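/- Let $m\ge 0$, $I\subset\{1,\dots,m\}$, $r=|I|$, and let $a\in\mathbb C$, $b,c\in\mathbb C^m$ satisfy $b_k,\ c_k-b_k,\ c_k\notin\mathbb Z$ for all $k$ and $a-\sum_{i\in S}c_i\notin\mathbb Z$ for all subsets $S\subset\{1,\dots,m\}$. Let $\varepsilon_1,\dots,\varepsilon_m,\varepsilon>0$ with $\varepsilon_k<\frac14$, $\varepsilon<1-\sum_k\varepsilon_k$, and let $0<x_k<\varepsilon_k$ be real with $\sum_k x_k(1+\varepsilon_k)<\varepsilon$. Put $v_I=1-\sum_{i\in I}s_i-\sum_{j\notin I}x_js_j$, $$u_I=\prod_{i\in I}s_i^{b_i}(s_i-x_i)^{c_i-b_i-1}\prod_{j\notin I}s_j^{b_j}(1-s_j)^{c_j-b_j-1}\cdot v_I^{-a},\qquad \varphi_I=\frac{ds_1\wedge\cdots\wedge ds_m}{s_1\cdots s_m},$$ and let $M_I\subset\mathbb C^m$ be the complement of the zero loci of $s_k$ (all $k$), $s_i-x_i$ ($i\in I$), $1-s_j$ ($j\notin I$) and $v_I$. Let $\sigma_I\subset\mathbb R^m$ be the polytope $s_i\ge\varepsilon_i$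 $(i\in I)$, $1-\sum_{i\in I}s_i\ge\varepsilon$, $\varepsilon_j\le s_j\le 1-\varepsilon_j$ $(j\notin I)$, a product of an $r$-simplex and $m-r$ intervals, with the standard orientation and the branch of $u_I$ all of whose factors are positive with argument $0$. Its facets correspond to the hyperplanes $L$ given by $s_k=0$ (all $k$), $1-s_j=0$ ($j\notin I$) and, if $I\neq\emptyset$, $1-\sum_{i\in I}s_i=0$; write $l_L$ for the facet belonging to $L$. Let $$\tilde\Delta_I=\sigma_I+\sum_{\emptyset\ne J}\ \prod_{L\in J}\frac1{d_L}\cdot\Big(\bigcap_{L\in J}l_L\Big)\times\prod_{L\in J}S_L$$ be the regularized twisted $m$-cycle in $M_I$, where $J$ runs over the sets of these hyperplanes for which $\bigcap_{L\in J} l_L\neq\emptyset$. On the cell of $J$, for every $L\in J$ the defining function ($s_k$, $1-s_j$ or $1-\sum_{i\in I}s_i$) of $L$ runs once, positively and starting at the facet, through the circle $S_L$ of radius $\varepsilon_k$, $\varepsilon_j$ or $\varepsilon$ around $0$, and the branch of $u_I$ is continued along it. Among the barycentric coordinates $s_i$ $(i\in I)$ and $1-\sum_{i\in I}s_i$ of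 the simplex, those that do not run through circles keep their distances from their minimal values $\varepsilon_i$, $\varepsilon$ up to a common factor, which is determined by the condition that the sum of all barycentric coordinates is $1$; the other coordinates $s_j$ $(j\notin I)$ do not change. The cell is oriented so that the angle on $S_L$ takes the place of the coordinate of $\sigma_I$ that grows from $l_L$ towards the interior. Here $$d_{(s_i=0)}=e^{2\pi\sqrt{-1}c_i}-1\ (i\in I),\quad d_{(s_j=0)}=e^{2\pi\sqrt{-1}b_j}-1,\quad d_{(1-s_j=0)}=e^{2\pi\sqrt{-1}(c_j-b_j)}-1\ (j\notin I),\quad d_{(1-\sum s_i=0)}=e^{-2\pi\sqrt{-1}a}-1 .$$ Let $$F_A(a,b,c;x)=\sum_{n\in\mathbb N^m}\frac{(a,\sum_k n_k)\prod_k(b_k,n_k)}{\prod_k(c_k,n_k)\prod_k n_k!}\prod_k x_k^{n_k}$$ be Lauricella's series, with the Pochhammer symbol $(z,n)=z(z+1)\cdots(z+n-1)$, and put $b^I=b+\sum_{i\in I}(1-c_i)e_i$, $c^I=c+2\sum_{i\in I}(1-c_i)e_i$, where $e_i$ is the $i$-th unit vector. Then the series $F_A\big(a+r-\sum_{i\in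 I}c_i,\,b^I,\,c^I;\,x\big)$ converges absolutely and $$\int_{\tilde\Delta_I}u_I\varphi_I=\prod_{i\in I}\Gamma(c_i-1)\cdot\prod_{j\notin I}\frac{\Gamma(b_j)\Gamma(c_j-b_j)}{\Gamma(c_j)}\cdot\frac{\Gamma(1-a)}{\Gamma\big(\sum_{i\in I}c_i-a-r+1\big)}\cdot F_A\Big(a+r-\sum_{i\in I}c_i,\,b^I,\,c^I;\,x\Big).$$ -/

import Mathlib

open scoped BigOperators ContDiff

noncomputable section

namespace LauricellaFA

/-! ### The series of Lauricella -/

/-- Pochhammer symbol `(z, n) = z (z + 1) ⋯ (z + n - 1)`. -/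
def poch (z : ℂ) (n : ℕ) : ℂ := (ascPochhammer ℂ n).eval z

/-- The `n`-th term of the series `F_A (a, b, c; x)`. -/
def termFA {m : ℕ} (a : ℂ) (b c : Fin m → ℂ) (x : Fin m → ℂ) (n : Fin m → ℕ) : ℂ :=
  poch a (∑ k, n k) * (∏ k, poch (b k) (n k)) /
    ((∏ k, poch (c k) (n k)) * ∏ k, ((n k).factorial : ℂ)) * ∏ k, x k ^ n k

/-- Lauricella's hypergeometric series `F_A (a, b, c; x)` in `m` variables. -/
def seriesFA {m : ℕ} (a : ℂ) (b c : Fin m → ℂ) (x : Fin m → ℂ) : ℂ :=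
  ∑' n : Fin m → ℕ, termFA a b c x n

/-- `b^I = b + ∑_{i ∈ I} (1 - c_i) e_i`. -/
def bShift {m : ℕ} (I : Finset (Fin m)) (b c : Fin m → ℂ) : Fin m → ℂ :=
  b + ∑ i ∈ I, (1 - c i) • Pi.single i (1 : ℂ)

/-- `c^I = c + 2 ∑_{i ∈ I} (1 - c_i) e_i`. -/
def cShift {m : ℕ} (I : Finset (Fin m)) (c : Fin m → ℂ) : Fin m → ℂ :=
  c + (2 : ℂ) • ∑ i ∈ I, (1 - c i) • Pi.single i (1 : ℂ)

/-! ### Twisted chains of top degree and their integrals -/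

/-- A loaded `m`-cell in `M = {s ∈ ℂ^m | P_j(s) ≠ 0 for all j}`: a smooth map defined on a
compact subset of `ℝ^m` (with its standard orientation), together with continuous branches of
all `log P_j` along it.  The equation `exp_logP` shows that the cell lies in `M`; the branches of
the logarithms determine a branch of `∏ P_j ^ λ_j` on the cell for all exponents `λ`. -/
structure LoadedCell {m : ℕ} {ι : Type} (P : ι → MvPolynomial (Fin m) ℂ) where
  dom : Set (Fin m → ℝ)
  map : (Fin m → ℝ) → (Fin m → ℂ)
  logP : ι → (Fin m → ℝ) → ℂ
  isCompact_dom : IsCompact dom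
  contDiff_map : ContDiff ℝ ∞ map
  continuousOn_logP : ∀ j, ContinuousOn (logP j) dom
  exp_logP : ∀ j, ∀ y ∈ dom, Complex.exp (logP j y) = MvPolynomial.eval (map y) (P j)

/-- The branch of `u = ∏ P_j ^ λ_j` loaded on the cell. -/
def LoadedCell.branch {m : ℕ} {ι : Type} [Fintype ι] {P : ι → MvPolynomial (Fin m) ℂ}
    (σ : LoadedCell P) (lam : ι → ℂ) (y : Fin m → ℝ) : ℂ :=
  Complex.exp (∑ j, lam j * σ.logP j y)

/-- The Jacobian determinant of the cell: the pull-back of `ds_1 ∧ ⋯ ∧ ds_m` is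
`jacobian y • dy_1 ∧ ⋯ ∧ dy_m`. -/
def LoadedCell.jacobian {m : ℕ} {ι : Type} {P : ι → MvPolynomial (Fin m) ℂ}
    (σ : LoadedCell P) (y : Fin m → ℝ) : ℂ :=
  (Matrix.of fun i k : Fin m => fderiv ℝ σ.map y (Pi.single k 1) i).det

/-- The integral of `u · g ds_1 ∧ ⋯ ∧ ds_m` over a loaded cell, `u = ∏ P_j ^ λ_j`. -/
def LoadedCell.integral {m : ℕ} {ι : Type} [Fintype ι] {P : ι → MvPolynomial (Fin m) ℂ}
    (σ : LoadedCell P) (lam : ι → ℂ) (g : (Fin m → ℂ) → ℂ) : ℂ :=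
  ∫ y in σ.dom, σ.branch lam y * g (σ.map y) * σ.jacobian y

/-- Twisted `m`-chains: formal finite `ℂ`-linear combinations of loaded cells. -/
abbrev TwistedChain {m : ℕ} {ι : Type} (P : ι → MvPolynomial (Fin m) ℂ) : Type :=
  LoadedCell P →₀ ℂ

/-- The integral of `u · g ds_1 ∧ ⋯ ∧ ds_m` over a twisted `m`-chain. -/
def chainIntegral {m : ℕ} {ι : Type} [Fintype ι] {P : ι → MvPolynomial (Fin m) ℂ}
    (Δ : TwistedChain P) (lam : ι → ℂ) (g : (Fin m → ℂ) → ℂ) : ℂ :=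
  Δ.sum fun σ w => w * σ.integral lam g

/-! ### The space `M_I` and the multivalued function `u_I` -/

/-- Index set of the polynomials defining `M_I`: `var k` stands for `s_k`, `side k` stands for
`s_k - x_k` if `k ∈ I` and for `1 - s_k` if `k ∉ I`, `slant` stands for `v_I`. -/
abbrev PolyIdx (m : ℕ) : Type := Fin m ⊕ Fin m ⊕ Unit

/-- The polynomials whose zero sets are removed from `ℂ^m` to get `M_I`. -/
def polyI {m : ℕ} (I : Finset (Fin m)) (x : Fin m → ℝ) : PolyIdx m → MvPolynomial (Fin m) ℂ
  | Sum.inl k => MvPolynomial.X k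
  | Sum.inr (Sum.inl k) =>
      if k ∈ I then MvPolynomial.X k - MvPolynomial.C (x k : ℂ) else 1 - MvPolynomial.X k
  | Sum.inr (Sum.inr _) =>
      1 - ∑ i ∈ I, MvPolynomial.X i - ∑ j ∈ Iᶜ, MvPolynomial.C (x j : ℂ) * MvPolynomial.X j

/-- The exponents of `u_I = ∏_{i ∈ I} s_i^{b_i} (s_i - x_i)^{c_i - b_i - 1} ·
∏_{j ∉ I} s_j^{b_j} (1 - s_j)^{c_j - b_j - 1} · v_I^{-a}`. -/
def expoI {m : ℕ} (a : ℂ) (b c : Fin m → ℂ) : PolyIdx m → ℂ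
  | Sum.inl k => b k
  | Sum.inr (Sum.inl k) => c k - b k - 1
  | Sum.inr (Sum.inr _) => -a

/-- The coefficient of `φ_I = ds_1 ∧ ⋯ ∧ ds_m / (s_1 ⋯ s_m)`. -/
def phiI {m : ℕ} (s : Fin m → ℂ) : ℂ := (∏ k, s k)⁻¹

/-! ### The polytope `σ_I`, its faces, and the tubes around them -/

/-- The conditions on the radii `ε_1, …, ε_m, ε` and on the variables `x_1, …, x_m`. -/
structure Admissible {m : ℕ} (ε : Fin m → ℝ) (ε₀ : ℝ) (x : Fin m → ℝ) : Prop where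
  eps_pos : ∀ k, 0 < ε k
  eps_lt : ∀ k, ε k < 1 / 4
  eps₀_pos : 0 < ε₀
  eps₀_lt : ε₀ < 1 - ∑ k, ε k
  x_pos : ∀ k, 0 < x k
  x_lt : ∀ k, x k < ε k
  sum_x_lt : ∑ k, x k * (1 + ε k) < ε₀

/-- The polytope `σ_I`, a product of an `r`-simplex and `m - r` intervals (`r = |I|`). -/
def polytope {m : ℕ} (I : Finset (Fin m)) (ε : Fin m → ℝ) (ε₀ : ℝ) : Set (Fin m → ℝ) :=
  {s | (∀ i ∈ I, ε i ≤ s i) ∧ ε₀ ≤ 1 - ∑ i ∈ I, s i ∧ ∀ j ∉ I, ε j ≤ s j ∧ ε j ≤ 1 - s j}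

/-- Labels of hyperplanes. -/
abbrev Hyp (m : ℕ) : Type := Fin m ⊕ Fin m ⊕ Unit

/-- The hyperplane `s_k = 0`. -/
abbrev hZero {m : ℕ} (k : Fin m) : Hyp m := Sum.inl k

/-- The hyperplane `1 - s_k = 0` (used for `k ∉ I` only). -/
abbrev hOne {m : ℕ} (k : Fin m) : Hyp m := Sum.inr (Sum.inl k)

/-- The hyperplane `1 - ∑_{i ∈ I} s_i = 0` (used for `I ≠ ∅` only). -/
abbrev hSum {m : ℕ} : Hyp m := Sum.inr (Sum.inr ())

/-- The sets `J` of hyperplanes (among `s_k = 0` for all `k`, `1 - s_j = 0` for `j ∉ I`, and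
`1 - ∑_{i ∈ I} s_i = 0` if `I ≠ ∅`) for which the corresponding face of the polytope is not empty:
`J` must not contain both `s_j = 0` and `1 - s_j = 0`, and must not contain all the walls of the
simplex. -/
abbrev Stratum {m : ℕ} (I : Finset (Fin m)) : Type :=
  {J : Finset (Hyp m) //
    (∀ k, hOne k ∈ J → k ∉ I ∧ hZero k ∉ J) ∧ (hSum ∈ J → ∃ i ∈ I, hZero i ∉ J)}

/-- The coordinates of the simplex that are not fixed by `J`. -/
def freeIdx {m : ℕ} {I : Finset (Fin m)} (J : Stratum I) : Finset (Fin m) :=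
  I.filter fun i => hZero i ∉ J.1

/-- If `J` contains the wall `1 - ∑ s_i = 0`, then the coordinate `s_i` of the simplex, with `i`
the following index, is determined by the others on the face, and the slot `i` of the
parameter `y ∈ ℝ^m` is used for the angle around this wall. -/
def pivot {m : ℕ} {I : Finset (Fin m)} (J : Stratum I) (h : hSum ∈ J.1) : Fin m :=
  (freeIdx J).min' (by
    obtain ⟨i, hi, hJ⟩ := J.2.2 h
    exact ⟨i, Finset.mem_filter.2 ⟨hi, hJ⟩⟩)

/-- The point `ρ e^{√-1 θ}` of the positively oriented circle of radius `ρ` that starts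
at `ρ`. -/
def circ (ρ θ : ℝ) : ℂ := (ρ : ℂ) * Complex.exp ((θ : ℂ) * Complex.I)

/-- The point of the face `⋂_{j ∈ J} l_j` of `σ_I` with the coordinates `y` (those slots of `y`
that are angles around the walls in `J` are ignored), before the simplex wall `hSum` is taken
into account. -/
def faceCoord {m : ℕ} {I : Finset (Fin m)} (ε : Fin m → ℝ) (J : Stratum I)
    (y : Fin m → ℝ) (k : Fin m) : ℝ :=
  if hZero k ∈ J.1 then ε k else if hOne k ∈ J.1 then 1 - ε k else y k

/-- The point of the face `⋂_{j ∈ J} l_j` of `σ_I` with the coordinates `y` (those slots of `y`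
that are angles around the walls in `J` are ignored). -/
def facePoint {m : ℕ} {I : Finset (Fin m)} (ε : Fin m → ℝ) (ε₀ : ℝ) (J : Stratum I)
    (y : Fin m → ℝ) (k : Fin m) : ℝ :=
  if ∃ h : hSum ∈ J.1, k = pivot J h then 1 - ε₀ - ∑ i ∈ I.erase k, faceCoord ε J y i
  else faceCoord ε J y k

/-- The parameter domain of the cell `(⋂_{j ∈ J} l_j) × ∏_{j ∈ J} S_j`. -/
def cellDom {m : ℕ} {I : Finset (Fin m)} (ε : Fin m → ℝ) (ε₀ : ℝ) (J : Stratum I) :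
    Set (Fin m → ℝ) :=
  {y | facePoint ε ε₀ J y ∈ polytope I ε ε₀ ∧
    (∀ k, hZero k ∈ J.1 ∨ hOne k ∈ J.1 → y k ∈ Set.Icc 0 (2 * Real.pi)) ∧
    ∀ h : hSum ∈ J.1, y (pivot J h) ∈ Set.Icc 0 (2 * Real.pi)}

/-- The displacement of the point `1 - ∑_{i ∈ I} s_i` of its circle from the starting point
(zero if `J` does not contain the wall `hSum`). -/
def outerDefect {m : ℕ} {I : Finset (Fin m)} (ε₀ : ℝ) (J : Stratum I) (y : Fin m → ℝ) : ℂ :=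
  if h : hSum ∈ J.1 then (ε₀ : ℂ) - circ ε₀ (y (pivot J h)) else 0

/-- The dilation factor by which the barycentric coordinates of the simplex that do not move on
circles are stretched (from their minimal values `ε_k`, `ε`), so that all the barycentric
coordinates keep the sum `1`. -/
def dilation {m : ℕ} {I : Finset (Fin m)} (ε : Fin m → ℝ) (ε₀ : ℝ) (J : Stratum I)
    (y : Fin m → ℝ) : ℂ :=
  1 + (∑ i ∈ I.filter (fun i => hZero i ∈ J.1), ((ε i : ℂ) - circ (ε i) (y i))
      + outerDefect ε₀ J y) / ((1 - ∑ i ∈ I, ε i - ε₀ : ℝ) : ℂ)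

/-- The cell `(⋂_{j ∈ J} l_j) × ∏_{j ∈ J} S_j`: the functions `s_k`, `1 - s_k`,
`1 - ∑_{i ∈ I} s_i` belonging to the walls in `J` run through circles of radius `ε_k`, `ε_k`, `ε`;
the other coordinates of the simplex are `ε_k + dilation * (· - ε_k)`, so that the walls of the
face not in `J` stay where `s_k = ε_k`, `1 - ∑ s_i = ε`, respectively. For `J = ∅` this is
the polytope `σ_I` itself. -/
def cellMap {m : ℕ} {I : Finset (Fin m)} (ε : Fin m → ℝ) (ε₀ : ℝ) (J : Stratum I)
    (y : Fin m → ℝ) (k : Fin m) : ℂ :=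
  if hZero k ∈ J.1 then circ (ε k) (y k)
  else if hOne k ∈ J.1 then 1 - circ (ε k) (y k)
  else if k ∈ I then
    (ε k : ℂ) + dilation ε ε₀ J y * ((facePoint ε ε₀ J y k - ε k : ℝ) : ℂ)
  else (y k : ℂ)

/-- The value of `1 - ∑_{i ∈ I} s_i` on the cell. -/
def simplexRest {m : ℕ} {I : Finset (Fin m)} (ε : Fin m → ℝ) (ε₀ : ℝ) (J : Stratum I)
    (y : Fin m → ℝ) : ℂ :=
  1 - ∑ i ∈ I, cellMap ε ε₀ J y i

/-- The branch of `log (1 - ∑_{i ∈ I} s_i)` on the cell. -/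
def logRest {m : ℕ} {I : Finset (Fin m)} (ε : Fin m → ℝ) (ε₀ : ℝ) (J : Stratum I)
    (y : Fin m → ℝ) : ℂ :=
  if h : hSum ∈ J.1 then (Real.log ε₀ : ℂ) + (y (pivot J h) : ℂ) * Complex.I
  else Complex.log (simplexRest ε ε₀ J y)

/-- The branch of `log s_k` on the cell. -/
def logCoord {m : ℕ} {I : Finset (Fin m)} (ε : Fin m → ℝ) (ε₀ : ℝ) (J : Stratum I)
    (y : Fin m → ℝ) (k : Fin m) : ℂ :=
  if hZero k ∈ J.1 then (Real.log (ε k) : ℂ) + (y k : ℂ) * Complex.I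
  else Complex.log (cellMap ε ε₀ J y k)

/-- The branches of the logarithms on the cell that continue the real values on `σ_I`.  The
argument of a function that runs through a circle is the angle; `x_i / s_i` and
`∑_j x_j s_j / (1 - ∑_i s_i)` have absolute value less than `1`, hence `s_i - x_i` and `v_I` follow
the arguments of `s_i` and `1 - ∑_i s_i`. -/
def cellLog {m : ℕ} {I : Finset (Fin m)} (ε : Fin m → ℝ) (ε₀ : ℝ) (x : Fin m → ℝ)
    (J : Stratum I) : PolyIdx m → (Fin m → ℝ) → ℂ
  | Sum.inl k => fun y => logCoord ε ε₀ J y k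
  | Sum.inr (Sum.inl k) => fun y =>
      if k ∈ I then
        logCoord ε ε₀ J y k + Complex.log (1 - (x k : ℂ) / cellMap ε ε₀ J y k)
      else if hOne k ∈ J.1 then (Real.log (ε k) : ℂ) + (y k : ℂ) * Complex.I
      else Complex.log (1 - cellMap ε ε₀ J y k)
  | Sum.inr (Sum.inr _) => fun y =>
      logRest ε ε₀ J y +
        Complex.log (1 - (∑ j ∈ Iᶜ, (x j : ℂ) * cellMap ε ε₀ J y j) / simplexRest ε ε₀ J y)

/-! ### The cell is a loaded cell -/

section facts

variable {m : ℕ} {I : Finset (Fin m)} {ε : Fin m → ℝ} {ε₀ : ℝ} {x : Fin m → ℝ}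

theorem circ_re_le {ρ : ℝ} (h : 0 < ρ) (θ : ℝ) : (circ ρ θ).re ≤ ρ := by
  unfold circ
  rw [Complex.re_ofReal_mul, Complex.exp_ofReal_mul_I_re]
  nlinarith [Real.cos_le_one θ]

theorem norm_circ {ρ : ℝ} (h : 0 < ρ) (θ : ℝ) : ‖circ ρ θ‖ = ρ := by
  unfold circ
  rw [norm_mul, Complex.norm_exp_ofReal_mul_I, mul_one, Complex.norm_real, Real.norm_of_nonneg h.le]

theorem exp_log_circ {ρ : ℝ} (h : 0 < ρ) (θ : ℝ) :
    Complex.exp ((Real.log ρ : ℂ) + (θ : ℂ) * Complex.I) = circ ρ θ := by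
  rw [Complex.exp_add, ← Complex.ofReal_exp, Real.exp_log h, circ]

theorem contDiff_circ (ρ : ℝ) : ContDiff ℝ ∞ (circ ρ) := by
  unfold circ
  exact contDiff_const.mul
    (Complex.contDiff_exp.comp (Complex.ofRealCLM.contDiff.mul contDiff_const))

theorem sum_eps_lt (h : Admissible ε ε₀ x) (I : Finset (Fin m)) :
    0 < 1 - ∑ i ∈ I, ε i - ε₀ := by
  have h1 : ∑ i ∈ I, ε i ≤ ∑ i, ε i :=
    Finset.sum_le_univ_sum_of_nonneg fun k => (h.eps_pos k).le
  linarith [h.eps₀_lt]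

theorem one_le_dilation_re (h : Admissible ε ε₀ x) (J : Stratum I) (y : Fin m → ℝ) :
    1 ≤ (dilation ε ε₀ J y).re := by
  unfold dilation
  rw [Complex.add_re, Complex.div_ofReal_re, Complex.one_re]
  have h1 : 0 ≤ (outerDefect ε₀ J y).re := by
    unfold outerDefect
    split_ifs with hJ
    · have := circ_re_le h.eps₀_pos (y (pivot J hJ))
      simpa using this
    · simp
  have h2 : 0 ≤ (∑ i ∈ I.filter (fun i => hZero i ∈ J.1),
      ((ε i : ℂ) - circ (ε i) (y i))).re := by
    rw [Complex.re_sum]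
    refine Finset.sum_nonneg fun i _ => ?_
    have := circ_re_le (h.eps_pos i) (y i)
    simpa using this
  have := div_nonneg (add_nonneg h2 h1) (sum_eps_lt h I).le
  rw [Complex.add_re]
  linarith

theorem contDiff_facePoint (J : Stratum I) (k : Fin m) :
    ContDiff ℝ ∞ fun y => facePoint ε ε₀ J y k := by
  have h1 : ∀ i, ContDiff ℝ ∞ fun y => faceCoord ε J y i := by
    intro i
    unfold faceCoord
    split_ifs <;> fun_prop
  unfold facePoint
  split_ifs
  · exact contDiff_const.sub (ContDiff.sum fun i _ => h1 i)
  · exact h1 k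

theorem contDiff_circ_apply (ρ : ℝ) (k : Fin m) :
    ContDiff ℝ ∞ fun y : Fin m → ℝ => circ ρ (y k) :=
  (contDiff_circ ρ).comp (contDiff_apply ℝ ℝ k)

theorem contDiff_dilation (J : Stratum I) :
    ContDiff ℝ ∞ fun y => dilation ε ε₀ J y := by
  have h1 : ContDiff ℝ ∞ fun y => outerDefect ε₀ J y := by
    unfold outerDefect
    split_ifs
    · exact contDiff_const.sub (contDiff_circ_apply _ _)
    · exact contDiff_const
  unfold dilation
  exact contDiff_const.add (((ContDiff.sum fun i _ =>
    contDiff_const.sub (contDiff_circ_apply _ _)).add h1).div_const _)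

theorem contDiff_cellMap_apply (J : Stratum I) (k : Fin m) :
    ContDiff ℝ ∞ fun y => cellMap ε ε₀ J y k := by
  unfold cellMap
  split_ifs
  · exact contDiff_circ_apply _ _
  · exact contDiff_const.sub (contDiff_circ_apply _ _)
  · exact contDiff_const.add ((contDiff_dilation J).mul
      (Complex.ofRealCLM.contDiff.comp ((contDiff_facePoint J k).sub contDiff_const)))
  · exact Complex.ofRealCLM.contDiff.comp (contDiff_apply ℝ ℝ k)

theorem facePoint_of_zero {J : Stratum I} {k : Fin m} (hk : hZero k ∈ J.1) (y : Fin m → ℝ) :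
    facePoint ε ε₀ J y k = ε k := by
  unfold facePoint
  rw [if_neg, faceCoord, if_pos hk]
  rintro ⟨h, rfl⟩
  exact (Finset.mem_filter.1 ((freeIdx J).min'_mem _)).2 hk

theorem facePoint_of_notMem {J : Stratum I} {k : Fin m} (hI : k ∉ I) (y : Fin m → ℝ) :
    facePoint ε ε₀ J y k = faceCoord ε J y k := by
  unfold facePoint
  rw [if_neg]
  rintro ⟨h, rfl⟩
  exact hI (Finset.mem_filter.1 ((freeIdx J).min'_mem _)).1

theorem sum_facePoint {J : Stratum I} (hJ : hSum ∈ J.1) (y : Fin m → ℝ) :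
    ∑ i ∈ I, facePoint ε ε₀ J y i = 1 - ε₀ := by
  have hp : pivot J hJ ∈ I := (Finset.mem_filter.1 ((freeIdx J).min'_mem _)).1
  rw [← Finset.add_sum_erase I _ hp]
  have h1 : ∑ i ∈ I.erase (pivot J hJ), facePoint ε ε₀ J y i =
      ∑ i ∈ I.erase (pivot J hJ), faceCoord ε J y i := by
    refine Finset.sum_congr rfl fun i hi => ?_
    unfold facePoint
    rw [if_neg]
    rintro ⟨h, hh⟩
    exact (Finset.mem_erase.1 hi).1 hh
  rw [h1]
  unfold facePoint
  rw [if_pos ⟨hJ, rfl⟩]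
  ring

/-- The function `1 - ∑ s_i` on a cell. -/
theorem simplexRest_eq (h : Admissible ε ε₀ x) (J : Stratum I) (y : Fin m → ℝ) :
    simplexRest ε ε₀ J y = (ε₀ : ℂ) - outerDefect ε₀ J y +
      dilation ε ε₀ J y * ((1 - ∑ i ∈ I, facePoint ε ε₀ J y i - ε₀ : ℝ) : ℂ) := by
  have h1 : ∀ i ∈ I, cellMap ε ε₀ J y i =
      (ε i : ℂ) + dilation ε ε₀ J y * ((facePoint ε ε₀ J y i - ε i : ℝ) : ℂ) -
        if hZero i ∈ J.1 then (ε i : ℂ) - circ (ε i) (y i) else 0 := by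
    intro i hi
    unfold cellMap
    by_cases hz : hZero i ∈ J.1
    · rw [if_pos hz, if_pos hz, facePoint_of_zero hz]
      simp
    · rw [if_neg hz, if_neg hz, if_neg (fun ho => (J.2.1 i ho).1 hi), if_pos hi, sub_zero]
  have hN : ((1 - ∑ i ∈ I, ε i - ε₀ : ℝ) : ℂ) ≠ 0 := by
    exact_mod_cast (sum_eps_lt h I).ne'
  have h2 : dilation ε ε₀ J y * ((1 - ∑ i ∈ I, ε i - ε₀ : ℝ) : ℂ) =
      ((1 - ∑ i ∈ I, ε i - ε₀ : ℝ) : ℂ) +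
      ((∑ i ∈ I, if hZero i ∈ J.1 then (ε i : ℂ) - circ (ε i) (y i) else 0)
        + outerDefect ε₀ J y) := by
    unfold dilation
    rw [Finset.sum_filter, add_mul, div_mul_cancel₀ _ hN, one_mul]
  unfold simplexRest
  rw [Finset.sum_congr rfl h1, Finset.sum_sub_distrib, Finset.sum_add_distrib, ← Finset.mul_sum]
  push_cast at h2 ⊢
  rw [Finset.sum_sub_distrib]
  linear_combination (-1 : ℂ) * h2

theorem simplexRest_of_mem (h : Admissible ε ε₀ x) {J : Stratum I} (hJ : hSum ∈ J.1)
    (y : Fin m → ℝ) : simplexRest ε ε₀ J y = circ ε₀ (y (pivot J hJ)) := by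
  rw [simplexRest_eq h, sum_facePoint hJ, outerDefect, dif_pos hJ]
  push_cast
  ring

theorem le_simplexRest_re (h : Admissible ε ε₀ x) {J : Stratum I} (hJ : hSum ∉ J.1)
    {y : Fin m → ℝ} (hy : y ∈ cellDom ε ε₀ J) : ε₀ ≤ (simplexRest ε ε₀ J y).re := by
  rw [simplexRest_eq h, outerDefect, dif_neg hJ]
  have h1 := one_le_dilation_re h J y
  have h2 : 0 ≤ 1 - ∑ i ∈ I, facePoint ε ε₀ J y i - ε₀ := by
    have := hy.1.2.1
    linarith
  simp only [sub_zero, Complex.add_re, Complex.ofReal_re, Complex.re_mul_ofReal]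
  nlinarith

theorem le_norm_simplexRest (h : Admissible ε ε₀ x) {J : Stratum I}
    {y : Fin m → ℝ} (hy : y ∈ cellDom ε ε₀ J) : ε₀ ≤ ‖simplexRest ε ε₀ J y‖ := by
  by_cases hJ : hSum ∈ J.1
  · rw [simplexRest_of_mem h hJ, norm_circ h.eps₀_pos]
  · exact (le_simplexRest_re h hJ hy).trans (Complex.re_le_norm _)

theorem le_cellMap_re (h : Admissible ε ε₀ x) {J : Stratum I} {k : Fin m}
    (hJ : hZero k ∉ J.1) {y : Fin m → ℝ} (hy : y ∈ cellDom ε ε₀ J) :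
    ε k ≤ (cellMap ε ε₀ J y k).re := by
  unfold cellMap
  rw [if_neg hJ]
  split_ifs with ho hI
  · have := circ_re_le (h.eps_pos k) (y k)
    have := h.eps_lt k
    simp only [Complex.sub_re, Complex.one_re]
    linarith
  · have h1 := one_le_dilation_re h J y
    have h2 := hy.1.1 k hI
    simp only [Complex.add_re, Complex.ofReal_re, Complex.re_mul_ofReal]
    nlinarith
  · have h2 := (hy.1.2.2 k hI).1
    rw [facePoint_of_notMem hI, faceCoord, if_neg hJ, if_neg ho] at h2
    simpa using h2

theorem le_norm_cellMap (h : Admissible ε ε₀ x) {J : Stratum I} (k : Fin m)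
    {y : Fin m → ℝ} (hy : y ∈ cellDom ε ε₀ J) : ε k ≤ ‖cellMap ε ε₀ J y k‖ := by
  by_cases hJ : hZero k ∈ J.1
  · unfold cellMap
    rw [if_pos hJ, norm_circ (h.eps_pos k)]
  · exact (le_cellMap_re h hJ hy).trans (Complex.re_le_norm _)

theorem one_sub_cellMap_re_pos (h : Admissible ε ε₀ x) {J : Stratum I} {k : Fin m}
    (hI : k ∉ I) (hJ : hOne k ∉ J.1) {y : Fin m → ℝ} (hy : y ∈ cellDom ε ε₀ J) :
    0 < (1 - cellMap ε ε₀ J y k).re := by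
  unfold cellMap
  rw [if_neg hJ, if_neg hI]
  split_ifs with hz
  · have := circ_re_le (h.eps_pos k) (y k)
    have := h.eps_lt k
    simp only [Complex.sub_re, Complex.one_re]
    linarith
  · have h2 := (hy.1.2.2 k hI).2
    rw [facePoint_of_notMem hI, faceCoord, if_neg hz, if_neg hJ] at h2
    have := h.eps_pos k
    simp only [Complex.sub_re, Complex.one_re, Complex.ofReal_re]
    linarith

theorem norm_cellMap_le (h : Admissible ε ε₀ x) {J : Stratum I} {k : Fin m}
    (hI : k ∉ I) {y : Fin m → ℝ} (hy : y ∈ cellDom ε ε₀ J) :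
    ‖cellMap ε ε₀ J y k‖ ≤ 1 + ε k := by
  have h0 := h.eps_pos k
  unfold cellMap
  rw [if_neg hI]
  split_ifs with hz ho
  · rw [norm_circ h0]
    linarith
  · refine (norm_sub_le _ _).trans ?_
    rw [norm_circ h0, norm_one]
  · have h2 := hy.1.2.2 k hI
    rw [facePoint_of_notMem hI, faceCoord, if_neg hz, if_neg ho] at h2
    rw [Complex.norm_real, Real.norm_of_nonneg (by linarith [h2.1])]
    linarith [h2.2]

theorem one_sub_re_pos {z : ℂ} (hz : ‖z‖ < 1) : 0 < (1 - z).re := by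
  have := Complex.re_le_norm z
  simp only [Complex.sub_re, Complex.one_re]
  linarith

theorem norm_ratio_lt (h : Admissible ε ε₀ x) {J : Stratum I} (k : Fin m)
    {y : Fin m → ℝ} (hy : y ∈ cellDom ε ε₀ J) :
    ‖(x k : ℂ) / cellMap ε ε₀ J y k‖ < 1 := by
  have h1 := le_norm_cellMap h k hy
  have h2 := h.x_lt k
  have h3 := h.x_pos k
  rw [norm_div, Complex.norm_real, Real.norm_of_nonneg h3.le, div_lt_one (by linarith)]
  linarith

theorem norm_sum_ratio_lt (h : Admissible ε ε₀ x) {J : Stratum I}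
    {y : Fin m → ℝ} (hy : y ∈ cellDom ε ε₀ J) :
    ‖(∑ j ∈ Iᶜ, (x j : ℂ) * cellMap ε ε₀ J y j) / simplexRest ε ε₀ J y‖ < 1 := by
  have h1 := le_norm_simplexRest h hy
  have h2 := h.eps₀_pos
  rw [norm_div, div_lt_one (by linarith)]
  refine lt_of_lt_of_le ?_ h1
  refine lt_of_le_of_lt ?_ h.sum_x_lt
  refine (norm_sum_le _ _).trans ?_
  refine le_trans (Finset.sum_le_sum (g := fun j => x j * (1 + ε j)) fun j hj => ?_)
    (Finset.sum_le_univ_sum_of_nonneg fun j =>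
      mul_nonneg (h.x_pos j).le (by linarith [h.eps_pos j]))
  rw [norm_mul, Complex.norm_real, Real.norm_of_nonneg (h.x_pos j).le]
  exact mul_le_mul_of_nonneg_left (norm_cellMap_le h (Finset.mem_compl.1 hj) hy) (h.x_pos j).le

theorem ne_zero_of_re_pos {z : ℂ} (hz : 0 < z.re) : z ≠ 0 := by
  rintro rfl
  simp at hz

theorem exp_logRest (h : Admissible ε ε₀ x) {J : Stratum I} {y : Fin m → ℝ}
    (hy : y ∈ cellDom ε ε₀ J) : Complex.exp (logRest ε ε₀ J y) = simplexRest ε ε₀ J y := by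
  unfold logRest
  split_ifs with hJ
  · rw [simplexRest_of_mem h hJ, exp_log_circ h.eps₀_pos]
  · exact Complex.exp_log (ne_zero_of_re_pos (h.eps₀_pos.trans_le (le_simplexRest_re h hJ hy)))

theorem exp_logCoord (h : Admissible ε ε₀ x) {J : Stratum I} {y : Fin m → ℝ}
    (hy : y ∈ cellDom ε ε₀ J) (k : Fin m) :
    Complex.exp (logCoord ε ε₀ J y k) = cellMap ε ε₀ J y k := by
  unfold logCoord
  split_ifs with hJ
  · rw [exp_log_circ (h.eps_pos k), cellMap, if_pos hJ]
  · exact Complex.exp_log (ne_zero_of_re_pos ((h.eps_pos k).trans_le (le_cellMap_re h hJ hy)))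

theorem exp_cellLog (h : Admissible ε ε₀ x) (J : Stratum I) (j : PolyIdx m) (y : Fin m → ℝ)
    (hy : y ∈ cellDom ε ε₀ J) :
    Complex.exp (cellLog ε ε₀ x J j y) = MvPolynomial.eval (cellMap ε ε₀ J y) (polyI I x j) := by
  rcases j with k | k | u
  · simp only [cellLog]
    rw [exp_logCoord h hy]
    simp [polyI]
  · simp only [cellLog, polyI]
    by_cases hI : k ∈ I
    · have hne : cellMap ε ε₀ J y k ≠ 0 :=
        norm_pos_iff.1 ((h.eps_pos k).trans_le (le_norm_cellMap h k hy))
      rw [if_pos hI, if_pos hI, Complex.exp_add, exp_logCoord h hy,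
        Complex.exp_log (ne_zero_of_re_pos (one_sub_re_pos (norm_ratio_lt h k hy)))]
      simp only [map_sub, MvPolynomial.eval_X, MvPolynomial.eval_C]
      field_simp
    · rw [if_neg hI, if_neg hI]
      simp only [map_sub, map_one, MvPolynomial.eval_X]
      split_ifs with hJ
      · rw [exp_log_circ (h.eps_pos k), cellMap, if_neg (J.2.1 k hJ).2, if_pos hJ]
        ring
      · exact Complex.exp_log (ne_zero_of_re_pos (one_sub_cellMap_re_pos h hI hJ hy))
  · unfold cellLog polyI
    have hne : simplexRest ε ε₀ J y ≠ 0 :=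
      norm_pos_iff.1 (h.eps₀_pos.trans_le (le_norm_simplexRest h hy))
    rw [Complex.exp_add, exp_logRest h hy,
      Complex.exp_log (ne_zero_of_re_pos (one_sub_re_pos (norm_sum_ratio_lt h hy))),
      mul_sub, mul_one, mul_div_cancel₀ _ hne]
    simp [simplexRest]

theorem continuousOn_clog {X : Type} [TopologicalSpace X] {S : Set X} {f : X → ℂ}
    (hf : ContinuousOn f S) (hpos : ∀ y ∈ S, 0 < (f y).re) :
    ContinuousOn (fun y => Complex.log (f y)) S :=
  hf.clog fun y hy => Or.inl (hpos y hy)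

theorem continuousOn_logCoord (h : Admissible ε ε₀ x) (J : Stratum I) (k : Fin m) :
    ContinuousOn (fun y => logCoord ε ε₀ J y k) (cellDom ε ε₀ J) := by
  unfold logCoord
  split_ifs with hJ
  · fun_prop
  · exact continuousOn_clog (contDiff_cellMap_apply J k).continuous.continuousOn
      fun y hy => (h.eps_pos k).trans_le (le_cellMap_re h hJ hy)

theorem continuousOn_cellLog (h : Admissible ε ε₀ x) (J : Stratum I) (j : PolyIdx m) :
    ContinuousOn (cellLog ε ε₀ x J j) (cellDom ε ε₀ J) := by
  have hc : ∀ k, Continuous fun y => cellMap ε ε₀ J y k :=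
    fun k => (contDiff_cellMap_apply J k).continuous
  have hr : Continuous fun y => simplexRest ε ε₀ J y := by
    unfold simplexRest
    fun_prop
  rcases j with k | k | u
  · exact continuousOn_logCoord h J k
  · by_cases hI : k ∈ I
    · have h1 : cellLog ε ε₀ x J (Sum.inr (Sum.inl k)) = fun y =>
          logCoord ε ε₀ J y k + Complex.log (1 - (x k : ℂ) / cellMap ε ε₀ J y k) := by
        funext y
        simp only [cellLog, if_pos hI]
      rw [h1]
      refine (continuousOn_logCoord h J k).add (continuousOn_clog ?_
        fun y hy => one_sub_re_pos (norm_ratio_lt h k hy))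
      exact continuousOn_const.sub (continuousOn_const.div (hc k).continuousOn
        fun y hy => norm_pos_iff.1 ((h.eps_pos k).trans_le (le_norm_cellMap h k hy)))
    · unfold cellLog
      simp only [if_neg hI]
      split_ifs with hJ
      · fun_prop
      · exact continuousOn_clog (continuous_const.sub (hc k)).continuousOn
          fun y hy => one_sub_cellMap_re_pos h hI hJ hy
  · unfold cellLog
    refine ContinuousOn.add ?_ (continuousOn_clog ?_
      fun y hy => one_sub_re_pos (norm_sum_ratio_lt h hy))
    · unfold logRest
      split_ifs with hJ
      · fun_prop
      · exact continuousOn_clog hr.continuousOn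
          fun y hy => h.eps₀_pos.trans_le (le_simplexRest_re h hJ hy)
    · refine continuousOn_const.sub (ContinuousOn.div ?_ hr.continuousOn
        fun y hy => norm_pos_iff.1 (h.eps₀_pos.trans_le (le_norm_simplexRest h hy)))
      fun_prop

theorem isCompact_cellDom (h : Admissible ε ε₀ x) (J : Stratum I) :
    IsCompact (cellDom ε ε₀ J) := by
  have hf : ∀ k, Continuous fun y => facePoint ε ε₀ J y k :=
    fun k => (contDiff_facePoint J k).continuous
  refine Metric.isCompact_of_isClosed_isBounded ?_ ?_
  · have : cellDom ε ε₀ J =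
        (⋂ i ∈ I, {y | ε i ≤ facePoint ε ε₀ J y i}) ∩
        {y | ε₀ ≤ 1 - ∑ i ∈ I, facePoint ε ε₀ J y i} ∩
        (⋂ j : Fin m, ⋂ (_ : j ∉ I),
          ({y | ε j ≤ facePoint ε ε₀ J y j} ∩ {y | ε j ≤ 1 - facePoint ε ε₀ J y j})) ∩
        (⋂ k, ⋂ (_ : hZero k ∈ J.1 ∨ hOne k ∈ J.1),
          {y : Fin m → ℝ | y k ∈ Set.Icc 0 (2 * Real.pi)}) ∩
        ⋂ h : hSum ∈ J.1, {y | y (pivot J h) ∈ Set.Icc 0 (2 * Real.pi)} := by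
      ext y
      simp only [cellDom, polytope, Set.mem_ofPred_eq, Set.mem_inter_iff, Set.mem_iInter]
      tauto
    rw [this]
    refine (((IsClosed.inter ?_ ?_).inter ?_).inter ?_).inter ?_
    · exact isClosed_biInter fun i _ => isClosed_le continuous_const (hf i)
    · exact isClosed_le continuous_const
        (continuous_const.sub (continuous_finsetSum _ fun i _ => hf i))
    · exact isClosed_iInter fun j => isClosed_iInter fun _ =>
        (isClosed_le continuous_const (hf j)).inter
          (isClosed_le continuous_const (continuous_const.sub (hf j)))
    · exact isClosed_iInter fun k => isClosed_iInter fun _ =>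
        isClosed_Icc.preimage (continuous_apply k)
    · exact isClosed_iInter fun h => isClosed_Icc.preimage (continuous_apply _)
  · refine (Metric.isBounded_Icc (0 : Fin m → ℝ) fun _ => 1 + 2 * Real.pi).subset ?_
    intro y hy
    have hpi := Real.pi_pos
    have key : ∀ k, 0 ≤ y k ∧ y k ≤ 1 + 2 * Real.pi := by
      intro k
      by_cases h1 : hZero k ∈ J.1 ∨ hOne k ∈ J.1
      · have := hy.2.1 k h1
        exact ⟨this.1, by linarith [this.2]⟩
      by_cases h2 : ∃ h : hSum ∈ J.1, k = pivot J h
      · obtain ⟨hJ, rfl⟩ := h2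
        have := hy.2.2 hJ
        exact ⟨this.1, by linarith [this.2]⟩
      push Not at h1
      have h3 : facePoint ε ε₀ J y k = y k := by
        rw [facePoint, if_neg h2, faceCoord, if_neg h1.1, if_neg h1.2]
      by_cases hI : k ∈ I
      · have h4 := hy.1.1 k hI
        have h5 := hy.1.2.1
        have h6 : facePoint ε ε₀ J y k ≤ ∑ i ∈ I, facePoint ε ε₀ J y i :=
          Finset.single_le_sum (f := fun i => facePoint ε ε₀ J y i)
            (fun i hi => (h.eps_pos i).le.trans (hy.1.1 i hi)) hI
        rw [h3] at h4 h6
        have := h.eps_pos k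
        have := h.eps₀_pos
        constructor <;> linarith
      · have h4 := hy.1.2.2 k hI
        rw [h3] at h4
        have := h.eps_pos k
        constructor <;> linarith [h4.1, h4.2]
    exact ⟨fun k => (key k).1, fun k => (key k).2⟩

end facts

/-- The loaded cell `(⋂_{j ∈ J} l_j) × ∏_{j ∈ J} S_j` in `M_I`. -/
def tubeCell {m : ℕ} {I : Finset (Fin m)} {ε : Fin m → ℝ} {ε₀ : ℝ} {x : Fin m → ℝ}
    (h : Admissible ε ε₀ x) (J : Stratum I) : LoadedCell (polyI I x) where
  dom := cellDom ε ε₀ J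
  map := cellMap ε ε₀ J
  logP := cellLog ε ε₀ x J
  isCompact_dom := isCompact_cellDom h J
  contDiff_map := contDiff_pi.2 fun k => contDiff_cellMap_apply J k
  continuousOn_logP := continuousOn_cellLog h J
  exp_logP := exp_cellLog h J

/-! ### The regularized cycle and its integral -/

/-- `d_j = e^{2π√-1 μ} - 1`, where `e^{2π√-1 μ}` is the monodromy of `u_I` along the circle `S_j`:
`γ_i - 1` and `β_j - 1` for `s_i = 0`, `i ∈ I`, and `s_j = 0`, `j ∉ I`; `γ_j β_j⁻¹ - 1` for
`1 - s_j = 0`; `α⁻¹ - 1` for `1 - ∑_{i ∈ I} s_i = 0`. -/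
def dCoef {m : ℕ} (I : Finset (Fin m)) (a : ℂ) (b c : Fin m → ℂ) : Hyp m → ℂ
  | Sum.inl k => Complex.exp (2 * Real.pi * Complex.I * (if k ∈ I then c k else b k)) - 1
  | Sum.inr (Sum.inl k) => Complex.exp (2 * Real.pi * Complex.I * (c k - b k)) - 1
  | Sum.inr (Sum.inr _) => Complex.exp (2 * Real.pi * Complex.I * (-a)) - 1

/-- Orientation of the tubes: the circle `S_j` replaces the coordinate that vanishes on the wall
and grows towards the interior of `σ_I`. In the parametrization `cellMap`, the angle sits in the
slot of a coordinate that grows towards the interior at the walls `s_k = 0`, and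
towards the exterior at the walls `1 - s_k = 0` and `1 - ∑_{i ∈ I} s_i = 0`. -/
def orient {m : ℕ} : Hyp m → ℂ
  | Sum.inl _ => 1
  | Sum.inr _ => -1

/-- The twisted cycle `σ_I + ∑_{J ≠ ∅} ∏_{j ∈ J} (1 / d_j) · (⋂_{j ∈ J} l_j) × ∏_{j ∈ J} S_j`;
the term `J = ∅` is `σ_I`, loaded with the branch of `u_I` on which all the factors are
positive and have argument `0`. -/
def regCycle {m : ℕ} (I : Finset (Fin m)) (a : ℂ) (b c : Fin m → ℂ)
    {ε : Fin m → ℝ} {ε₀ : ℝ} {x : Fin m → ℝ} (h : Admissible ε ε₀ x) :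
    TwistedChain (polyI I x) :=
  ∑ J : Stratum I, Finsupp.single (tubeCell h J) (∏ j ∈ J.1, orient j / dCoef I a b c j)

/-- `F_I = ∫ u_I φ_I` over the regularized cycle. -/
def cycleIntegral {m : ℕ} (I : Finset (Fin m)) (a : ℂ) (b c : Fin m → ℂ)
    {ε : Fin m → ℝ} {ε₀ : ℝ} {x : Fin m → ℝ} (h : Admissible ε ε₀ x) : ℂ :=
  chainIntegral (regCycle I a b c h) (expoI a b c) phiI

end LauricellaFA

end

/-! Factor out of `u_I` what does not depend on `x`: `s_i - x_i = s_i (1 - x_i / s_i)` and `v_I = (1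
- ∑ s_i) (1 - ∑ x_j s_j / (1 - ∑ s_i))`, with `i ∈ I` and `j ∉ I`. On every cell `|x_i / s_i| ≤ x_i
/ ε_i < 1`, and `∑ |x_j s_j| / |1 - ∑ s_i| ≤ ∑ x_j (1 + ε_j) / ε < 1`. So the binomial series in the
`x_i / s_i` and the multinomial series in the `x_j s_j / (1 - ∑ s_i)` converge uniformly, and the
integral over a cell becomes a series of integrals of monomials `∏ ℓ_L ^ (λ_L - 1)` in the affine
forms `ℓ_L` of the walls (`branch_mul_phiI`, `hasSum_monInt`). The exponents `λ_L` vary with the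
multi-index `n` only by integers, so the same denominators `d_L = e^{2πi λ_L} - 1` serve all the
monomials (`monod_expo`).

It remains to integrate one monomial over the regularized cycle (`sum_monInt`); the result is a
quotient of gamma values, as in Dirichlet's integral. Suppose first that `Re λ_L > 1` for all `L`.
Replacing the circle around a wall by its radius costs a factor `e^{2πi λ_L} - 1`
(`setIntegral_circ_eq`), which cancels `1 / d_L`. For this, a cell is viewed as a map of independent
complex variables, one for each of its circles. This map is affine in each of these variables, the
form of a wall in `J` is exactly the corresponding variable, and the remaining forms keep positive
real part on the whole polydisc, so their powers are holomorphic there. After contraction the cell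
of `J` parametrizes the part of the full polytope (simplex times unit intervals, with walls on the
hyperplanes themselves) where the forms in `J` are at most their radii and the others at least
theirs (`orient_mul_monInt_eq`). These parts overlap in null sets and fill the full polytope
(`sum_setIntegral_region`). Hence the sum over `J` is Dirichlet's integral
(`setIntegral_dirichletTerm`).

The restriction on `λ` is removed by analytic continuation. Multiplied by all `e^{2πi λ_L} - 1`,
both sides are entire functions of a common shift `t` of the exponents: the cells are compact, and
`(e^{2πiz} - 1) Γ(z)` extends to the entire function `hankel`. They agree for large `Re t`, hence at
`t = 0`.

Finally `Γ(z ± n)` is expressed through Pochhammer symbols (`multTerm_mul_Gamma`), which turns the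
series into a constant times `F_A`. The constant is not zero, so convergence of `F_A` comes with the
same computation. -/

namespace LauricellaFA

open MeasureTheory

/-! ### Integrals over compact sets -/

/-- Termwise integration of a uniformly dominated series of continuous functions. -/
theorem hasSum_setIntegral_of_isCompact {X ι : Type*} [TopologicalSpace X] [T2Space X]
    [MeasurableSpace X] [OpensMeasurableSpace X] {μ : Measure X} [IsFiniteMeasureOnCompacts μ]
    [Countable ι] {K : Set X} (hK : IsCompact K) {F : ι → X → ℂ} {f : X → ℂ} {u : ι → ℝ}
    (hF : ∀ i, ContinuousOn (F i) K) (hu : Summable u) (hFu : ∀ i, ∀ y ∈ K, ‖F i y‖ ≤ u i)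
    (hf : ∀ y ∈ K, HasSum (fun i => F i y) (f y)) :
    HasSum (fun i => ∫ y in K, F i y ∂μ) (∫ y in K, f y ∂μ) := by
  have hfin : μ K ≠ ⊤ := hK.measure_lt_top.ne
  have hint : ∀ i, Integrable (F i) (μ.restrict K) := fun i =>
    (hF i).integrableOn_compact' hK hK.measurableSet
  have h1 := hasSum_integral_of_summable_integral_norm hint (by
    refine Summable.of_nonneg_of_le (fun i => integral_nonneg fun y => norm_nonneg _)
      (fun i => ?_) (hu.mul_right (μ.real K))
    have h2 := setIntegral_mono_on (hint i).norm (integrableOn_const (C := u i) hfin)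
      hK.measurableSet (fun y hy => hFu i y hy)
    refine h2.trans (le_of_eq ?_)
    rw [setIntegral_const, smul_eq_mul, mul_comm])
  rwa [setIntegral_congr_fun hK.measurableSet fun y hy => (hf y hy).tsum_eq] at h1

/-- A parametric integral `∫ exp (t g) w` over a compact set is entire in `t`. -/
theorem differentiable_setIntegral_exp {X : Type*} [TopologicalSpace X] [T2Space X]
    [MeasurableSpace X] [OpensMeasurableSpace X] {μ : Measure X} [IsFiniteMeasureOnCompacts μ]
    {K : Set X} (hK : IsCompact K) {g w : X → ℂ}
    (hg : ContinuousOn g K) (hw : ContinuousOn w K) :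
    Differentiable ℂ fun t : ℂ => ∫ y in K, Complex.exp (t * g y) * w y ∂μ := by
  intro t
  have hc : ∀ t : ℂ, ContinuousOn (fun y => Complex.exp (t * g y) * w y) K := fun t => by
    fun_prop
  have hc' : ContinuousOn (fun y => Complex.exp (t * g y) * g y * w y) K := by
    fun_prop
  have hi : ∀ {f : X → ℂ}, ContinuousOn f K → Integrable f (μ.restrict K) := fun h =>
    h.integrableOn_compact' hK hK.measurableSet
  -- Majorant of the `t`-derivative on the unit ball around `t`, where `‖s‖ ≤ ‖t‖ + 1`.
  have hb : ContinuousOn (fun y => Real.exp ((‖t‖ + 1) * ‖g y‖) * ‖g y‖ * ‖w y‖) K := by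
    fun_prop
  refine (hasDerivAt_integral_of_dominated_loc_of_deriv_le (Metric.ball_mem_nhds t one_pos)
    (Filter.Eventually.of_forall fun t => (hi (hc t)).1) (hi (hc t)) (hi hc').1
    (F' := fun t y => Complex.exp (t * g y) * g y * w y) ?_
    (hb.integrableOn_compact' hK hK.measurableSet) ?_).2.differentiableAt
  · refine Filter.Eventually.of_forall fun y s hs => ?_
    rw [norm_mul, norm_mul]
    gcongr
    rw [Complex.norm_exp]
    refine Real.exp_le_exp.2 ((Complex.re_le_norm _).trans ?_)
    rw [norm_mul]
    gcongr
    have := norm_sub_norm_le s t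
    rw [Metric.mem_ball, dist_eq_norm] at hs
    linarith
  · refine Filter.Eventually.of_forall fun y s _ => ?_
    have := (((hasDerivAt_id s).mul_const (g y)).cexp).mul_const (w y)
    simpa using this

/-! ### Contraction of a circle to the radius -/

/-- With `Re λ > 1` instead of `Re λ > 0` the power is continuous up to and including `0`, so all
the integrals are integrals of continuous functions over compact sets. Analytic continuation makes
the stronger assumption harmless. -/
theorem continuousOn_ofReal_cpow {lam : ℂ} (hlam : 1 < lam.re) :
    Continuous fun t : ℝ => (t : ℂ) ^ (lam - 1) := by
  refine continuous_iff_continuousAt.2 fun t => Complex.continuousAt_ofReal_cpow_const t _ ?_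
  left
  simpa using hlam

/-- On the circle the integrand is a multiple of `e^{i(λ+n)θ}`, so both sides are elementary. The
factor does not depend on `n`, because `e^{2πin} = 1`; this is what allows summation over a power
series. -/
theorem setIntegral_circ_pow {lam : ℂ} (hlam : 1 < lam.re) {ρ : ℝ} (hρ : 0 < ρ) (n : ℕ) :
    ∫ t in Set.Icc 0 (2 * Real.pi), Complex.exp ((lam - 1) * (Real.log ρ + t * Complex.I)) *
        (circ ρ t * Complex.I) * circ ρ t ^ n =
      (Complex.exp (2 * Real.pi * Complex.I * lam) - 1) *
        ∫ t in Set.Icc 0 ρ, (t : ℂ) ^ (lam - 1) * (t : ℂ) ^ n := by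
  have hre : 0 < (lam + n).re := by
    simp only [Complex.add_re, Complex.natCast_re]
    positivity
  have hne : lam + n ≠ 0 := ne_zero_of_re_pos hre
  have hρ' : (ρ : ℂ) ≠ 0 := by exact_mod_cast hρ.ne'
  have e1 : ∀ t : ℝ, Complex.exp ((lam - 1) * (Real.log ρ + t * Complex.I)) *
        (circ ρ t * Complex.I) * circ ρ t ^ n = (ρ : ℂ) ^ (lam + n) * Complex.I *
          Complex.exp ((lam + n) * Complex.I * t) := by
    intro t
    rw [← exp_log_circ hρ t, ← Complex.exp_nat_mul, Complex.cpow_def_of_ne_zero hρ',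
      Complex.ofReal_log hρ.le]
    rw [show ∀ a b c : ℂ, a * (b * Complex.I) * c = a * b * c * Complex.I by intros; ring,
      show ∀ a c : ℂ, a * Complex.I * c = a * c * Complex.I by intros; ring,
      ← Complex.exp_add, ← Complex.exp_add, ← Complex.exp_add]
    congr 2
    ring
  have e2 : ∫ t in Set.Icc 0 ρ, (t : ℂ) ^ (lam - 1) * (t : ℂ) ^ n =
      ∫ t in Set.Icc 0 ρ, (t : ℂ) ^ (lam + n - 1) := by
    rw [integral_Icc_eq_integral_Ioc, integral_Icc_eq_integral_Ioc]
    refine setIntegral_congr_fun measurableSet_Ioc fun t ht => ?_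
    have : (t : ℂ) ≠ 0 := by exact_mod_cast ht.1.ne'
    rw [← Complex.cpow_natCast, ← Complex.cpow_add _ _ this]
    congr 1
    ring
  rw [e2]
  simp_rw [e1]
  rw [integral_Icc_eq_integral_Ioc, integral_Icc_eq_integral_Ioc,
    ← intervalIntegral.integral_of_le Real.two_pi_pos.le,
    ← intervalIntegral.integral_of_le hρ.le, intervalIntegral.integral_const_mul,
    integral_exp_mul_complex (mul_ne_zero hne Complex.I_ne_zero),
    integral_cpow (Or.inl (by simp only [Complex.sub_re, Complex.one_re]; linarith))]
  simp only [sub_add_cancel, Complex.ofReal_zero, mul_zero, Complex.exp_zero,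
    Complex.zero_cpow hne, sub_zero]
  have e3 : Complex.exp ((lam + n) * Complex.I * ((2 * Real.pi : ℝ) : ℂ)) =
      Complex.exp (2 * Real.pi * Complex.I * lam) := by
    rw [show (lam + n) * Complex.I * ((2 * Real.pi : ℝ) : ℂ) =
      2 * Real.pi * Complex.I * lam + n * (2 * Real.pi * Complex.I) by push_cast; ring,
      Complex.exp_add, Complex.exp_nat_mul_two_pi_mul_I, mul_one]
  rw [e3]
  field_simp [Complex.I_ne_zero]

/-- For `Re λ > 1` and a function `h` holomorphic near the closed disc, the integral of
`z ^ (λ - 1) h(z)` over the circle is `e ^ {2 π i λ} - 1` times the integral over the radius. -/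
theorem setIntegral_circ_eq {lam : ℂ} (hlam : 1 < lam.re) {ρ : ℝ} (hρ : 0 < ρ) {U : Set ℂ}
    (hU : IsOpen U) (hρU : Metric.closedBall 0 ρ ⊆ U) {h : ℂ → ℂ} (hh : DifferentiableOn ℂ h U) :
    ∫ t in Set.Icc 0 (2 * Real.pi), Complex.exp ((lam - 1) * (Real.log ρ + t * Complex.I)) *
        (circ ρ t * Complex.I) * h (circ ρ t) =
      (Complex.exp (2 * Real.pi * Complex.I * lam) - 1) *
        ∫ t in Set.Icc 0 ρ, (t : ℂ) ^ (lam - 1) * h t := by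
  -- A slightly larger disc still lies in `U`, so the power series of `h` at `0` converges
  -- absolutely on the closed disc of radius `ρ`. It is integrated termwise over the circle and over
  -- the radius.
  obtain ⟨δ, hδ, hδU⟩ := (isCompact_closedBall (0 : ℂ) ρ).exists_thickening_subset_open hU hρU
  rw [thickening_closedBall hδ hρ.le] at hδU
  obtain ⟨R, hR⟩ : ∃ R : NNReal, (R : ℝ) = ρ + δ / 2 := ⟨⟨ρ + δ / 2, by positivity⟩, rfl⟩
  have hps : HasFPowerSeriesOnBall h (cauchyPowerSeries h 0 R) 0 R :=
    DifferentiableOn.hasFPowerSeriesOnBall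
      (hh.mono ((Metric.closedBall_subset_ball (by rw [hR]; linarith)).trans hδU))
      (by rw [← NNReal.coe_pos, hR]; positivity)
  set p := cauchyPowerSeries h 0 R
  have hmem : ∀ z : ℂ, ‖z‖ ≤ ρ → z ∈ Metric.eball (0 : ℂ) R := by
    intro z hz
    rw [Metric.eball_coe, Metric.mem_ball, dist_zero_right, hR]
    linarith
  have hsum : ∀ z : ℂ, ‖z‖ ≤ ρ → HasSum (fun n => z ^ n * p.coeff n) (h z) := by
    intro z hz
    have := hps.hasSum (hmem z hz)
    simpa [FormalMultilinearSeries.apply_eq_pow_smul_coeff] using this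
  have hnorm : Summable fun n => ρ ^ n * ‖p.coeff n‖ := by
    have := p.summable_norm_apply (x := (ρ : ℂ))
      (Metric.eball_subset_eball hps.r_le (hmem _ (by simp [abs_of_pos hρ])))
    simpa [FormalMultilinearSeries.apply_eq_pow_smul_coeff, abs_of_pos hρ] using this
  have hcirc : Continuous (circ ρ) := (contDiff_circ ρ).continuous
  have hL := hasSum_setIntegral_of_isCompact (μ := volume)
    (isCompact_Icc (a := (0 : ℝ)) (b := 2 * Real.pi))
    (F := fun n t => Complex.exp ((lam - 1) * (Real.log ρ + t * Complex.I)) *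
        (circ ρ t * Complex.I) * (circ ρ t ^ n * p.coeff n))
    (f := fun t => Complex.exp ((lam - 1) * (Real.log ρ + t * Complex.I)) *
        (circ ρ t * Complex.I) * h (circ ρ t))
    (u := fun n => Real.exp (‖lam - 1‖ * (|Real.log ρ| + 2 * Real.pi)) * ρ *
        (ρ ^ n * ‖p.coeff n‖))
    (fun n => by fun_prop) (hnorm.mul_left _) (fun n t ht => by
      rw [norm_mul, norm_mul, norm_mul, norm_mul, norm_pow, norm_circ hρ, Complex.norm_I, mul_one]
      gcongr
      rw [Complex.norm_exp]
      refine Real.exp_le_exp.2 ((Complex.re_le_norm _).trans ?_)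
      rw [norm_mul]
      gcongr
      refine (norm_add_le _ _).trans ?_
      rw [Complex.norm_real, Real.norm_eq_abs, norm_mul, Complex.norm_I, mul_one,
        Complex.norm_real, Real.norm_of_nonneg ht.1]
      gcongr
      exact ht.2)
    (fun t _ => (hsum _ (norm_circ hρ t).le).mul_left _)
  have hRr := hasSum_setIntegral_of_isCompact (μ := volume)
    (isCompact_Icc (a := (0 : ℝ)) (b := ρ))
    (F := fun n t => (t : ℂ) ^ (lam - 1) * ((t : ℂ) ^ n * p.coeff n))
    (f := fun t => (t : ℂ) ^ (lam - 1) * h t)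
    (u := fun n => ρ ^ (lam - 1).re * (ρ ^ n * ‖p.coeff n‖))
    (fun n => by
      have := continuousOn_ofReal_cpow hlam
      fun_prop) (hnorm.mul_left _) (fun n t ht => by
      have h0 : 0 < (lam - 1).re := by simpa using hlam
      rw [norm_mul, norm_mul, norm_pow, Complex.norm_real, Real.norm_of_nonneg ht.1]
      have h1 : ‖(t : ℂ) ^ (lam - 1)‖ ≤ ρ ^ (lam - 1).re := by
        rcases ht.1.eq_or_lt with h2 | h2
        · rw [← h2, Complex.ofReal_zero, Complex.zero_cpow (ne_zero_of_re_pos h0), norm_zero]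
          positivity
        · rw [Complex.norm_cpow_eq_rpow_re_of_pos h2]
          exact Real.rpow_le_rpow ht.1 ht.2 h0.le
      have h3 : t ^ n ≤ ρ ^ n := pow_le_pow_left₀ ht.1 ht.2 n
      have h4 := pow_nonneg ht.1 n
      gcongr)
    (fun t ht => (hsum _ (by simpa [abs_of_nonneg ht.1] using ht.2)).mul_left _)
  refine hL.unique ?_
  convert! hRr.mul_left (Complex.exp (2 * Real.pi * Complex.I * lam) - 1) using 2 with n
  have e := setIntegral_circ_pow hlam hρ n
  simp_rw [← mul_assoc] at e ⊢
  rw [integral_mul_const, integral_mul_const, e]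
  ring

/-! ### Integration one coordinate at a time -/

/-- Two integrable functions on `ℝ^m` all of whose integrals along the lines in the direction of
the `k`-th coordinate agree have the same integral. -/
theorem integral_eq_of_update {m : ℕ} (k : Fin m) {f g : (Fin m → ℝ) → ℂ} (hf : Integrable f)
    (hg : Integrable g)
    (h : ∀ y, ∫ t, f (Function.update y k t) = ∫ t, g (Function.update y k t)) :
    ∫ y, f y = ∫ y, g y := by
  obtain ⟨n, rfl⟩ : ∃ n, m = n + 1 := ⟨m - 1, by have := k.pos; omega⟩
  have key : ∀ {f : (Fin (n + 1) → ℝ) → ℂ}, Integrable f →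
      ∫ y, f y = ∫ y' : Fin n → ℝ, ∫ t, f (Function.update (k.insertNth 0 y') k t) := by
    intro f hf
    have hmp := (volume_preserving_piFinSuccAbove (fun _ : Fin (n + 1) => ℝ) k).symm
    have hint := (hmp.integrable_comp_emb (MeasurableEquiv.measurableEmbedding _)).2 hf
    have h1 := hmp.integral_comp (MeasurableEquiv.measurableEmbedding _) f
    rw [Measure.volume_eq_prod] at hint h1
    rw [← h1]
    refine (integral_prod_symm _ hint).trans ?_
    simp [MeasurableEquiv.piFinSuccAbove, Fin.insertNthEquiv, Fin.update_insertNth]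
  rw [key hf, key hg]
  simp_rw [h]

/-! ### Contraction of several circles -/

/-- The slots in `T` are filled with points of circles, the other ones with real numbers. -/
noncomputable def circleSlots {m : ℕ} (ρ : Fin m → ℝ) (T : Finset (Fin m))
    (y : Fin m → ℝ) (k : Fin m) : ℂ :=
  if k ∈ T then circ (ρ k) (y k) else (y k : ℂ)

theorem circleSlots_update_of_mem {m : ℕ} {ρ : Fin m → ℝ} {T : Finset (Fin m)} {k : Fin m}
    (hk : k ∈ T) (y : Fin m → ℝ) (t : ℝ) :
    circleSlots ρ T (Function.update y k t) =
      Function.update (circleSlots ρ T y) k (circ (ρ k) t) := by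
  funext i
  rcases eq_or_ne i k with rfl | hi
  · simp [circleSlots, hk]
  · simp [circleSlots, hi]

/-- The right-hand side keeps `circleSlots ρ T y`, as in `circleSlots_update_of_mem`: circle and
radius are then two paths in slot `k` of one and the same point, and the one-variable result
applies. -/
theorem circleSlots_erase_update {m : ℕ} {ρ : Fin m → ℝ} {T : Finset (Fin m)} {k : Fin m}
    (y : Fin m → ℝ) (t : ℝ) :
    circleSlots ρ (T.erase k) (Function.update y k t) =
      Function.update (circleSlots ρ T y) k (t : ℂ) := by
  funext i
  rcases eq_or_ne i k with rfl | hi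
  · simp [circleSlots]
  · simp [circleSlots, hi]

theorem continuous_circleSlots {m : ℕ} (ρ : Fin m → ℝ) (T : Finset (Fin m)) :
    Continuous (circleSlots ρ T) := by
  refine continuous_pi fun k => ?_
  unfold circleSlots
  split_ifs
  · exact (contDiff_circ_apply (ρ k) k).continuous
  · fun_prop

/-- The domain on which the slots in `T` are angles, and the slots in `A \ T` are radii. -/
def slotDom {m : ℕ} (ρ : Fin m → ℝ) (A T : Finset (Fin m)) (B : Set (Fin m → ℝ)) :
    Set (Fin m → ℝ) :=
  {y | y ∈ B ∧ ∀ k ∈ A, y k ∈ Set.Icc 0 (if k ∈ T then 2 * Real.pi else ρ k)}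

/-- The one-dimensional factor of the integrands in `setIntegral_circleSlots`. -/
noncomputable def slotFactor {m : ℕ} (ρ : Fin m → ℝ) (lam : Fin m → ℂ)
    (T : Finset (Fin m)) (k : Fin m)
    (t : ℝ) : ℂ :=
  if k ∈ T then Complex.exp ((lam k - 1) * (Real.log (ρ k) + t * Complex.I)) *
    (circ (ρ k) t * Complex.I)
  else (t : ℂ) ^ (lam k - 1)

/-- `e^{2 π i z} - 1`. -/
noncomputable def monod (z : ℂ) : ℂ := Complex.exp (2 * Real.pi * Complex.I * z) - 1

theorem norm_circleSlots_le {m : ℕ} {ρ : Fin m → ℝ} {A T : Finset (Fin m)}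
    {B : Set (Fin m → ℝ)} (hρ : ∀ k ∈ A, 0 < ρ k) {y : Fin m → ℝ} (hy : y ∈ slotDom ρ A T B)
    {k : Fin m} (hk : k ∈ A) : ‖circleSlots ρ T y k‖ ≤ ρ k := by
  have := hy.2 k hk
  unfold circleSlots
  split_ifs with h
  · exact (norm_circ (hρ k hk) _).le
  · rw [if_neg h] at this
    rw [Complex.norm_real, Real.norm_of_nonneg this.1]
    exact this.2

/-- Contraction of circles to radii in several coordinates at the same time. The function
`H z y` depends holomorphically on the coordinates `z k`, `k ∈ A`, and on the coordinates
`y k`, `k ∉ A`. -/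
theorem setIntegral_circleSlots {m : ℕ} {ρ : Fin m → ℝ} {lam : Fin m → ℂ} {A : Finset (Fin m)}
    {B : Set (Fin m → ℝ)} {H : (Fin m → ℂ) → (Fin m → ℝ) → ℂ}
    (hρ : ∀ k ∈ A, 0 < ρ k) (hlam : ∀ k ∈ A, 1 < (lam k).re)
    (hB : ∀ k ∈ A, ∀ y t, Function.update y k t ∈ B ↔ y ∈ B)
    (hHy : ∀ k ∈ A, ∀ z y t, H z (Function.update y k t) = H z y)
    (hcomp : ∀ T, IsCompact (slotDom ρ A T B))
    (hcont : ContinuousOn (fun p : (Fin m → ℂ) × (Fin m → ℝ) => H p.1 p.2)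
      {p | p.2 ∈ B ∧ ∀ k ∈ A, ‖p.1 k‖ ≤ ρ k})
    (hdiff : ∀ y ∈ B, ∀ z : Fin m → ℂ, (∀ k ∈ A, ‖z k‖ ≤ ρ k) → ∀ k ∈ A, ∃ U : Set ℂ,
      IsOpen U ∧ Metric.closedBall 0 (ρ k) ⊆ U ∧
        DifferentiableOn ℂ (fun w => H (Function.update z k w) y) U) :
    ∫ y in slotDom ρ A A B, (∏ k ∈ A, slotFactor ρ lam A k (y k)) * H (circleSlots ρ A y) y =
      (∏ k ∈ A, monod (lam k)) *
        ∫ y in slotDom ρ A ∅ B, (∏ k ∈ A, slotFactor ρ lam ∅ k (y k)) *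
          H (circleSlots ρ ∅ y) y := by
  -- `T` records the slots that are still circles. Extension by zero turns the different domains
  -- into integrals over all of `ℝ^m`, to be compared line by line.
  set F : Finset (Fin m) → (Fin m → ℝ) → ℂ := fun T =>
    (slotDom ρ A T B).indicator fun y =>
      (∏ k ∈ A, slotFactor ρ lam T k (y k)) * H (circleSlots ρ T y) y with hF
  have hint : ∀ T, Integrable (F T) := by
    intro T
    rw [hF, integrable_indicator_iff (hcomp T).measurableSet]
    refine ContinuousOn.integrableOn_compact' (hcomp T) (hcomp T).measurableSet ?_
    refine ContinuousOn.mul ?_ ?_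
    · refine continuousOn_finsetProd _ fun k hk => Continuous.continuousOn ?_
      unfold slotFactor
      split_ifs
      · have := (contDiff_circ_apply (ρ k) k).continuous
        fun_prop
      · exact (continuousOn_ofReal_cpow (hlam k hk)).comp (continuous_apply k)
    · refine hcont.comp ((continuous_circleSlots ρ T).prodMk continuous_id).continuousOn ?_
      intro y hy
      exact ⟨hy.1, fun k hk => norm_circleSlots_le hρ hy hk⟩
  have hFin : ∀ T, ∀ y ∈ slotDom ρ A T B, F T y =
      (∏ k ∈ A, slotFactor ρ lam T k (y k)) * H (circleSlots ρ T y) y :=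
    fun T y hy => Set.indicator_of_mem hy _
  have hFout : ∀ T, ∀ y ∉ slotDom ρ A T B, F T y = 0 :=
    fun T y hy => Set.indicator_of_notMem hy _
  have hstep : ∀ T ⊆ A, ∀ k ∈ T, ∫ y, F T y = monod (lam k) * ∫ y, F (T.erase k) y := by
    intro T hT k hkT
    have hkA := hT hkT
    rw [← integral_const_mul]
    refine integral_eq_of_update k (hint T) ((hint _).const_mul _) fun y => ?_
    -- A line in direction `k` meets the domain in a full interval or not at all, depending on the
    -- other coordinates only; this condition is the same for `T` and `T.erase k`.
    have hdom : ∀ T' : Finset (Fin m), (∀ i, i ≠ k → (i ∈ T' ↔ i ∈ T)) → ∀ t,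
        (Function.update y k t ∈ slotDom ρ A T' B ↔
          (y ∈ B ∧ ∀ i ∈ A.erase k, y i ∈ Set.Icc 0 (if i ∈ T then 2 * Real.pi else ρ i)) ∧
          t ∈ Set.Icc 0 (if k ∈ T' then 2 * Real.pi else ρ k)) := by
      intro T' hT' t
      unfold slotDom
      rw [Set.mem_ofPred_eq, hB k hkA, and_assoc]
      refine and_congr_right fun _ => ?_
      constructor
      · intro h
        refine ⟨fun i hi => ?_, by simpa using h k hkA⟩
        obtain ⟨h1, h2⟩ := Finset.mem_erase.1 hi
        have := h i h2
        rw [Function.update_of_ne h1] at this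
        simpa only [hT' i h1] using this
      · rintro ⟨h1, h2⟩ i hi
        rcases eq_or_ne i k with rfl | hik
        · simpa using h2
        · rw [Function.update_of_ne hik]
          simpa only [hT' i hik] using h1 i (Finset.mem_erase.2 ⟨hik, hi⟩)
    have hprod : ∀ T' : Finset (Fin m), (∀ i, i ≠ k → (i ∈ T' ↔ i ∈ T)) → ∀ t,
        ∏ i ∈ A, slotFactor ρ lam T' i (Function.update y k t i) =
          slotFactor ρ lam T' k t * ∏ i ∈ A.erase k, slotFactor ρ lam T i (y i) := by
      intro T' hT' t
      rw [← Finset.mul_prod_erase A _ hkA, Function.update_self]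
      congr 1
      refine Finset.prod_congr rfl fun i hi => ?_
      have h1 := (Finset.mem_erase.1 hi).1
      rw [Function.update_of_ne h1]
      unfold slotFactor
      simp only [hT' i h1]
    have hself : ∀ i, i ≠ k → (i ∈ T ↔ i ∈ T) := fun _ _ => Iff.rfl
    have herase : ∀ i, i ≠ k → (i ∈ T.erase k ↔ i ∈ T) := fun i hi => by simp [hi]
    by_cases hy : y ∈ B ∧ ∀ i ∈ A.erase k, y i ∈ Set.Icc 0 (if i ∈ T then 2 * Real.pi else ρ i)
    · set z := circleSlots ρ T y with hz
      set c := ∏ i ∈ A.erase k, slotFactor ρ lam T i (y i) with hc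
      -- Slot `k` of `y` is arbitrary on this line, so it is reset to `0` to obtain an admissible
      -- point for `hdiff`; the function of `w` is not affected.
      have hz1 : ∀ i ∈ A, ‖Function.update z k 0 i‖ ≤ ρ i := by
        intro i hi
        rcases eq_or_ne i k with rfl | hik
        · simpa using (hρ i hi).le
        · have := norm_circleSlots_le hρ
            (((hdom T hself 0).2 ⟨hy, ⟨le_rfl, by
              rw [if_pos hkT]
              exact Real.two_pi_pos.le⟩⟩)) hi
          rw [circleSlots_update_of_mem hkT, Function.update_of_ne hik] at this
          rwa [Function.update_of_ne hik]
      obtain ⟨U, hU, hUρ, hUd⟩ := hdiff y hy.1 _ hz1 k hkA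
      simp only [Function.update_idem] at hUd
      have key := setIntegral_circ_eq (hlam k hkA) (hρ k hkA) hU hUρ hUd
      have e1 : ∀ t, F T (Function.update y k t) = (Set.Icc 0 (2 * Real.pi)).indicator (fun t =>
          c * (Complex.exp ((lam k - 1) * (Real.log (ρ k) + t * Complex.I)) *
            (circ (ρ k) t * Complex.I) * H (Function.update z k (circ (ρ k) t)) y)) t := by
        intro t
        have hd := hdom T hself t
        rw [if_pos hkT] at hd
        by_cases ht : t ∈ Set.Icc 0 (2 * Real.pi)
        · rw [Set.indicator_of_mem ht, hFin T _ (hd.2 ⟨hy, ht⟩), hprod T hself, hHy k hkA,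
            circleSlots_update_of_mem hkT, slotFactor, if_pos hkT]
          ring
        · rw [Set.indicator_of_notMem ht, hFout T _ fun h => ht (hd.1 h).2]
      have e2 : ∀ t, monod (lam k) * F (T.erase k) (Function.update y k t) =
          (Set.Icc 0 (ρ k)).indicator (fun t =>
          c * (monod (lam k) * ((t : ℂ) ^ (lam k - 1) * H (Function.update z k (t : ℂ)) y))) t := by
        intro t
        have hd := hdom _ herase t
        rw [if_neg (Finset.notMem_erase _ _)] at hd
        by_cases ht : t ∈ Set.Icc 0 (ρ k)
        · rw [Set.indicator_of_mem ht, hFin _ _ (hd.2 ⟨hy, ht⟩), hprod _ herase, hHy k hkA,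
            circleSlots_erase_update, slotFactor,
            if_neg (Finset.notMem_erase _ _)]
          ring
        · rw [Set.indicator_of_notMem ht, hFout _ _ fun h => ht (hd.1 h).2, mul_zero]
      simp_rw [e1, e2]
      rw [integral_indicator measurableSet_Icc, integral_indicator measurableSet_Icc,
        integral_const_mul, integral_const_mul, integral_const_mul, key, monod]
    · have e1 : ∀ t, F T (Function.update y k t) = 0 := fun t =>
        hFout T _ fun h => hy ((hdom T hself t).1 h).1
      have e2 : ∀ t, F (T.erase k) (Function.update y k t) = 0 := fun t =>
        hFout _ _ fun h => hy ((hdom _ herase t).1 h).1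
      simp [e1, e2]
  -- The circles are contracted one after the other; `S` is the set of those already done.
  have hind : ∀ S ⊆ A, ∫ y, F A y = (∏ k ∈ S, monod (lam k)) * ∫ y, F (A \ S) y := by
    intro S
    induction S using Finset.induction_on with
    | empty => simp
    | insert k S hk ih =>
      intro hS
      obtain ⟨h1, h2⟩ := Finset.insert_subset_iff.1 hS
      rw [ih h2, hstep (A \ S) Finset.sdiff_subset k (Finset.mem_sdiff.2 ⟨h1, hk⟩),
        Finset.prod_insert hk, ← Finset.sdiff_insert]
      ring
  have := hind A subset_rfl
  rw [sdiff_self, hF] at this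
  simpa only [integral_indicator (hcomp _).measurableSet] using! this

/-! ### A determinant -/

/-- A matrix that is triangular with respect to a grading of the indices, and diagonal on the
pieces of the grading. -/
theorem det_of_graded {n R : Type*} [Fintype n] [DecidableEq n] [CommRing R]
    (M : Matrix n n R) (d : n → ℕ) (h : ∀ i k, M i k ≠ 0 → i = k ∨ d k < d i) :
    M.det = ∏ i, M i i := by
  rw [Matrix.det_apply', Finset.sum_eq_single 1]
  · simp
  · intro σ _ hσ
    by_contra hne
    have h1 : ∀ i, σ i = i ∨ d i < d (σ i) := by
      intro i
      refine h (σ i) i fun h0 => hne ?_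
      exact mul_eq_zero_of_right _ (Finset.prod_eq_zero (Finset.mem_univ i) h0)
    -- A permutation preserves the sum of the degrees. A nonzero term never lowers a degree, so it
    -- raises none either, and the permutation must be the identity.
    have h2 : ∑ i, d (σ i) = ∑ i, d i := Equiv.sum_comp σ d
    have h3 : ∀ i ∈ Finset.univ, d i ≤ d (σ i) := fun i _ => by
      rcases h1 i with h | h
      · rw [h]
      · exact h.le
    have h4 := (Finset.sum_eq_sum_iff_of_le h3).1 h2.symm
    refine hσ (Equiv.ext fun i => ?_)
    rcases h1 i with h | h
    · exact h
    · exact absurd (h4 i (Finset.mem_univ i)) h.ne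
  · simp

/-! ### Dirichlet's integral -/

theorem integral_pi_succ {n : ℕ} {f : (Fin (n + 1) → ℝ) → ℂ} (hf : Integrable f) :
    ∫ y, f y = ∫ y' : Fin n → ℝ, ∫ t, f (Fin.cons t y') := by
  have hmp := (volume_preserving_piFinSuccAbove (fun _ : Fin (n + 1) => ℝ) 0).symm
  have hint := (hmp.integrable_comp_emb (MeasurableEquiv.measurableEmbedding _)).2 hf
  have h1 := hmp.integral_comp (MeasurableEquiv.measurableEmbedding _) f
  rw [Measure.volume_eq_prod] at hint h1
  rw [← h1]
  refine (integral_prod_symm _ hint).trans ?_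
  simp [MeasurableEquiv.piFinSuccAbove, Fin.insertNthEquiv]

/-- The product of the standard simplex in the coordinates with `p k` and of the unit intervals in
the other coordinates. -/
def unitPolytope {m : ℕ} (p : Fin m → Prop) [DecidablePred p] : Set (Fin m → ℝ) :=
  {s | (∀ k, 0 ≤ s k) ∧ (∀ k, ¬p k → s k ≤ 1) ∧ ∑ k, (if p k then s k else 0) ≤ 1}

/-- The integrand of Dirichlet's integral. -/
noncomputable def dirichletTerm {m : ℕ} (p : Fin m → Prop) [DecidablePred p] (lam mu : Fin m → ℂ)
    (nu : ℂ) (s : Fin m → ℝ) : ℂ :=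
  (∏ k, (s k : ℂ) ^ (lam k - 1) * (if p k then 1 else ((1 - s k : ℝ) : ℂ) ^ (mu k - 1))) *
    ((1 - ∑ k, (if p k then s k else 0) : ℝ) : ℂ) ^ (nu - 1)

theorem isCompact_unitPolytope {m : ℕ} (p : Fin m → Prop) [DecidablePred p] :
    IsCompact (unitPolytope p) := by
  refine Metric.isCompact_of_isClosed_isBounded ?_ ?_
  · have h : unitPolytope p = (⋂ k, {s | 0 ≤ s k}) ∩ ((⋂ k, ⋂ (_ : ¬p k), {s | s k ≤ 1}) ∩
        {s | ∑ k, (if p k then s k else 0) ≤ 1}) := by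
      ext s
      simp [unitPolytope]
    rw [h]
    refine (isClosed_iInter fun k => isClosed_le continuous_const (continuous_apply k)).inter
      ((isClosed_iInter fun k => isClosed_iInter fun _ =>
        isClosed_le (continuous_apply k) continuous_const).inter
        (isClosed_le (continuous_finsetSum _ fun k _ => ?_) continuous_const))
    split_ifs <;> fun_prop
  · refine (Metric.isBounded_Icc (0 : Fin m → ℝ) 1).subset fun s hs => ⟨hs.1, fun k => ?_⟩
    by_cases hp : p k
    · refine le_trans ?_ hs.2.2
      have := Finset.single_le_sum (f := fun k => if p k then s k else 0)
        (fun i _ => by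
          have := hs.1 i
          split_ifs <;> simp [this]) (Finset.mem_univ k)
      simpa [hp] using this
    · exact hs.2.1 k hp

theorem continuous_dirichletTerm {m : ℕ} {p : Fin m → Prop} [DecidablePred p] {lam mu : Fin m → ℂ}
    {nu : ℂ} (hlam : ∀ k, 1 < (lam k).re) (hmu : ∀ k, 1 < (mu k).re) (hnu : 1 < nu.re) :
    Continuous (dirichletTerm p lam mu nu) := by
  unfold dirichletTerm
  refine Continuous.mul (continuous_finsetProd _ fun k _ => Continuous.mul ?_ ?_) ?_
  · exact (continuousOn_ofReal_cpow (hlam k)).comp (continuous_apply k)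
  · split_ifs
    · exact continuous_const
    · exact (continuousOn_ofReal_cpow (hmu k)).comp (continuous_const.sub (continuous_apply k))
  · refine (continuousOn_ofReal_cpow hnu).comp (continuous_const.sub
      (continuous_finsetSum _ fun k _ => ?_))
    split_ifs <;> fun_prop

/-- The scaled Beta integral. The case `A = 0` is needed for slices of the simplex through its
boundary, where both sides vanish. -/
theorem setIntegral_beta {u v : ℂ} (hu : 1 < u.re) (hv : 1 < v.re) {A : ℝ} (hA : 0 ≤ A) :
    ∫ t in Set.Icc 0 A, (t : ℂ) ^ (u - 1) * ((A - t : ℝ) : ℂ) ^ (v - 1) =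
      (A : ℂ) ^ (u + v - 1) * (Complex.Gamma u * Complex.Gamma v / Complex.Gamma (u + v)) := by
  have huv : 0 < (u + v).re := by
    simp only [Complex.add_re]
    linarith
  have h1 : Complex.Gamma (u + v) ≠ 0 := Complex.Gamma_ne_zero_of_re_pos huv
  rw [Complex.Gamma_mul_Gamma_eq_betaIntegral (by linarith) (by linarith),
    mul_div_cancel_left₀ _ h1, integral_Icc_eq_integral_Ioc,
    ← intervalIntegral.integral_of_le hA]
  rcases hA.eq_or_lt with rfl | hA
  · have : u + v - 1 ≠ 0 := ne_zero_of_re_pos (by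
      simp only [Complex.sub_re, Complex.add_re, Complex.one_re]
      linarith)
    simp [Complex.zero_cpow this]
  · rw [← Complex.betaIntegral_scaled u v hA]
    simp

/-- Dirichlet's integral over a product of a simplex and of intervals. -/
theorem setIntegral_dirichletTerm {m : ℕ} (p : Fin m → Prop) [DecidablePred p]
    (lam mu : Fin m → ℂ) (nu : ℂ) (hlam : ∀ k, 1 < (lam k).re) (hmu : ∀ k, 1 < (mu k).re)
    (hnu : 1 < nu.re) :
    ∫ s in unitPolytope p, dirichletTerm p lam mu nu s =
      (∏ k, if p k then Complex.Gamma (lam k)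
        else Complex.Gamma (lam k) * Complex.Gamma (mu k) / Complex.Gamma (lam k + mu k)) *
      (Complex.Gamma nu / Complex.Gamma (nu + ∑ k, if p k then lam k else 0)) := by
  induction m generalizing nu with
  | zero =>
    have h1 : Complex.Gamma nu ≠ 0 := Complex.Gamma_ne_zero_of_re_pos (by linarith)
    have h2 : unitPolytope p = Set.univ := by
      ext s
      simp [unitPolytope]
    simp [h2, dirichletTerm, integral_unique, h1, Measure.real, volume_pi]
  | succ n ih =>
    have hcont := continuous_dirichletTerm (p := p) hlam hmu hnu
    have hint : Integrable ((unitPolytope p).indicator (dirichletTerm p lam mu nu)) :=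
      (integrable_indicator_iff (isCompact_unitPolytope p).measurableSet).2
        (hcont.continuousOn.integrableOn_compact (isCompact_unitPolytope p))
    rw [← integral_indicator (isCompact_unitPolytope p).measurableSet, integral_pi_succ hint]
    have hS : ∀ y : Fin n → ℝ, (∀ k, 0 ≤ y k) → 0 ≤ ∑ k, (if p k.succ then y k else 0) := by
      intro y hy
      refine Finset.sum_nonneg fun k _ => ?_
      have := hy k
      split_ifs <;> simp [this]
    by_cases hp : p 0
    · have hmem : ∀ (y : Fin n → ℝ) t, (Fin.cons t y : Fin (n + 1) → ℝ) ∈ unitPolytope p ↔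
          y ∈ unitPolytope (fun k => p k.succ) ∧
            t ∈ Set.Icc 0 (1 - ∑ k, (if p k.succ then y k else 0)) := by
        intro y t
        simp only [unitPolytope, Set.mem_ofPred_eq, Fin.forall_fin_succ, Fin.cons_zero,
          Fin.cons_succ, Fin.sum_univ_succ, hp, not_true_eq_false, if_true, Set.mem_Icc]
        constructor
        · rintro ⟨⟨h1, h2⟩, ⟨-, h3⟩, h4⟩
          exact ⟨⟨h2, h3, by linarith⟩, h1, by linarith⟩
        · rintro ⟨⟨h2, h3, h4⟩, h1, h5⟩
          exact ⟨⟨h1, h2⟩, ⟨fun h => h.elim, h3⟩, by linarith⟩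
      -- For a simplex coordinate the slice is `[0, 1 - S]`, and its Beta integral contributes `(1 -
      -- S) ^ (λ₀ + ν - 1)`. What remains is again a Dirichlet integrand, with `ν` replaced by `λ₀ +
      -- ν`; the factors `Γ(λ₀ + ν)` cancel.
      have hinner : ∀ y : Fin n → ℝ, ∫ t, (unitPolytope p).indicator (dirichletTerm p lam mu nu)
          (Fin.cons t y) = (unitPolytope fun k => p k.succ).indicator (fun y =>
            (Complex.Gamma (lam 0) * Complex.Gamma nu / Complex.Gamma (lam 0 + nu)) *
            dirichletTerm (fun k => p k.succ) (fun k => lam k.succ) (fun k => mu k.succ)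
              (lam 0 + nu) y) y := by
        intro y
        by_cases hy : y ∈ unitPolytope fun k => p k.succ
        · rw [Set.indicator_of_mem hy]
          set S := ∑ k, (if p k.succ then y k else 0) with hSdef
          have h1 : ∀ t, (unitPolytope p).indicator (dirichletTerm p lam mu nu) (Fin.cons t y) =
              (Set.Icc 0 (1 - S)).indicator (fun t => (∏ k : Fin n, (y k : ℂ) ^ (lam k.succ - 1) *
                (if p k.succ then 1 else ((1 - y k : ℝ) : ℂ) ^ (mu k.succ - 1))) *
                ((t : ℂ) ^ (lam 0 - 1) * ((1 - S - t : ℝ) : ℂ) ^ (nu - 1))) t := by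
            intro t
            by_cases ht : t ∈ Set.Icc 0 (1 - S)
            · rw [Set.indicator_of_mem ht, Set.indicator_of_mem ((hmem y t).2 ⟨hy, ht⟩)]
              simp only [dirichletTerm, Fin.prod_univ_succ, Fin.sum_univ_succ, Fin.cons_zero,
                Fin.cons_succ, hp, if_true, mul_one, ← hSdef]
              rw [show 1 - (t + S) = 1 - S - t by ring]
              ring
            · rw [Set.indicator_of_notMem ht,
                Set.indicator_of_notMem fun h => ht ((hmem y t).1 h).2]
          simp_rw [h1]
          rw [integral_indicator measurableSet_Icc, integral_const_mul,
            setIntegral_beta (hlam 0) hnu (by linarith [hy.2.2]), dirichletTerm]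
          ring
        · rw [Set.indicator_of_notMem hy]
          refine integral_eq_zero_of_ae (Filter.Eventually.of_forall fun t => ?_)
          exact Set.indicator_of_notMem (fun h => hy ((hmem y t).1 h).1) _
      simp_rw [hinner]
      have hre : 1 < (lam 0 + nu).re := by
        have := hlam 0
        simp only [Complex.add_re]
        linarith
      rw [integral_indicator (isCompact_unitPolytope _).measurableSet, integral_const_mul,
        ih _ _ _ _ (fun k => hlam k.succ) (fun k => hmu k.succ) hre]
      simp only [Fin.prod_univ_succ, Fin.sum_univ_succ, hp, if_true]
      have h2 : Complex.Gamma (lam 0 + nu) ≠ 0 := Complex.Gamma_ne_zero_of_re_pos (by linarith)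
      rw [show ∀ z, nu + (lam 0 + z) = lam 0 + nu + z by intro z; ring]
      field_simp
    · have hmem : ∀ (y : Fin n → ℝ) t, (Fin.cons t y : Fin (n + 1) → ℝ) ∈ unitPolytope p ↔
          y ∈ unitPolytope (fun k => p k.succ) ∧ t ∈ Set.Icc (0 : ℝ) 1 := by
        intro y t
        simp only [unitPolytope, Set.mem_ofPred_eq, Fin.forall_fin_succ, Fin.cons_zero,
          Fin.cons_succ, Fin.sum_univ_succ, hp, not_false_eq_true, if_false, Set.mem_Icc, zero_add]
        tauto
      -- An interval coordinate separates from the others, and `ν` stays unchanged.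
      have hinner : ∀ y : Fin n → ℝ, ∫ t, (unitPolytope p).indicator (dirichletTerm p lam mu nu)
          (Fin.cons t y) = (unitPolytope fun k => p k.succ).indicator (fun y =>
            (Complex.Gamma (lam 0) * Complex.Gamma (mu 0) / Complex.Gamma (lam 0 + mu 0)) *
            dirichletTerm (fun k => p k.succ) (fun k => lam k.succ) (fun k => mu k.succ) nu y)
              y := by
        intro y
        by_cases hy : y ∈ unitPolytope fun k => p k.succ
        · rw [Set.indicator_of_mem hy]
          have h1 : ∀ t, (unitPolytope p).indicator (dirichletTerm p lam mu nu) (Fin.cons t y) =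
              (Set.Icc (0 : ℝ) 1).indicator (fun t => dirichletTerm (fun k => p k.succ)
                (fun k => lam k.succ) (fun k => mu k.succ) nu y *
                ((t : ℂ) ^ (lam 0 - 1) * ((1 - t : ℝ) : ℂ) ^ (mu 0 - 1))) t := by
            intro t
            by_cases ht : t ∈ Set.Icc (0 : ℝ) 1
            · rw [Set.indicator_of_mem ht, Set.indicator_of_mem ((hmem y t).2 ⟨hy, ht⟩)]
              simp only [dirichletTerm, Fin.prod_univ_succ, Fin.sum_univ_succ, Fin.cons_zero,
                Fin.cons_succ, hp, if_false, zero_add]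
              ring
            · rw [Set.indicator_of_notMem ht,
                Set.indicator_of_notMem fun h => ht ((hmem y t).1 h).2]
          simp_rw [h1]
          rw [integral_indicator measurableSet_Icc, integral_const_mul,
            setIntegral_beta (hlam 0) (hmu 0) zero_le_one]
          simp only [Complex.ofReal_one, Complex.one_cpow]
          ring
        · rw [Set.indicator_of_notMem hy]
          refine integral_eq_zero_of_ae (Filter.Eventually.of_forall fun t => ?_)
          exact Set.indicator_of_notMem (fun h => hy ((hmem y t).1 h).1) _
      simp_rw [hinner]
      rw [integral_indicator (isCompact_unitPolytope _).measurableSet, integral_const_mul,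
        ih _ _ _ _ (fun k => hlam k.succ) (fun k => hmu k.succ) hnu]
      simp only [Fin.prod_univ_succ, Fin.sum_univ_succ, hp, if_false, zero_add]
      ring

/-! ### Binomial and multinomial series -/

/-- The binomial series of `(1 - q) ^ (-a)`. The sum is written with the principal logarithm because
the branches on the cells are given by logarithms. -/
theorem hasSum_poch (a : ℂ) {q : ℂ} (hq : ‖q‖ < 1) :
    HasSum (fun n : ℕ => poch a n / (n.factorial : ℂ) * q ^ n)
      (Complex.exp (-a * Complex.log (1 - q))) := by
  have h1 := (Complex.one_div_one_sub_cpow_hasFPowerSeriesOnBall_zero a).hasSum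
    (y := q) (by
      rw [Metric.mem_eball, edist_zero_right, ← ofReal_norm]
      exact ENNReal.ofReal_lt_one.2 hq)
  have hne : 1 - q ≠ 0 := ne_zero_of_re_pos (one_sub_re_pos hq)
  have h2 : 1 / (1 - (0 + q)) ^ a = Complex.exp (-a * Complex.log (1 - q)) := by
    rw [zero_add, Complex.cpow_def_of_ne_zero hne, one_div, ← Complex.exp_neg]
    congr 1
    ring
  rw [h2] at h1
  convert! h1 using 2 with n
  have h3 := Ring.factorial_nsmul_multichoose_eq_ascPochhammer a n
  rw [Polynomial.ascPochhammer_smeval_eq_eval, nsmul_eq_mul] at h3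
  have h4 : (n.factorial : ℂ) ≠ 0 := by exact_mod_cast n.factorial_ne_zero
  simp only [FormalMultilinearSeries.ofScalars_apply_eq, smul_eq_mul]
  rw [poch, ← h3, mul_div_cancel_left₀ _ h4, Ring.choose]
  congr 2
  ring

theorem poch_ofReal (a : ℝ) (n : ℕ) : poch (a : ℂ) n = ((ascPochhammer ℝ n).eval a : ℝ) := by
  unfold poch
  induction n with
  | zero => simp
  | succ n ih =>
    rw [ascPochhammer_succ_eval, ascPochhammer_succ_eval, ih]
    push_cast
    ring

theorem hasSum_ascPochhammer_real (a : ℝ) {q : ℝ} (hq0 : 0 ≤ q) (hq : q < 1) :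
    HasSum (fun n : ℕ => (ascPochhammer ℝ n).eval a / (n.factorial : ℝ) * q ^ n)
      (Real.exp (-a * Real.log (1 - q))) := by
  have h1 := hasSum_poch (a : ℂ) (q := (q : ℂ))
    (by rwa [Complex.norm_real, Real.norm_of_nonneg hq0])
  refine Complex.hasSum_ofReal.1 ?_
  convert! h1 using 2 with n
  · rw [poch_ofReal]
    push_cast
    ring
  · rw [Complex.ofReal_exp]
    congr 1
    rw [show (1 : ℂ) - q = ((1 - q : ℝ) : ℂ) by push_cast; ring, ← Complex.ofReal_log (by linarith)]
    push_cast
    ring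

theorem ascPochhammer_eval_add {𝕜 : Type*} [CommRing 𝕜] (a : 𝕜) (n k : ℕ) :
    (ascPochhammer 𝕜 (n + k)).eval a =
      (ascPochhammer 𝕜 n).eval a * (ascPochhammer 𝕜 k).eval (a + n) := by
  rw [← ascPochhammer_mul]
  simp [Polynomial.eval_comp]

/-- The general term of the product of binomial series in the variables `q k` with `p k` and of a
multinomial series in the other variables. -/
noncomputable def multTerm {𝕜 : Type*} [Field 𝕜] {m : ℕ} (p : Fin m → Prop) [DecidablePred p]
    (al q : Fin m → 𝕜)
    (a : 𝕜) (n : Fin m → ℕ) : 𝕜 :=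
  (∏ k, (if p k then (ascPochhammer 𝕜 (n k)).eval (al k) else 1) / ((n k).factorial : 𝕜) *
    q k ^ n k) * (ascPochhammer 𝕜 (∑ k, if p k then 0 else n k)).eval a

section

variable {𝕜 : Type*} [Field 𝕜] {m : ℕ} {p : Fin (m + 1) → Prop} [DecidablePred p]
  (al q : Fin (m + 1) → 𝕜) (a : 𝕜) (n : ℕ) (l : Fin m → ℕ)

theorem multTerm_cons_of_pos (hp : p 0) :
    multTerm p al q a (Fin.cons n l) =
      (ascPochhammer 𝕜 n).eval (al 0) / (n.factorial : 𝕜) * q 0 ^ n *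
        multTerm (fun k => p k.succ) (fun k => al k.succ) (fun k => q k.succ) a l := by
  simp only [multTerm, Fin.prod_univ_succ, Fin.sum_univ_succ, Fin.cons_zero, Fin.cons_succ, hp,
    if_true, zero_add]
  ring

/-- An index of the multinomial part shifts the parameter of the rest, since `(a, n + k) = (a, n) (a
+ n, k)`. The inductions below therefore need all values of `a`. -/
theorem multTerm_cons_of_neg (hp : ¬p 0) :
    multTerm p al q a (Fin.cons n l) =
      (ascPochhammer 𝕜 n).eval a / (n.factorial : 𝕜) * q 0 ^ n *
        multTerm (fun k => p k.succ) (fun k => al k.succ) (fun k => q k.succ) (a + n) l := by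
  simp only [multTerm, Fin.prod_univ_succ, Fin.sum_univ_succ, Fin.cons_zero, Fin.cons_succ, hp,
    if_false, ascPochhammer_eval_add]
  ring

end

theorem multTerm_nonneg {m : ℕ} {p : Fin m → Prop} [DecidablePred p] {al q : Fin m → ℝ} {a : ℝ}
    (hal : ∀ k, 0 ≤ al k) (hq : ∀ k, 0 ≤ q k) (ha : 0 ≤ a) (n : Fin m → ℕ) :
    0 ≤ multTerm p al q a n := by
  have h : ∀ (a : ℝ) (n : ℕ), 0 ≤ a → 0 ≤ (ascPochhammer ℝ n).eval a := by
    intro a n ha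
    induction n with
    | zero => simp
    | succ n ih =>
      rw [ascPochhammer_succ_eval]
      positivity
  refine mul_nonneg (Finset.prod_nonneg fun k _ => mul_nonneg (div_nonneg ?_ (by positivity))
    (pow_nonneg (hq k) _)) (h _ _ ha)
  split_ifs
  · exact h _ _ (hal k)
  · exact zero_le_one

/-- Since `|(a, n)| ≤ (|a|, n)`, the same series with absolute values as parameters is a majorant,
and it can be summed in closed form. -/
theorem norm_multTerm_le {m : ℕ} {p : Fin m → Prop} [DecidablePred p] {al q : Fin m → ℂ} {a : ℂ}
    {Q : Fin m → ℝ} (hQ : ∀ k, ‖q k‖ ≤ Q k) (n : Fin m → ℕ) :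
    ‖multTerm p al q a n‖ ≤ multTerm p (fun k => ‖al k‖) Q ‖a‖ n := by
  have h : ∀ (a : ℂ) (n : ℕ), ‖(ascPochhammer ℂ n).eval a‖ ≤ (ascPochhammer ℝ n).eval ‖a‖ := by
    intro a n
    induction n with
    | zero => simp
    | succ n ih =>
      rw [ascPochhammer_succ_eval, ascPochhammer_succ_eval, norm_mul]
      have := norm_add_le a (n : ℂ)
      rw [Complex.norm_natCast] at this
      gcongr
      exact (norm_nonneg _).trans ih
  rw [multTerm, multTerm, norm_mul, norm_prod]
  refine mul_le_mul (Finset.prod_le_prod (fun _ _ => norm_nonneg _) fun k _ => ?_) (h _ _)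
    (norm_nonneg _) (Finset.prod_nonneg fun k _ => ?_)
  · rw [norm_mul, norm_div, norm_pow, Complex.norm_natCast]
    have h1 := hQ k
    have h2 : ‖if p k then (ascPochhammer ℂ (n k)).eval (al k) else 1‖ ≤
        if p k then (ascPochhammer ℝ (n k)).eval ‖al k‖ else 1 := by
      split_ifs
      · exact h _ _
      · simp
    have h3 := (norm_nonneg _).trans h2
    gcongr
  · have h1 : 0 ≤ Q k := (norm_nonneg _).trans (hQ k)
    refine mul_nonneg (div_nonneg ?_ (by positivity)) (pow_nonneg h1 _)
    split_ifs
    · exact (norm_nonneg _).trans (h _ _)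
    · exact zero_le_one

/-- The nonnegative case comes first: there summability over multi-indices follows from summability
of the iterated sums. It then provides the absolute convergence for the complex case. -/
theorem hasSum_multTerm_real {m : ℕ} (p : Fin m → Prop) [DecidablePred p] {al q : Fin m → ℝ}
    {a : ℝ} (hal : ∀ k, 0 ≤ al k) (hq : ∀ k, 0 ≤ q k) (ha : 0 ≤ a) (hq1 : ∀ k, p k → q k < 1)
    (hq2 : ∑ k, (if p k then 0 else q k) < 1) :
    HasSum (multTerm p al q a)
      ((∏ k, if p k then Real.exp (-al k * Real.log (1 - q k)) else 1) *
        Real.exp (-a * Real.log (1 - ∑ k, if p k then 0 else q k))) := by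
  induction m generalizing a with
  | zero =>
    have h := hasSum_unique (multTerm p al q a)
    simpa [multTerm] using h
  | succ m ih =>
    rw [← (Fin.consEquiv fun _ : Fin (m + 1) => ℕ).hasSum_iff]
    have hnn : 0 ≤ (multTerm p al q a ∘ (Fin.consEquiv fun _ : Fin (m + 1) => ℕ)) :=
      fun n => multTerm_nonneg hal hq ha _
    suffices h : ∃ G : ℕ → ℝ,
        (∀ n, HasSum (fun l : Fin m → ℕ => multTerm p al q a (Fin.cons n l)) (G n)) ∧
        HasSum G ((∏ k, if p k then Real.exp (-al k * Real.log (1 - q k)) else 1) *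
          Real.exp (-a * Real.log (1 - ∑ k, if p k then 0 else q k))) by
      obtain ⟨G, h1, h2⟩ := h
      have h3 : Summable (multTerm p al q a ∘ (Fin.consEquiv fun _ : Fin (m + 1) => ℕ)) := by
        refine (summable_prod_of_nonneg hnn).2 ⟨fun n => (h1 n).summable, ?_⟩
        refine h2.summable.congr fun n => ?_
        exact (h1 n).tsum_eq.symm
      have h4 := h3.hasSum
      rwa [(h4.prod_fiberwise h1).unique h2] at h4
    by_cases hp : p 0
    · simp only [Fin.sum_univ_succ, hp, if_true, zero_add] at hq2 ⊢
      have h0 := ih (fun k => p k.succ) (a := a) (fun k => hal k.succ) (fun k => hq k.succ) ha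
        (fun k => hq1 k.succ) hq2
      simp_rw [multTerm_cons_of_pos al q a _ _ hp]
      refine ⟨_, fun n => h0.mul_left _, ?_⟩
      · convert! (hasSum_ascPochhammer_real (al 0) (hq 0) (hq1 0 hp)).mul_right _ using 1
        simp only [Fin.prod_univ_succ, hp, if_true, mul_assoc]
    · simp only [Fin.sum_univ_succ, hp, if_false] at hq2 ⊢
      set S := ∑ k : Fin m, (if p k.succ then 0 else q k.succ) with hS
      have hS1 : S < 1 := by linarith [hq 0]
      have h0 := fun n : ℕ => ih (fun k => p k.succ) (a := a + n) (fun k => hal k.succ)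
        (fun k => hq k.succ) (by positivity) (fun k => hq1 k.succ) hS1
      simp_rw [multTerm_cons_of_neg al q a _ _ hp]
      refine ⟨_, fun n => (h0 n).mul_left _, ?_⟩
      · have hpos : 0 < 1 - S := by linarith
        -- Summing over the other indices gives `(1 - S) ^ (-a - n)`. So the series in `n` is a
        -- binomial series at `q₀ / (1 - S)`, and `(1 - S) (1 - q₀ / (1 - S)) = 1 - q₀ - S`.
        convert! (hasSum_ascPochhammer_real a (q := q 0 / (1 - S)) (div_nonneg (hq 0) hpos.le)
          ((div_lt_one hpos).2 (by linarith))).mul_right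
          ((∏ k : Fin m, if p k.succ then Real.exp (-al k.succ * Real.log (1 - q k.succ)) else 1) *
            Real.exp (-a * Real.log (1 - S))) using 1
        · funext n
          rw [← hS, show -(a + n) * Real.log (1 - S) = -a * Real.log (1 - S) +
            n * (-Real.log (1 - S)) by ring, Real.exp_add, Real.exp_nat_mul, Real.exp_neg,
            Real.exp_log hpos, div_pow, inv_pow]
          ring
        · simp only [Fin.prod_univ_succ, hp, if_false, one_mul]
          rw [mul_left_comm, ← Real.exp_add, ← mul_add, ← Real.log_mul (by
            have : q 0 / (1 - S) < 1 := (div_lt_one hpos).2 (by linarith)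
            linarith) hpos.ne']
          congr 4
          field_simp
          ring

theorem clog_mul_of_re_pos {z w : ℂ} (hz : 0 < z.re) (hw : 0 < w.re) :
    Complex.log (z * w) = Complex.log z + Complex.log w := by
  have h1 := abs_lt.1 (Complex.abs_arg_lt_pi_div_two_iff.2 (Or.inl hz))
  have h2 := abs_lt.1 (Complex.abs_arg_lt_pi_div_two_iff.2 (Or.inl hw))
  exact Complex.log_mul (ne_zero_of_re_pos hz) (ne_zero_of_re_pos hw)
    ⟨by linarith [h1.1, h2.1], by linarith [h1.2, h2.2]⟩

/-- The recursion of the real case, with summability from the majorant. Both factors `1 - S` and `1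
- q₀ / (1 - S)` have positive real part, so their principal logarithms add up. -/
theorem hasSum_multTerm {m : ℕ} (p : Fin m → Prop) [DecidablePred p] {al q : Fin m → ℂ}
    {a : ℂ} (hq1 : ∀ k, p k → ‖q k‖ < 1) (hq2 : ∑ k, (if p k then 0 else ‖q k‖) < 1) :
    HasSum (multTerm p al q a)
      ((∏ k, if p k then Complex.exp (-al k * Complex.log (1 - q k)) else 1) *
        Complex.exp (-a * Complex.log (1 - ∑ k, if p k then 0 else q k))) := by
  induction m generalizing a with
  | zero =>
    have h := hasSum_unique (multTerm p al q a)
    simpa [multTerm] using h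
  | succ m ih =>
    have h3 : Summable (multTerm p al q a ∘ (Fin.consEquiv fun _ : Fin (m + 1) => ℕ)) := by
      rw [(Fin.consEquiv fun _ : Fin (m + 1) => ℕ).summable_iff]
      exact (hasSum_multTerm_real p (fun k => norm_nonneg (al k)) (fun k => norm_nonneg (q k))
        (norm_nonneg a) hq1 hq2).summable.of_norm_bounded
          fun n => norm_multTerm_le (fun _ => le_rfl) n
    rw [← (Fin.consEquiv fun _ : Fin (m + 1) => ℕ).hasSum_iff]
    suffices h : ∃ G : ℕ → ℂ,
        (∀ n, HasSum (fun l : Fin m → ℕ => multTerm p al q a (Fin.cons n l)) (G n)) ∧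
        HasSum G ((∏ k, if p k then Complex.exp (-al k * Complex.log (1 - q k)) else 1) *
          Complex.exp (-a * Complex.log (1 - ∑ k, if p k then 0 else q k))) by
      obtain ⟨G, h1, h2⟩ := h
      have h4 := h3.hasSum
      rwa [(h4.prod_fiberwise h1).unique h2] at h4
    by_cases hp : p 0
    · simp only [Fin.sum_univ_succ, hp, if_true, zero_add] at hq2 ⊢
      have h0 := ih (fun k => p k.succ) (al := fun k => al k.succ) (q := fun k => q k.succ) (a := a)
        (fun k => hq1 k.succ) hq2
      simp_rw [multTerm_cons_of_pos al q a _ _ hp]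
      refine ⟨_, fun n => h0.mul_left _, ?_⟩
      · convert! (hasSum_poch (al 0) (hq1 0 hp)).mul_right _ using 1
        simp only [Fin.prod_univ_succ, hp, if_true, mul_assoc]
    · simp only [Fin.sum_univ_succ, hp, if_false] at hq2 ⊢
      set S := ∑ k : Fin m, (if p k.succ then 0 else q k.succ) with hS
      have hSn : ‖S‖ ≤ ∑ k : Fin m, (if p k.succ then 0 else ‖q k.succ‖) := by
        refine (norm_sum_le _ _).trans (Finset.sum_le_sum fun k _ => ?_)
        split_ifs <;> simp
      have hS1 : ‖S‖ < 1 := by linarith [norm_nonneg (q 0)]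
      have h0 := fun n : ℕ => ih (fun k => p k.succ) (al := fun k => al k.succ)
        (q := fun k => q k.succ) (a := a + n) (fun k => hq1 k.succ)
        (by linarith [norm_nonneg (q 0)])
      simp_rw [multTerm_cons_of_neg al q a _ _ hp]
      refine ⟨_, fun n => (h0 n).mul_left _, ?_⟩
      · have hre := one_sub_re_pos hS1
        have hne : 1 - S ≠ 0 := ne_zero_of_re_pos hre
        have hlt : ‖q 0 / (1 - S)‖ < 1 := by
          rw [norm_div, div_lt_one (norm_pos_iff.2 hne)]
          have := norm_sub_norm_le (1 : ℂ) S
          rw [norm_one] at this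
          linarith
        convert! (hasSum_poch a hlt).mul_right
          ((∏ k : Fin m, if p k.succ then
            Complex.exp (-al k.succ * Complex.log (1 - q k.succ)) else 1) *
            Complex.exp (-a * Complex.log (1 - S))) using 1
        · funext n
          rw [← hS, show -(a + n) * Complex.log (1 - S) = -a * Complex.log (1 - S) +
            n * (-Complex.log (1 - S)) by ring, Complex.exp_add, Complex.exp_nat_mul,
            Complex.exp_neg, Complex.exp_log hne, div_pow, inv_pow, poch]
          ring
        · simp only [Fin.prod_univ_succ, hp, if_false, one_mul]
          rw [mul_left_comm, ← Complex.exp_add, ← mul_add,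
            ← clog_mul_of_re_pos (one_sub_re_pos hlt) hre]
          congr 4
          field_simp
          ring

/-! ### Hyperplanes and slots -/

/-- The affine function that vanishes on a hyperplane. -/
noncomputable def hypVal {m : ℕ} {R : Type*} [CommRing R] (I : Finset (Fin m))
    (s : Fin m → R) : Hyp m → R
  | Sum.inl k => s k
  | Sum.inr (Sum.inl k) => 1 - s k
  | Sum.inr (Sum.inr _) => 1 - ∑ i ∈ I, s i

/-- The radius of the circle around a hyperplane. -/
noncomputable def hypRad {m : ℕ} (ε : Fin m → ℝ) (ε₀ : ℝ) : Hyp m → ℝ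
  | Sum.inl k => ε k
  | Sum.inr (Sum.inl k) => ε k
  | Sum.inr (Sum.inr _) => ε₀

/-- The walls of the polytope (for `I = ∅`, together with the irrelevant `hSum`). -/
def activeHyp {m : ℕ} (I : Finset (Fin m)) : Finset (Hyp m) :=
  Finset.univ.filter fun L => ∀ k ∈ I, L ≠ hOne k

theorem hypRad_pos {m : ℕ} {ε : Fin m → ℝ} {ε₀ : ℝ} {x : Fin m → ℝ} (h : Admissible ε ε₀ x)
    (L : Hyp m) : 0 < hypRad ε ε₀ L := by
  rcases L with k | k | u
  · exact h.eps_pos k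
  · exact h.eps_pos k
  · exact h.eps₀_pos

theorem hypRad_le_one {m : ℕ} {ε : Fin m → ℝ} {ε₀ : ℝ} {x : Fin m → ℝ} (h : Admissible ε ε₀ x)
    (L : Hyp m) : hypRad ε ε₀ L ≤ 1 := by
  rcases L with k | k | u
  · exact (h.eps_lt k).le.trans (by norm_num)
  · exact (h.eps_lt k).le.trans (by norm_num)
  · have := h.eps₀_lt
    have h1 : 0 ≤ ∑ k, ε k := Finset.sum_nonneg fun k _ => (h.eps_pos k).le
    simp only [hypRad]
    linarith

section slots

variable {m : ℕ} {I : Finset (Fin m)}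

theorem mem_activeHyp {L : Hyp m} : L ∈ activeHyp I ↔ ∀ k ∈ I, L ≠ hOne k := by
  simp [activeHyp]

theorem prod_activeHyp {R : Type*} [CommMonoid R] (I : Finset (Fin m)) (g : Hyp m → R) :
    ∏ L ∈ activeHyp I, g L = (∏ k, g (hZero k)) * (∏ j ∈ Iᶜ, g (hOne j)) * g hSum := by
  rw [activeHyp, Finset.prod_filter, Fintype.prod_sum_type, Fintype.prod_sum_type]
  simp only [ne_eq, reduceCtorEq, not_false_eq_true, implies_true, if_true, Finset.univ_unique,
    Finset.prod_singleton, Sum.inr.injEq, Sum.inl.injEq]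
  rw [mul_assoc]
  congr 2
  have : Iᶜ = Finset.univ.filter fun j => j ∉ I := by
    ext j
    simp
  rw [this, Finset.prod_filter]
  refine Finset.prod_congr rfl fun j _ => if_congr ?_ rfl rfl
  constructor
  · intro h hj
    exact h j hj rfl
  · rintro h k hk rfl
    exact h hk

theorem sum_activeHyp {R : Type*} [AddCommMonoid R] (I : Finset (Fin m)) (g : Hyp m → R) :
    ∑ L ∈ activeHyp I, g L = (∑ k, g (hZero k)) + (∑ j ∈ Iᶜ, g (hOne j)) + g hSum :=
  prod_activeHyp (R := Multiplicative R) I g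

theorem stratum_subset (J : Stratum I) : J.1 ⊆ activeHyp I := by
  intro L hL
  refine mem_activeHyp.2 fun k hk h => ?_
  rw [h] at hL
  exact (J.2.1 k hL).1 hk

theorem pivot_mem {J : Stratum I} (h : hSum ∈ J.1) : pivot J h ∈ I :=
  (Finset.mem_filter.1 ((freeIdx J).min'_mem _)).1

theorem pivot_zero {J : Stratum I} (h : hSum ∈ J.1) : hZero (pivot J h) ∉ J.1 :=
  (Finset.mem_filter.1 ((freeIdx J).min'_mem _)).2

theorem pivot_one {J : Stratum I} (h : hSum ∈ J.1) : hOne (pivot J h) ∉ J.1 :=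
  fun h1 => (J.2.1 _ h1).1 (pivot_mem h)

/-- The slots of the parameter that are angles. -/
def angSlots (J : Stratum I) : Finset (Fin m) :=
  Finset.univ.filter fun k => hZero k ∈ J.1 ∨ hOne k ∈ J.1 ∨ ∃ h : hSum ∈ J.1, k = pivot J h

theorem mem_angSlots {J : Stratum I} {k : Fin m} :
    k ∈ angSlots J ↔ hZero k ∈ J.1 ∨ hOne k ∈ J.1 ∨ ∃ h : hSum ∈ J.1, k = pivot J h := by
  simp [angSlots]

/-- The wall whose circle uses the angle in the slot `k`. -/
def hypAt (J : Stratum I) (k : Fin m) : Hyp m :=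
  if hZero k ∈ J.1 then hZero k else if hOne k ∈ J.1 then hOne k else hSum

theorem hypAt_of_zero {J : Stratum I} {k : Fin m} (h : hZero k ∈ J.1) : hypAt J k = hZero k :=
  if_pos h

theorem hypAt_of_one {J : Stratum I} {k : Fin m} (h : hOne k ∈ J.1) : hypAt J k = hOne k := by
  rw [hypAt, if_neg (J.2.1 k h).2, if_pos h]

theorem hypAt_pivot {J : Stratum I} (h : hSum ∈ J.1) : hypAt J (pivot J h) = hSum := by
  rw [hypAt, if_neg (pivot_zero h), if_neg (pivot_one h)]

theorem hypAt_mem {J : Stratum I} {k : Fin m} (hk : k ∈ angSlots J) : hypAt J k ∈ J.1 := by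
  rcases mem_angSlots.1 hk with h | h | ⟨h, rfl⟩
  · rwa [hypAt_of_zero h]
  · rwa [hypAt_of_one h]
  · rwa [hypAt_pivot h]

theorem exists_hypAt {J : Stratum I} {L : Hyp m} (hL : L ∈ J.1) :
    ∃ k ∈ angSlots J, hypAt J k = L := by
  rcases L with k | k | u
  · exact ⟨k, mem_angSlots.2 (Or.inl hL), hypAt_of_zero hL⟩
  · exact ⟨k, mem_angSlots.2 (Or.inr (Or.inl hL)), hypAt_of_one hL⟩
  · exact ⟨pivot J hL, mem_angSlots.2 (Or.inr (Or.inr ⟨hL, rfl⟩)), hypAt_pivot hL⟩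

/-- `hypAt J` is a bijection from the angular slots onto `J`; the wall `hSum` is served by the pivot
slot. Products over walls thus become products over coordinates. -/
theorem prod_stratum {R : Type*} [CommMonoid R] (J : Stratum I) (g : Hyp m → R) :
    ∏ L ∈ J.1, g L = ∏ k ∈ angSlots J, g (hypAt J k) := by
  symm
  refine Finset.prod_nbij (hypAt J) (fun k hk => hypAt_mem hk) ?_
    (fun L hL => exists_hypAt hL) fun _ _ => rfl
  intro k hk l hl hkl
  rcases mem_angSlots.1 hk with h | h | ⟨h, hk'⟩ <;>
    rcases mem_angSlots.1 hl with h' | h' | ⟨h', hl'⟩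
  · rw [hypAt_of_zero h, hypAt_of_zero h'] at hkl
    exact Sum.inl.inj hkl
  · rw [hypAt_of_zero h, hypAt_of_one h'] at hkl
    cases hkl
  · subst hl'
    rw [hypAt_of_zero h, hypAt_pivot h'] at hkl
    cases hkl
  · rw [hypAt_of_one h, hypAt_of_zero h'] at hkl
    cases hkl
  · rw [hypAt_of_one h, hypAt_of_one h'] at hkl
    exact Sum.inl.inj (Sum.inr.inj hkl)
  · subst hl'
    rw [hypAt_of_one h, hypAt_pivot h'] at hkl
    cases hkl
  · subst hk'
    rw [hypAt_pivot h, hypAt_of_zero h'] at hkl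
    cases hkl
  · subst hk'
    rw [hypAt_pivot h, hypAt_of_one h'] at hkl
    cases hkl
  · rw [hk', hl']

theorem prod_activeHyp_stratum {R : Type*} [CommMonoid R] (J : Stratum I) (g : Hyp m → R) :
    ∏ L ∈ activeHyp I, g L =
      (∏ k ∈ angSlots J, g (hypAt J k)) * ∏ L ∈ activeHyp I \ J.1, g L := by
  rw [← prod_stratum, mul_comm, Finset.prod_sdiff (stratum_subset J)]

theorem sum_activeHyp_stratum {R : Type*} [AddCommMonoid R] (J : Stratum I) (g : Hyp m → R) :
    ∑ L ∈ activeHyp I, g L =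
      (∑ k ∈ angSlots J, g (hypAt J k)) + ∑ L ∈ activeHyp I \ J.1, g L :=
  prod_activeHyp_stratum (R := Multiplicative R) J g

/-- The slot of the pivot holds an angle, while the pivot coordinate of the face point is computed
from the other coordinates. Hence no angular slot influences the face point, and the cell's domain
splits into face and angles. -/
theorem facePoint_update {ε : Fin m → ℝ} {ε₀ : ℝ} {J : Stratum I} {k : Fin m}
    (hk : k ∈ angSlots J) (y : Fin m → ℝ) (t : ℝ) :
    facePoint ε ε₀ J (Function.update y k t) = facePoint ε ε₀ J y := by
  have h1 : ∀ i, (¬∃ h : hSum ∈ J.1, i = pivot J h) →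
      faceCoord ε J (Function.update y k t) i = faceCoord ε J y i := by
    intro i hi
    unfold faceCoord
    split_ifs with h1 h2
    · rfl
    · rfl
    · rw [Function.update_of_ne]
      rintro rfl
      rcases mem_angSlots.1 hk with h | h | h
      · exact h1 h
      · exact h2 h
      · exact hi h
  funext i
  unfold facePoint
  split_ifs with h
  · congr 1
    refine Finset.sum_congr rfl fun j hj => h1 j ?_
    rintro ⟨h', rfl⟩
    obtain ⟨h'', rfl⟩ := h
    exact (Finset.mem_erase.1 hj).1 rfl
  · exact h1 i h

theorem facePoint_of_notMem_angSlots {ε : Fin m → ℝ} {ε₀ : ℝ} {J : Stratum I} {k : Fin m}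
    (hk : k ∉ angSlots J) (y : Fin m → ℝ) : facePoint ε ε₀ J y k = y k := by
  rw [mem_angSlots] at hk
  push Not at hk
  rw [facePoint, if_neg (by rintro ⟨h, h'⟩; exact hk.2.2 h h'), faceCoord, if_neg hk.1,
    if_neg hk.2.1]

end slots

/-! ### The cells with arbitrary values in the slots -/

section cells

variable {m : ℕ} {I : Finset (Fin m)}

/-- The dilation factor as a function of the values in the angular slots. -/
noncomputable def slotDil (ε : Fin m → ℝ) (ε₀ : ℝ) (J : Stratum I) (z : Fin m → ℂ) : ℂ :=
  1 + (∑ i ∈ I.filter (fun i => hZero i ∈ J.1), ((ε i : ℂ) - z i)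
      + if h : hSum ∈ J.1 then (ε₀ : ℂ) - z (pivot J h) else 0) /
        ((1 - ∑ i ∈ I, ε i - ε₀ : ℝ) : ℂ)

/-- The cell as a function of the values in the angular slots and of the point of the face. -/
noncomputable def slotMap (ε : Fin m → ℝ) (ε₀ : ℝ) (J : Stratum I) (z : Fin m → ℂ) (y : Fin m → ℝ)
    (k : Fin m) : ℂ :=
  if hZero k ∈ J.1 then z k
  else if hOne k ∈ J.1 then 1 - z k
  else if k ∈ I then (ε k : ℂ) + slotDil ε ε₀ J z * ((facePoint ε ε₀ J y k - ε k : ℝ) : ℂ)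
  else (y k : ℂ)

/-- The radius of the circle in the slot `k`. -/
noncomputable def slotRad (ε : Fin m → ℝ) (ε₀ : ℝ) (J : Stratum I) (k : Fin m) : ℝ :=
  hypRad ε ε₀ (hypAt J k)

variable {ε : Fin m → ℝ} {ε₀ : ℝ} {x : Fin m → ℝ}

theorem slotDil_circleSlots (J : Stratum I) (y : Fin m → ℝ) :
    slotDil ε ε₀ J (circleSlots (slotRad ε ε₀ J) (angSlots J) y) = dilation ε ε₀ J y := by
  unfold slotDil dilation outerDefect
  congr 3
  · refine Finset.sum_congr rfl fun i hi => ?_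
    have h := (Finset.mem_filter.1 hi).2
    rw [circleSlots, if_pos (mem_angSlots.2 (Or.inl h)), slotRad, hypAt_of_zero h]
    rfl
  · split_ifs with h
    · rw [circleSlots, if_pos (mem_angSlots.2 (Or.inr (Or.inr ⟨h, rfl⟩))), slotRad, hypAt_pivot h]
      rfl
    · rfl

/-- `slotMap` with points of circles in its slots is the cell; with real numbers in its slots it
will be the contracted cell. The contraction moves only the slot values. -/
theorem slotMap_circleSlots (J : Stratum I) (y : Fin m → ℝ) :
    slotMap ε ε₀ J (circleSlots (slotRad ε ε₀ J) (angSlots J) y) y = cellMap ε ε₀ J y := by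
  funext k
  unfold slotMap cellMap
  rw [slotDil_circleSlots]
  split_ifs with h1 h2 h3
  · rw [circleSlots, if_pos (mem_angSlots.2 (Or.inl h1)), slotRad, hypAt_of_zero h1]
    rfl
  · rw [circleSlots, if_pos (mem_angSlots.2 (Or.inr (Or.inl h2))), slotRad, hypAt_of_one h2]
    rfl
  · rfl
  · rfl

/-- The dilation was chosen so that the barycentric coordinates of the simplex add up to `1`; for a
free wall `1 - ∑ s_i` this shows that its form is stretched like the other free coordinates. -/
theorem sum_slotMap (h : Admissible ε ε₀ x) (J : Stratum I) (z : Fin m → ℂ) (y : Fin m → ℝ) :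
    1 - ∑ i ∈ I, slotMap ε ε₀ J z y i =
      (ε₀ : ℂ) - (if h : hSum ∈ J.1 then (ε₀ : ℂ) - z (pivot J h) else 0) +
      slotDil ε ε₀ J z * ((1 - ∑ i ∈ I, facePoint ε ε₀ J y i - ε₀ : ℝ) : ℂ) := by
  have h1 : ∀ i ∈ I, slotMap ε ε₀ J z y i =
      (ε i : ℂ) + slotDil ε ε₀ J z * ((facePoint ε ε₀ J y i - ε i : ℝ) : ℂ) -
        if hZero i ∈ J.1 then (ε i : ℂ) - z i else 0 := by
    intro i hi
    unfold slotMap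
    by_cases hz : hZero i ∈ J.1
    · rw [if_pos hz, if_pos hz, facePoint_of_zero hz]
      simp
    · rw [if_neg hz, if_neg hz, if_neg (fun ho => (J.2.1 i ho).1 hi), if_pos hi, sub_zero]
  have hN : ((1 - ∑ i ∈ I, ε i - ε₀ : ℝ) : ℂ) ≠ 0 := by
    exact_mod_cast (sum_eps_lt h I).ne'
  have h2 : slotDil ε ε₀ J z * ((1 - ∑ i ∈ I, ε i - ε₀ : ℝ) : ℂ) =
      ((1 - ∑ i ∈ I, ε i - ε₀ : ℝ) : ℂ) +
      ((∑ i ∈ I, if hZero i ∈ J.1 then (ε i : ℂ) - z i else 0)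
        + if h : hSum ∈ J.1 then (ε₀ : ℂ) - z (pivot J h) else 0) := by
    unfold slotDil
    rw [Finset.sum_filter, add_mul, div_mul_cancel₀ _ hN, one_mul]
  rw [Finset.sum_congr rfl h1, Finset.sum_sub_distrib, Finset.sum_add_distrib, ← Finset.mul_sum]
  push_cast at h2 ⊢
  rw [Finset.sum_sub_distrib]
  linear_combination (-1 : ℂ) * h2

theorem sum_slotMap_of_mem (h : Admissible ε ε₀ x) {J : Stratum I} (hJ : hSum ∈ J.1)
    (z : Fin m → ℂ) (y : Fin m → ℝ) :
    1 - ∑ i ∈ I, slotMap ε ε₀ J z y i = z (pivot J hJ) := by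
  rw [sum_slotMap h, sum_facePoint hJ, dif_pos hJ]
  push_cast
  ring

/-- The power belonging to a wall in `J` is a pure power of a single slot variable, as the
contraction of its circle requires. -/
theorem hypVal_hypAt (h : Admissible ε ε₀ x) {J : Stratum I} {k : Fin m} (hk : k ∈ angSlots J)
    (z : Fin m → ℂ) (y : Fin m → ℝ) : hypVal I (slotMap ε ε₀ J z y) (hypAt J k) = z k := by
  rcases mem_angSlots.1 hk with h1 | h1 | ⟨h1, rfl⟩
  · rw [hypAt_of_zero h1]
    simp only [hypVal, slotMap, if_pos h1]
  · rw [hypAt_of_one h1]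
    simp only [hypVal, slotMap, if_neg (J.2.1 k h1).2, if_pos h1]
    ring
  · rw [hypAt_pivot h1]
    exact sum_slotMap_of_mem h h1 z y

/-- Each slot value has real part at most its starting value, so what the slots give up can only
stretch the free coordinates. -/
theorem one_le_slotDil_re (h : Admissible ε ε₀ x) (J : Stratum I) {z : Fin m → ℂ}
    (hz : ∀ k ∈ angSlots J, (z k).re ≤ slotRad ε ε₀ J k) : 1 ≤ (slotDil ε ε₀ J z).re := by
  unfold slotDil
  rw [Complex.add_re, Complex.div_ofReal_re, Complex.one_re, Complex.add_re, Complex.re_sum]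
  have h1 : 0 ≤ (if h : hSum ∈ J.1 then (ε₀ : ℂ) - z (pivot J h) else 0).re := by
    split_ifs with hJ
    · have := hz _ (mem_angSlots.2 (Or.inr (Or.inr ⟨hJ, rfl⟩)))
      rw [slotRad, hypAt_pivot hJ] at this
      simpa [hypRad] using this
    · simp
  have h2 : 0 ≤ ∑ i ∈ I.filter (fun i => hZero i ∈ J.1), ((ε i : ℂ) - z i).re := by
    refine Finset.sum_nonneg fun i hi => ?_
    have hi' := (Finset.mem_filter.1 hi).2
    have := hz _ (mem_angSlots.2 (Or.inl hi'))
    rw [slotRad, hypAt_of_zero hi'] at this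
    simpa [hypRad] using this
  have := div_nonneg (add_nonneg h2 h1) (sum_eps_lt h I).le
  linarith

/-- Free barycentric coordinates are minimal value plus dilation times a nonnegative distance; for a
free wall at the other end of an interval, radii below `1/4` suffice. So on the whole polydisc of
slot values the forms of the walls outside `J` stay in the right half plane, where the principal
logarithm is holomorphic. -/
theorem hypRad_le_hypVal_re (h : Admissible ε ε₀ x) {J : Stratum I} {z : Fin m → ℂ}
    (hz : ∀ k ∈ angSlots J, (z k).re ≤ slotRad ε ε₀ J k) {y : Fin m → ℝ}
    (hy : facePoint ε ε₀ J y ∈ polytope I ε ε₀) {L : Hyp m} (hL : L ∈ activeHyp I \ J.1) :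
    hypRad ε ε₀ L ≤ (hypVal I (slotMap ε ε₀ J z y) L).re := by
  obtain ⟨hL1, hL2⟩ := Finset.mem_sdiff.1 hL
  have hD := one_le_slotDil_re h J hz
  rcases L with k | k | u
  · simp only [hypVal, hypRad, slotMap]
    rw [if_neg hL2]
    split_ifs with h1 h2
    · have := hz k (mem_angSlots.2 (Or.inr (Or.inl h1)))
      rw [slotRad, hypAt_of_one h1] at this
      simp only [hypRad] at this
      have := h.eps_lt k
      simp only [Complex.sub_re, Complex.one_re]
      linarith
    · have h3 := hy.1 k h2
      simp only [Complex.add_re, Complex.ofReal_re, Complex.re_mul_ofReal]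
      nlinarith
    · have h3 := (hy.2.2 k h2).1
      rw [facePoint_of_notMem h2, faceCoord, if_neg hL2, if_neg h1] at h3
      simpa using h3
  · have hI : k ∉ I := fun hk => (mem_activeHyp.1 hL1) k hk rfl
    simp only [hypVal, hypRad, slotMap, if_neg hI]
    rw [if_neg hL2]
    split_ifs with h1
    · have := hz k (mem_angSlots.2 (Or.inl h1))
      rw [slotRad, hypAt_of_zero h1] at this
      simp only [hypRad] at this
      have := h.eps_lt k
      simp only [Complex.sub_re, Complex.one_re]
      linarith
    · have h3 := (hy.2.2 k hI).2
      rw [facePoint_of_notMem hI, faceCoord, if_neg h1, if_neg hL2] at h3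
      simpa using h3
  · simp only [hypVal, hypRad]
    rw [sum_slotMap h, dif_neg hL2]
    have h3 := hy.2.1
    simp only [sub_zero, Complex.add_re, Complex.ofReal_re, Complex.re_mul_ofReal]
    nlinarith

theorem slotDil_congr {J : Stratum I} {z w : Fin m → ℂ} (hzw : ∀ k ∈ angSlots J, z k = w k) :
    slotDil ε ε₀ J z = slotDil ε ε₀ J w := by
  unfold slotDil
  congr 3
  · refine Finset.sum_congr rfl fun i hi => ?_
    rw [hzw i (mem_angSlots.2 (Or.inl (Finset.mem_filter.1 hi).2))]
  · split_ifs with h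
    · rw [hzw _ (mem_angSlots.2 (Or.inr (Or.inr ⟨h, rfl⟩)))]
    · rfl

theorem slotMap_update_right {J : Stratum I} {k : Fin m} (hk : k ∈ angSlots J) (z : Fin m → ℂ)
    (y : Fin m → ℝ) (t : ℝ) :
    slotMap ε ε₀ J z (Function.update y k t) = slotMap ε ε₀ J z y := by
  funext i
  unfold slotMap
  rw [facePoint_update hk]
  split_ifs with h1 h2 h3
  · rfl
  · rfl
  · rfl
  · rw [Function.update_of_ne]
    rintro rfl
    rcases mem_angSlots.1 hk with h | h | ⟨h, rfl⟩
    · exact h1 h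
    · exact h2 h
    · exact h3 (pivot_mem h)

theorem differentiable_slotDil (J : Stratum I) : Differentiable ℂ (slotDil ε ε₀ J) := by
  unfold slotDil
  split_ifs <;> fun_prop

theorem differentiable_slotMap (J : Stratum I) (y : Fin m → ℝ) (k : Fin m) :
    Differentiable ℂ fun z => slotMap ε ε₀ J z y k := by
  have := differentiable_slotDil (ε := ε) (ε₀ := ε₀) J
  unfold slotMap
  split_ifs <;> fun_prop

theorem continuous_slotMap (J : Stratum I) (k : Fin m) :
    Continuous fun p : (Fin m → ℂ) × (Fin m → ℝ) => slotMap ε ε₀ J p.1 p.2 k := by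
  have h1 := (differentiable_slotDil (ε := ε) (ε₀ := ε₀) J).continuous
  have h2 := (contDiff_facePoint (ε := ε) (ε₀ := ε₀) J k).continuous
  unfold slotMap
  split_ifs
  · fun_prop
  · fun_prop
  · exact continuous_const.add ((h1.comp continuous_fst).mul
      (Complex.continuous_ofReal.comp ((h2.comp continuous_snd).sub continuous_const)))
  · fun_prop

end cells

/-! ### The Jacobian determinant of a cell -/

section jacobian

variable {m : ℕ} {I : Finset (Fin m)} {ε : Fin m → ℝ} {ε₀ : ℝ} {x : Fin m → ℝ}

/-- The components of the cell after the component of the pivot has been replaced by the sum of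
the components that do not run through circles. -/
noncomputable def reducedMap (ε : Fin m → ℝ) (ε₀ : ℝ) (J : Stratum I) (z : Fin m → ℂ)
    (y : Fin m → ℝ) (k : Fin m) : ℂ :=
  if ∃ h : hSum ∈ J.1, k = pivot J h then
    1 - z k - ∑ i ∈ I.filter (fun i => hZero i ∈ J.1), z i
  else slotMap ε ε₀ J z y k

/-- The sum of all barycentric coordinates is `1`, so the free components add up to an expression in
the slot variables that involves neither dilation nor face point. This is the row operation that
makes the Jacobian matrix triangular. -/
theorem sum_freeIdx_slotMap (h : Admissible ε ε₀ x) {J : Stratum I} (hJ : hSum ∈ J.1)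
    (z : Fin m → ℂ) (y : Fin m → ℝ) :
    ∑ i ∈ freeIdx J, slotMap ε ε₀ J z y i = reducedMap ε ε₀ J z y (pivot J hJ) := by
  have h1 := sum_slotMap_of_mem h hJ z y
  rw [← Finset.sum_filter_add_sum_filter_not I (fun i => hZero i ∈ J.1)] at h1
  have h2 : ∑ i ∈ I.filter (fun i => hZero i ∈ J.1), slotMap ε ε₀ J z y i =
      ∑ i ∈ I.filter (fun i => hZero i ∈ J.1), z i :=
    Finset.sum_congr rfl fun i hi => by rw [slotMap, if_pos (Finset.mem_filter.1 hi).2]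
  rw [h2] at h1
  rw [reducedMap, if_pos ⟨hJ, rfl⟩, freeIdx]
  linear_combination -h1

theorem differentiableAt_slotMap {zeta : Fin m → ℝ → ℂ} {y : Fin m → ℝ}
    (hz : ∀ k, DifferentiableAt ℝ (zeta k) (y k)) (J : Stratum I) (i : Fin m) :
    DifferentiableAt ℝ (fun y => slotMap ε ε₀ J (fun k => zeta k (y k)) y i) y := by
  have h0 : ∀ k, DifferentiableAt ℝ (fun y : Fin m → ℝ => zeta k (y k)) y := fun k =>
    (hz k).comp y (by fun_prop)
  have h1 : DifferentiableAt ℝ (fun y : Fin m → ℝ => slotDil ε ε₀ J (fun k => zeta k (y k))) y :=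
    (((differentiable_slotDil J).restrictScalars ℝ) _).comp y (differentiableAt_pi.2 h0)
  have h2 : DifferentiableAt ℝ (fun y => facePoint ε ε₀ J y i) y :=
    (contDiff_facePoint J i).differentiable (by simp) y
  unfold slotMap
  split_ifs
  · exact h0 i
  · exact (h0 i).const_sub 1
  · exact ((h1.mul (Complex.ofRealCLM.differentiableAt.comp y (h2.sub_const _)))).const_add _
  · exact Complex.ofRealCLM.differentiableAt.comp y (by fun_prop)

/-- The Jacobian determinant of a cell, for arbitrary curves in the slots. -/
theorem det_slotMap (h : Admissible ε ε₀ x) (J : Stratum I) {zeta zeta' : Fin m → ℝ → ℂ}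
    (hz : ∀ k t, HasDerivAt (zeta k) (zeta' k t) t) (y : Fin m → ℝ) :
    (∏ L ∈ J.1, orient L) * (Matrix.of fun i k : Fin m =>
      fderiv ℝ (fun y => slotMap ε ε₀ J (fun k => zeta k (y k)) y) y (Pi.single k 1) i).det =
    (∏ k ∈ angSlots J, zeta' k (y k)) *
      slotDil ε ε₀ J (fun k => zeta k (y k)) ^ (I \ angSlots J).card := by
  set M : Matrix (Fin m) (Fin m) ℂ := Matrix.of fun i k : Fin m =>
      fderiv ℝ (fun y => slotMap ε ε₀ J (fun k => zeta k (y k)) y) y (Pi.single k 1) i with hM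
  have hdiff : ∀ i, DifferentiableAt ℝ (fun y => slotMap ε ε₀ J (fun k => zeta k (y k)) y i) y :=
    fun i => differentiableAt_slotMap (fun k => (hz k _).differentiableAt) J i
  -- The entries are read as derivatives along coordinate lines; each row below is then computed by
  -- uniqueness of the derivative.
  have hentry : ∀ i k, HasDerivAt (fun t => slotMap ε ε₀ J
      (fun l => zeta l (Function.update y k t l)) (Function.update y k t) i) (M i k) (y k) := by
    intro i k
    have h1 := (differentiableAt_pi.2 hdiff).hasFDerivAt
    have h2 := (hasFDerivAt_pi'.1 h1 i)
    have h3 : HasDerivAt (Function.update y k) (Pi.single k 1) (y k) := hasDerivAt_update y k (y k)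
    rw [show y = Function.update y k (y k) by simp] at h2
    have := h2.comp_hasDerivAt (y k) h3
    simp only [Function.update_eq_self] at this
    exact this
  -- The other free rows are added to the row of the pivot, which leaves the determinant unchanged.
  set M' : Matrix (Fin m) (Fin m) ℂ := if hJ : hSum ∈ J.1 then
    M.updateRow (pivot J hJ) (∑ i, (if i ∈ freeIdx J then (1 : ℂ) else 0) • M i) else M with hM'
  have hdet : M.det = M'.det := by
    rw [hM']
    split_ifs with hJ
    · have hp : pivot J hJ ∈ freeIdx J := (freeIdx J).min'_mem _
      rw [Matrix.det_updateRow_sum, if_pos hp, one_smul]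
    · rfl
  have hentry' : ∀ i k, HasDerivAt (fun t => reducedMap ε ε₀ J
      (fun l => zeta l (Function.update y k t l)) (Function.update y k t) i) (M' i k) (y k) := by
    intro i k
    by_cases hp : ∃ h : hSum ∈ J.1, i = pivot J h
    · obtain ⟨hJ, rfl⟩ := hp
      simp_rw [← sum_freeIdx_slotMap h hJ]
      have h1 : M' (pivot J hJ) k = ∑ i ∈ freeIdx J, M i k := by
        rw [hM', dif_pos hJ, Matrix.updateRow_self, Finset.sum_apply]
        simp [Finset.sum_ite_mem]
      rw [h1]
      exact HasDerivAt.fun_sum fun i _ => hentry i k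
    · have h1 : M' i k = M i k := by
        rw [hM']
        split_ifs with hJ
        · rw [Matrix.updateRow_ne fun h' => hp ⟨hJ, h'⟩]
        · rfl
      rw [h1]
      simp only [reducedMap, if_neg hp]
      exact hentry i k
  have hzeta : ∀ i k, HasDerivAt (fun t => zeta i (Function.update y k t i))
      (if i = k then zeta' i (y i) else 0) (y k) := by
    intro i k
    split_ifs with hik
    · subst hik
      simpa using hz i (y i)
    · simp only [Function.update_of_ne hik]
      exact hasDerivAt_const _ _
  have hdil : ∀ k ∉ angSlots J, ∀ t, slotDil ε ε₀ J (fun l => zeta l (Function.update y k t l)) =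
      slotDil ε ε₀ J (fun l => zeta l (y l)) := by
    intro k hk t
    refine slotDil_congr fun l hl => ?_
    rw [Function.update_of_ne]
    rintro rfl
    exact hk hl
  have hzero : ∀ i, hZero i ∈ J.1 → ∀ k, M' i k = if i = k then zeta' i (y i) else 0 := by
    intro i hi k
    refine (hentry' i k).unique ?_
    have hp : ¬∃ h : hSum ∈ J.1, i = pivot J h := by
      rintro ⟨h, rfl⟩
      exact pivot_zero h hi
    simpa only [reducedMap, if_neg hp, slotMap, if_pos hi] using hzeta i k
  have hone : ∀ i, hOne i ∈ J.1 → ∀ k, M' i k = if i = k then -zeta' i (y i) else 0 := by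
    intro i hi k
    refine (hentry' i k).unique ?_
    have hp : ¬∃ h : hSum ∈ J.1, i = pivot J h := by
      rintro ⟨h, rfl⟩
      exact pivot_one h hi
    simp only [reducedMap, if_neg hp, slotMap, if_neg (J.2.1 i hi).2, if_pos hi]
    convert! (hzeta i k).const_sub 1 using 1
    split_ifs <;> simp
  have hpivot : ∀ hJ : hSum ∈ J.1, ∀ k, M' (pivot J hJ) k =
      -(if pivot J hJ = k then zeta' (pivot J hJ) (y (pivot J hJ)) else 0) -
        ∑ i ∈ I.filter (fun i => hZero i ∈ J.1), if i = k then zeta' i (y i) else 0 := by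
    intro hJ k
    refine (hentry' _ k).unique ?_
    have e : ∀ z y, reducedMap ε ε₀ J z y (pivot J hJ) =
        1 - z (pivot J hJ) - ∑ i ∈ I.filter (fun i => hZero i ∈ J.1), z i :=
      fun z y => by rw [reducedMap, if_pos ⟨hJ, rfl⟩]
    simp_rw [e]
    exact ((hzeta _ k).const_sub 1).sub (HasDerivAt.fun_sum fun i _ => hzeta i k)
  have hfree : ∀ i ∉ angSlots J, i ∈ I → ∀ k ∉ angSlots J,
      M' i k = if i = k then slotDil ε ε₀ J (fun l => zeta l (y l)) else 0 := by
    intro i hi hiI k hk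
    refine (hentry' i k).unique ?_
    have hi' := hi
    rw [mem_angSlots] at hi'
    push Not at hi'
    have hp : ¬∃ h : hSum ∈ J.1, i = pivot J h := by
      rintro ⟨h, h'⟩
      exact hi'.2.2 h h'
    simp only [reducedMap, if_neg hp, slotMap, if_neg hi'.1, if_neg hi'.2.1, if_pos hiI,
      hdil k hk, facePoint_of_notMem_angSlots hi]
    split_ifs with hik
    · subst hik
      simp only [Function.update_self]
      have h1 : HasDerivAt (fun t : ℝ => ((t - ε i : ℝ) : ℂ)) 1 (y i) := by
        simpa using ((hasDerivAt_id (y i)).sub_const (ε i)).ofReal_comp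
      simpa using (h1.const_mul (slotDil ε ε₀ J fun l => zeta l (y l))).const_add (ε i : ℂ)
    · simp only [Function.update_of_ne hik]
      exact hasDerivAt_const _ _
  have hplain : ∀ i ∉ angSlots J, i ∉ I → ∀ k, M' i k = if i = k then 1 else 0 := by
    intro i hi hiI k
    refine (hentry' i k).unique ?_
    have hi' := hi
    rw [mem_angSlots] at hi'
    push Not at hi'
    have hp : ¬∃ h : hSum ∈ J.1, i = pivot J h := by
      rintro ⟨h, h'⟩
      exact hi'.2.2 h h'
    simp only [reducedMap, if_neg hp, slotMap, if_neg hi'.1, if_neg hi'.2.1, if_neg hiI]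
    split_ifs with hik
    · subst hik
      simp only [Function.update_self]
      exact (hasDerivAt_id (y i)).ofReal_comp
    · simp only [Function.update_of_ne hik]
      exact hasDerivAt_const _ _
  -- Degrees: `0` for slots of the walls `s_k` and `1 - s_k`, `1` for the pivot, `2` for the rest.
  -- The pivot row involves only itself and slots of degree `0`; free rows involve themselves and,
  -- through the dilation, angular slots.
  have htri : M'.det = ∏ i, M' i i := by
    refine det_of_graded M' (fun k => if hZero k ∈ J.1 ∨ hOne k ∈ J.1 then 0 else
      if k ∈ angSlots J then 1 else 2) fun i k hik => ?_
    by_contra! hcon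
    obtain ⟨hne, hle⟩ := hcon
    refine hik ?_
    by_cases h1 : hZero i ∈ J.1
    · rw [hzero i h1, if_neg hne]
    by_cases h2 : hOne i ∈ J.1
    · rw [hone i h2, if_neg hne]
    by_cases h3 : ∃ h : hSum ∈ J.1, i = pivot J h
    · obtain ⟨hJ, rfl⟩ := h3
      rw [hpivot hJ, if_neg hne, neg_zero, zero_sub, neg_eq_zero]
      refine Finset.sum_eq_zero fun l hl => if_neg ?_
      rintro rfl
      have := (Finset.mem_filter.1 hl).2
      rw [if_neg (not_or.2 ⟨h1, h2⟩), if_pos (Or.inl this),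
        if_pos (mem_angSlots.2 (Or.inr (Or.inr ⟨hJ, rfl⟩)))] at hle
      omega
    · have hi : i ∉ angSlots J := by
        rw [mem_angSlots]
        tauto
      by_cases hiI : i ∈ I
      · rw [hfree i hi hiI k ?_, if_neg hne]
        intro hk
        rw [if_neg (not_or.2 ⟨h1, h2⟩), if_neg hi, if_pos hk] at hle
        split_ifs at hle <;> omega
      · rw [hplain i hi hiI, if_neg hne]
  -- The diagonal entries at `1 - z_k` and at the pivot carry a minus sign, which `orient`
  -- compensates.
  have hang : ∀ k ∈ angSlots J, orient (hypAt J k) * M' k k = zeta' k (y k) := by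
    intro k hk
    rcases mem_angSlots.1 hk with h1 | h1 | ⟨h1, rfl⟩
    · rw [hypAt_of_zero h1, hzero k h1, if_pos rfl]
      simp [orient]
    · rw [hypAt_of_one h1, hone k h1, if_pos rfl]
      simp [orient]
    · rw [hypAt_pivot h1, hpivot h1, if_pos rfl, Finset.sum_eq_zero]
      · simp [orient]
      · intro i hi
        refine if_neg ?_
        rintro rfl
        exact pivot_zero h1 (Finset.mem_filter.1 hi).2
  have hrest : ∏ k ∈ (angSlots J)ᶜ, M' k k =
      slotDil ε ε₀ J (fun k => zeta k (y k)) ^ (I \ angSlots J).card := by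
    have h1 : ∀ k ∈ (angSlots J)ᶜ, M' k k =
        if k ∈ I then slotDil ε ε₀ J (fun k => zeta k (y k)) else 1 := by
      intro k hk
      rw [Finset.mem_compl] at hk
      split_ifs with hkI
      · rw [hfree k hk hkI k hk, if_pos rfl]
      · rw [hplain k hk hkI, if_pos rfl]
    rw [Finset.prod_congr rfl h1, ← Finset.prod_filter, Finset.prod_const]
    congr 2
    ext k
    simp [and_comm]
  rw [hdet, htri, prod_stratum, ← Finset.prod_mul_prod_compl (angSlots J), hrest, ← mul_assoc,
    ← Finset.prod_mul_distrib, Finset.prod_congr rfl hang]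

end jacobian

/-! ### Monomial integrals over the cells -/

section monomial

variable {m : ℕ} {I : Finset (Fin m)} {ε : Fin m → ℝ} {ε₀ : ℝ} {x : Fin m → ℝ}

/-- The branch of the logarithm of `hypVal I _ L` on a cell. -/
noncomputable def hypLog (ε : Fin m → ℝ) (ε₀ : ℝ) (J : Stratum I) (y : Fin m → ℝ) : Hyp m → ℂ
  | Sum.inl k => logCoord ε ε₀ J y k
  | Sum.inr (Sum.inl k) =>
      if hOne k ∈ J.1 then (Real.log (ε k) : ℂ) + (y k : ℂ) * Complex.I
      else Complex.log (1 - cellMap ε ε₀ J y k)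
  | Sum.inr (Sum.inr _) => logRest ε ε₀ J y

theorem hypLog_hypAt {J : Stratum I} {k : Fin m} (hk : k ∈ angSlots J) (y : Fin m → ℝ) :
    hypLog ε ε₀ J y (hypAt J k) = Real.log (slotRad ε ε₀ J k) + y k * Complex.I := by
  rcases mem_angSlots.1 hk with h1 | h1 | ⟨h1, rfl⟩
  · rw [slotRad, hypAt_of_zero h1]
    simp only [hypLog, logCoord, if_pos h1, hypRad]
  · rw [slotRad, hypAt_of_one h1]
    simp only [hypLog, if_pos h1, hypRad]
  · rw [slotRad, hypAt_pivot h1]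
    simp only [hypLog, logRest, dif_pos h1, hypRad]

theorem hypLog_of_notMem {J : Stratum I} {L : Hyp m} (hL : L ∉ J.1) (y : Fin m → ℝ) :
    hypLog ε ε₀ J y L = Complex.log (hypVal I (cellMap ε ε₀ J y) L) := by
  rcases L with k | k | u
  · simp only [hypLog, hypVal, logCoord, if_neg hL]
  · simp only [hypLog, hypVal, if_neg hL]
  · simp only [hypLog, hypVal, logRest, dif_neg hL, simplexRest]

/-- The points whose face coordinates lie in the polytope. -/
def faceSet (ε : Fin m → ℝ) (ε₀ : ℝ) (J : Stratum I) : Set (Fin m → ℝ) :=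
  {y | facePoint ε ε₀ J y ∈ polytope I ε ε₀}

theorem cellDom_eq_slotDom (J : Stratum I) :
    cellDom ε ε₀ J = slotDom (slotRad ε ε₀ J) (angSlots J) (angSlots J) (faceSet ε ε₀ J) := by
  ext y
  refine and_congr_right fun _ => ⟨fun h k hk => ?_, fun h => ⟨fun k hk => ?_, fun hJ => ?_⟩⟩
  · rw [if_pos hk]
    rcases mem_angSlots.1 hk with h1 | h1 | ⟨h1, rfl⟩
    · exact h.1 k (Or.inl h1)
    · exact h.1 k (Or.inr h1)
    · exact h.2 h1
  · have hk' : k ∈ angSlots J := mem_angSlots.2 (by tauto)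
    simpa only [if_pos hk'] using h k hk'
  · have hk' : pivot J hJ ∈ angSlots J := mem_angSlots.2 (Or.inr (Or.inr ⟨hJ, rfl⟩))
    simpa only [if_pos hk'] using h _ hk'

theorem mem_Icc_of_mem_polytope (h : Admissible ε ε₀ x) {s : Fin m → ℝ}
    (hs : s ∈ polytope I ε ε₀) (k : Fin m) : s k ∈ Set.Icc (0 : ℝ) 1 := by
  have h1 := h.eps_pos k
  by_cases hk : k ∈ I
  · have h2 := hs.1 k hk
    have h3 := hs.2.1
    have h4 : s k ≤ ∑ i ∈ I, s i :=
      Finset.single_le_sum (fun i hi => (h.eps_pos i).le.trans (hs.1 i hi)) hk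
    have := h.eps₀_pos
    constructor <;> linarith
  · have h2 := hs.2.2 k hk
    constructor <;> linarith [h2.1, h2.2]

theorem isClosed_polytope : IsClosed (polytope I ε ε₀) := by
  have h : polytope I ε ε₀ = (⋂ i ∈ I, {s | ε i ≤ s i}) ∩ ({s | ε₀ ≤ 1 - ∑ i ∈ I, s i} ∩
      ⋂ j, ⋂ (_ : j ∉ I), ({s | ε j ≤ s j} ∩ {s | ε j ≤ 1 - s j})) := by
    ext s
    simp only [polytope, Set.mem_inter_iff, Set.mem_iInter, Set.mem_ofPred_eq]
  rw [h]
  refine (isClosed_biInter fun i _ => isClosed_le continuous_const (continuous_apply i)).inter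
    ((isClosed_le continuous_const (by fun_prop)).inter
      (isClosed_iInter fun j => isClosed_iInter fun _ => ?_))
  exact (isClosed_le continuous_const (by fun_prop)).inter
    (isClosed_le continuous_const (by fun_prop))

theorem isCompact_slotDom (h : Admissible ε ε₀ x) (J : Stratum I) (T : Finset (Fin m)) :
    IsCompact (slotDom (slotRad ε ε₀ J) (angSlots J) T (faceSet ε ε₀ J)) := by
  refine Metric.isCompact_of_isClosed_isBounded ?_ ?_
  · have h1 : slotDom (slotRad ε ε₀ J) (angSlots J) T (faceSet ε ε₀ J) =
        (facePoint ε ε₀ J ⁻¹' polytope I ε ε₀) ∩ ⋂ k ∈ angSlots J,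
          {y | y k ∈ Set.Icc 0 (if k ∈ T then 2 * Real.pi else slotRad ε ε₀ J k)} := by
      ext y
      simp only [slotDom, faceSet, Set.mem_inter_iff, Set.mem_iInter, Set.mem_ofPred_eq,
        Set.mem_preimage]
    rw [h1]
    refine (isClosed_polytope.preimage (continuous_pi fun k =>
      (contDiff_facePoint J k).continuous)).inter (isClosed_biInter fun k _ => ?_)
    exact isClosed_Icc.preimage (continuous_apply k)
  · refine (Metric.isBounded_Icc (0 : Fin m → ℝ) fun _ => 1 + 2 * Real.pi).subset fun y hy => ?_
    have hpi := Real.pi_pos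
    have key : ∀ k, y k ∈ Set.Icc 0 (1 + 2 * Real.pi) := by
      intro k
      by_cases hk : k ∈ angSlots J
      · refine ⟨(hy.2 k hk).1, (hy.2 k hk).2.trans ?_⟩
        have := hypRad_le_one h (hypAt J k)
        split_ifs
        · linarith
        · rw [slotRad]
          linarith
      · have := mem_Icc_of_mem_polytope h hy.1 k
        rw [facePoint_of_notMem_angSlots hk] at this
        exact ⟨this.1, by linarith [this.2]⟩
    exact ⟨fun k => (key k).1, fun k => (key k).2⟩

/-- The integral of a product of powers of the functions `hypVal I _ L` over a cell. -/
noncomputable def monInt (h : Admissible ε ε₀ x) (J : Stratum I) (lam : Hyp m → ℂ) : ℂ :=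
  ∫ y in cellDom ε ε₀ J, Complex.exp (∑ L ∈ activeHyp I, (lam L - 1) * hypLog ε ε₀ J y L) *
    (tubeCell h J).jacobian y

/-- The part of the integrand of `monInt` that is holomorphic in the values in the slots. -/
noncomputable def slotWeight (ε : Fin m → ℝ) (ε₀ : ℝ) (J : Stratum I) (lam : Hyp m → ℂ)
    (z : Fin m → ℂ) (y : Fin m → ℝ) : ℂ :=
  slotDil ε ε₀ J z ^ (I \ angSlots J).card *
    ∏ L ∈ activeHyp I \ J.1,
      Complex.exp ((lam L - 1) * Complex.log (hypVal I (slotMap ε ε₀ J z y) L))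

theorem hasDerivAt_circ (ρ t : ℝ) : HasDerivAt (circ ρ) (circ ρ t * Complex.I) t := by
  unfold circ
  have h1 : HasDerivAt (fun t : ℝ => (t : ℂ) * Complex.I) Complex.I t := by
    simpa using (Complex.ofRealCLM.hasDerivAt (x := t)).mul_const Complex.I
  simpa [mul_assoc] using h1.cexp.const_mul (ρ : ℂ)

/-- The general determinant for circles in the angular slots: up to orientation it is the product of
the `dz_k / dθ_k` and of a power of the dilation, which is holomorphic in the slot variables and
goes into `slotWeight`. -/
theorem orient_mul_jacobian (h : Admissible ε ε₀ x) (J : Stratum I) (y : Fin m → ℝ) :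
    (∏ L ∈ J.1, orient L) * (tubeCell h J).jacobian y =
      (∏ k ∈ angSlots J, circ (slotRad ε ε₀ J k) (y k) * Complex.I) *
      slotDil ε ε₀ J (circleSlots (slotRad ε ε₀ J) (angSlots J) y) ^ (I \ angSlots J).card := by
  have h1 := det_slotMap h J (zeta := fun k t =>
      if k ∈ angSlots J then circ (slotRad ε ε₀ J k) t else (t : ℂ))
    (zeta' := fun k t => if k ∈ angSlots J then circ (slotRad ε ε₀ J k) t * Complex.I else 1)
    (fun k t => by
      split_ifs
      · exact hasDerivAt_circ _ _
      · exact Complex.ofRealCLM.hasDerivAt) y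
  have h2 : ∀ y : Fin m → ℝ, (fun k => if k ∈ angSlots J then circ (slotRad ε ε₀ J k) (y k)
      else (y k : ℂ)) = circleSlots (slotRad ε ε₀ J) (angSlots J) y := fun _ => rfl
  simp only [h2, slotMap_circleSlots] at h1
  refine h1.trans ?_
  congr 1
  exact Finset.prod_congr rfl fun k hk => if_pos hk

theorem hypVal_continuous {X : Type*} [TopologicalSpace X] {f : X → Fin m → ℂ}
    (hf : ∀ k, Continuous fun t => f t k) (L : Hyp m) :
    Continuous fun t => hypVal I (f t) L := by
  rcases L with k | k | u
  · exact hf k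
  · exact continuous_const.sub (hf k)
  · exact continuous_const.sub (continuous_finsetSum _ fun i _ => hf i)

theorem hypVal_differentiable {f : ℂ → Fin m → ℂ}
    (hf : ∀ k, Differentiable ℂ fun t => f t k) (L : Hyp m) :
    Differentiable ℂ fun t => hypVal I (f t) L := by
  rcases L with k | k | u
  · exact hf k
  · exact (hf k).const_sub 1
  · have : Differentiable ℂ fun t => ∑ i ∈ I, f t i := Differentiable.fun_sum fun i _ => hf i
    exact this.const_sub 1

/-- Contraction of all the circles of a cell to their radii. -/
theorem orient_mul_monInt (h : Admissible ε ε₀ x) (J : Stratum I) {lam : Hyp m → ℂ}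
    (hlam : ∀ L, 1 < (lam L).re) :
    (∏ L ∈ J.1, orient L) * monInt h J lam = (∏ L ∈ J.1, monod (lam L)) *
      ∫ y in slotDom (slotRad ε ε₀ J) (angSlots J) ∅ (faceSet ε ε₀ J),
        (∏ k ∈ angSlots J, (y k : ℂ) ^ (lam (hypAt J k) - 1)) *
          slotWeight ε ε₀ J lam (fun k => (y k : ℂ)) y := by
  have hrad : ∀ k, 0 < slotRad ε ε₀ J k := fun k => hypRad_pos h _
  have hre : ∀ {z : Fin m → ℂ}, (∀ k ∈ angSlots J, ‖z k‖ ≤ slotRad ε ε₀ J k) →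
      ∀ {y}, y ∈ faceSet ε ε₀ J → ∀ L ∈ activeHyp I \ J.1,
        0 < (hypVal I (slotMap ε ε₀ J z y) L).re := fun hz y hy L hL =>
    (hypRad_pos h L).trans_le (hypRad_le_hypVal_re h
      (fun k hk => (Complex.re_le_norm _).trans (hz k hk)) hy hL)
  have key := setIntegral_circleSlots (ρ := slotRad ε ε₀ J) (lam := fun k => lam (hypAt J k))
    (A := angSlots J) (B := faceSet ε ε₀ J) (H := slotWeight ε ε₀ J lam)
    (fun k _ => hrad k) (fun k _ => hlam _)
    (fun k hk y t => by
      unfold faceSet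
      rw [Set.mem_ofPred_eq, facePoint_update hk]
      rfl)
    (fun k hk z y t => by
      unfold slotWeight
      rw [slotMap_update_right hk])
    (isCompact_slotDom h J)
    (by
      unfold slotWeight
      refine ContinuousOn.mul ?_ (continuousOn_finsetProd _ fun L hL => ?_)
      · exact (((differentiable_slotDil J).continuous.comp continuous_fst).pow _).continuousOn
      · refine (continuousOn_const.mul (continuousOn_clog ?_ fun p hp => ?_)).cexp
        · exact (hypVal_continuous (fun k => continuous_slotMap J k) L).continuousOn
        · exact hre hp.2 hp.1 L hL)
    (fun y hy z hz k hk => by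
      have hupd : ∀ i, Differentiable ℂ fun w => slotMap ε ε₀ J (Function.update z k w) y i := by
        intro i
        refine (differentiable_slotMap J y i).comp ?_
        exact fun w => (hasDerivAt_update z k w).differentiableAt
      -- The neighbourhood of the closed disc is the set where the free forms have positive real
      -- part: open because they depend continuously on `w`, large enough by `hypRad_le_hypVal_re`.
      refine ⟨⋂ L ∈ activeHyp I \ J.1,
        {w | 0 < (hypVal I (slotMap ε ε₀ J (Function.update z k w) y) L).re}, ?_, ?_, ?_⟩
      · refine isOpen_biInter_finset fun L _ => isOpen_lt continuous_const
          (Complex.continuous_re.comp (hypVal_differentiable hupd L).continuous)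
      · intro w hw
        rw [Metric.mem_closedBall, dist_zero_right] at hw
        simp only [Set.mem_iInter, Set.mem_ofPred_eq]
        refine hre (fun i hi => ?_) hy
        rcases eq_or_ne i k with rfl | hik
        · simpa using hw
        · rw [Function.update_of_ne hik]
          exact hz i hi
      · unfold slotWeight
        refine DifferentiableOn.mul ?_ (DifferentiableOn.fun_finsetProd fun L hL => ?_)
        · refine (DifferentiableOn.pow (Differentiable.differentiableOn ?_) _)
          exact (differentiable_slotDil J).comp
            fun w => (hasDerivAt_update z k w).differentiableAt
        · refine (DifferentiableOn.const_mul (DifferentiableOn.clog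
            (hypVal_differentiable hupd L).differentiableOn fun w hw => Or.inl ?_) _).cexp
          exact Set.mem_iInter₂.1 hw L hL)
  rw [monInt, ← integral_const_mul, cellDom_eq_slotDom, prod_stratum J fun L => monod (lam L)]
  convert! key using 1
  · refine setIntegral_congr_fun (isCompact_slotDom h J _).measurableSet fun y hy => ?_
    rw [mul_left_comm, orient_mul_jacobian, slotWeight, sum_activeHyp_stratum J, Complex.exp_add,
      Complex.exp_sum, Complex.exp_sum, slotMap_circleSlots]
    have h1 : ∏ k ∈ angSlots J, slotFactor (slotRad ε ε₀ J) (fun k => lam (hypAt J k))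
        (angSlots J) k (y k) = (∏ k ∈ angSlots J, Complex.exp ((lam (hypAt J k) - 1) *
          hypLog ε ε₀ J y (hypAt J k))) *
          ∏ k ∈ angSlots J, circ (slotRad ε ε₀ J k) (y k) * Complex.I := by
      rw [← Finset.prod_mul_distrib]
      refine Finset.prod_congr rfl fun k hk => ?_
      rw [slotFactor, if_pos hk, hypLog_hypAt hk]
    have h2 : ∏ L ∈ activeHyp I \ J.1, Complex.exp ((lam L - 1) * hypLog ε ε₀ J y L) =
        ∏ L ∈ activeHyp I \ J.1, Complex.exp ((lam L - 1) *
          Complex.log (hypVal I (cellMap ε ε₀ J y) L)) :=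
      Finset.prod_congr rfl fun L hL => by rw [hypLog_of_notMem (Finset.mem_sdiff.1 hL).2]
    rw [h1, h2]
    ring
end monomial

/-! ### The contracted cells subdivide the polytope with walls through the coordinate planes -/

section subdivision

variable {m : ℕ} {I : Finset (Fin m)} {ε : Fin m → ℝ} {ε₀ : ℝ} {x : Fin m → ℝ}

/-- The dilation factor of a contracted cell. -/
noncomputable def realDil (ε : Fin m → ℝ) (ε₀ : ℝ) (J : Stratum I) (y : Fin m → ℝ) : ℝ :=
  1 + (∑ i ∈ I.filter (fun i => hZero i ∈ J.1), (ε i - y i)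
      + if h : hSum ∈ J.1 then ε₀ - y (pivot J h) else 0) / (1 - ∑ i ∈ I, ε i - ε₀)

/-- The contracted cell. -/
noncomputable def realMap (ε : Fin m → ℝ) (ε₀ : ℝ) (J : Stratum I) (y : Fin m → ℝ)
    (k : Fin m) : ℝ :=
  if hZero k ∈ J.1 then y k
  else if hOne k ∈ J.1 then 1 - y k
  else if k ∈ I then ε k + realDil ε ε₀ J y * (facePoint ε ε₀ J y k - ε k)
  else y k

theorem slotDil_ofReal (J : Stratum I) (y : Fin m → ℝ) :
    slotDil ε ε₀ J (fun k => (y k : ℂ)) = (realDil ε ε₀ J y : ℂ) := by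
  unfold slotDil realDil
  split_ifs <;> push_cast <;> rfl

theorem slotMap_ofReal (J : Stratum I) (y : Fin m → ℝ) :
    slotMap ε ε₀ J (fun k => (y k : ℂ)) y = fun k => (realMap ε ε₀ J y k : ℂ) := by
  funext k
  unfold slotMap realMap
  rw [slotDil_ofReal]
  split_ifs <;> push_cast <;> rfl

theorem hypVal_ofReal (s : Fin m → ℝ) (L : Hyp m) :
    hypVal I (fun k => (s k : ℂ)) L = ((hypVal I s L : ℝ) : ℂ) := by
  rcases L with k | k | u <;> simp [hypVal]

theorem hypVal_realMap_hypAt (h : Admissible ε ε₀ x) {J : Stratum I} {k : Fin m}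
    (hk : k ∈ angSlots J) (y : Fin m → ℝ) :
    hypVal I (realMap ε ε₀ J y) (hypAt J k) = y k := by
  have := hypVal_hypAt h hk (fun k => (y k : ℂ)) y
  rw [slotMap_ofReal, hypVal_ofReal] at this
  exact_mod_cast this

theorem one_le_realDil (h : Admissible ε ε₀ x) (J : Stratum I) {y : Fin m → ℝ}
    (hy : ∀ k ∈ angSlots J, y k ≤ slotRad ε ε₀ J k) : 1 ≤ realDil ε ε₀ J y := by
  have := one_le_slotDil_re h J (z := fun k => (y k : ℂ)) (fun k hk => by simpa using hy k hk)
  rwa [slotDil_ofReal, Complex.ofReal_re] at this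

theorem hypRad_le_hypVal_realMap (h : Admissible ε ε₀ x) {J : Stratum I} {y : Fin m → ℝ}
    (hy : ∀ k ∈ angSlots J, y k ≤ slotRad ε ε₀ J k) (hy' : y ∈ faceSet ε ε₀ J)
    {L : Hyp m} (hL : L ∈ activeHyp I \ J.1) :
    hypRad ε ε₀ L ≤ hypVal I (realMap ε ε₀ J y) L := by
  have := hypRad_le_hypVal_re h (z := fun k => (y k : ℂ)) (fun k hk => by simpa using hy k hk)
    hy' hL
  rwa [slotMap_ofReal, hypVal_ofReal, Complex.ofReal_re] at this

theorem sum_realMap (h : Admissible ε ε₀ x) (J : Stratum I) (y : Fin m → ℝ) :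
    1 - ∑ i ∈ I, realMap ε ε₀ J y i =
      ε₀ - (if h : hSum ∈ J.1 then ε₀ - y (pivot J h) else 0) +
      realDil ε ε₀ J y * (1 - ∑ i ∈ I, facePoint ε ε₀ J y i - ε₀) := by
  have := sum_slotMap h J (fun k => (y k : ℂ)) y
  simp only [slotMap_ofReal, slotDil_ofReal] at this
  split_ifs at this ⊢ <;> exact_mod_cast this

theorem realDil_congr {J : Stratum I} {y w : Fin m → ℝ} (hyw : ∀ k ∈ angSlots J, y k = w k) :
    realDil ε ε₀ J y = realDil ε ε₀ J w := by
  have := slotDil_congr (ε := ε) (ε₀ := ε₀) (J := J) (z := fun k => (y k : ℂ))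
    (w := fun k => (w k : ℂ)) (fun k hk => by rw [hyw k hk])
  rw [slotDil_ofReal, slotDil_ofReal] at this
  exact_mod_cast this

/-- The piece of the big polytope that corresponds to `J`. -/
def region (ε : Fin m → ℝ) (ε₀ : ℝ) (J : Stratum I) : Set (Fin m → ℝ) :=
  {s | (∀ L ∈ activeHyp I, 0 ≤ hypVal I s L) ∧ (∀ L ∈ J.1, hypVal I s L ≤ hypRad ε ε₀ L) ∧
    ∀ L ∈ activeHyp I \ J.1, hypRad ε ε₀ L ≤ hypVal I s L}

/-- The inverse of a contracted cell. -/
noncomputable def backMap (ε : Fin m → ℝ) (ε₀ : ℝ) (J : Stratum I) (s : Fin m → ℝ)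
    (k : Fin m) : ℝ :=
  if k ∈ angSlots J then hypVal I s (hypAt J k)
  else if k ∈ I then ε k + (s k - ε k) / realDil ε ε₀ J (fun k => hypVal I s (hypAt J k))
  else s k

theorem mapsTo_realMap (h : Admissible ε ε₀ x) (J : Stratum I) :
    Set.MapsTo (realMap ε ε₀ J) (slotDom (slotRad ε ε₀ J) (angSlots J) ∅ (faceSet ε ε₀ J))
      (region ε ε₀ J) := by
  intro y hy
  have h1 : ∀ k ∈ angSlots J, y k ∈ Set.Icc 0 (slotRad ε ε₀ J k) := fun k hk => by
    simpa using hy.2 k hk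
  have h2 : ∀ L ∈ activeHyp I \ J.1, hypRad ε ε₀ L ≤ hypVal I (realMap ε ε₀ J y) L :=
    fun L hL => hypRad_le_hypVal_realMap h (fun k hk => (h1 k hk).2) hy.1 hL
  have h3 : ∀ L ∈ J.1, hypVal I (realMap ε ε₀ J y) L ∈ Set.Icc 0 (hypRad ε ε₀ L) := by
    intro L hL
    obtain ⟨k, hk, rfl⟩ := exists_hypAt hL
    rw [hypVal_realMap_hypAt h hk]
    exact h1 k hk
  refine ⟨fun L hL => ?_, fun L hL => (h3 L hL).2, h2⟩
  by_cases hLJ : L ∈ J.1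
  · exact (h3 L hLJ).1
  · exact (hypRad_pos h L).le.trans (h2 L (Finset.mem_sdiff.2 ⟨hL, hLJ⟩))

/-- The slot variables are read off as values of the forms in `J`. They determine the dilation,
which is then divided out of the free coordinates. -/
theorem backMap_realMap (h : Admissible ε ε₀ x) (J : Stratum I) :
    Set.LeftInvOn (backMap ε ε₀ J) (realMap ε ε₀ J)
      (slotDom (slotRad ε ε₀ J) (angSlots J) ∅ (faceSet ε ε₀ J)) := by
  intro y hy
  have h1 : ∀ k ∈ angSlots J, y k ≤ slotRad ε ε₀ J k := fun k hk => by
    simpa using (hy.2 k hk).2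
  have hD := one_le_realDil h J h1
  funext k
  unfold backMap
  rw [realDil_congr (w := y) fun k hk => hypVal_realMap_hypAt h hk y]
  split_ifs with hk hkI
  · exact hypVal_realMap_hypAt h hk y
  · have hk' := hk
    rw [mem_angSlots] at hk'
    push Not at hk'
    rw [realMap, if_neg hk'.1, if_neg hk'.2.1, if_pos hkI, facePoint_of_notMem_angSlots hk]
    field_simp
    ring
  · rw [mem_angSlots] at hk
    push Not at hk
    rw [realMap, if_neg hk.1, if_neg hk.2.1, if_neg hkI]

theorem slot_le_of_mem_region {J : Stratum I} {s : Fin m → ℝ}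
    (hs : s ∈ region ε ε₀ J) : ∀ k ∈ angSlots J, backMap ε ε₀ J s k ≤ slotRad ε ε₀ J k := by
  intro k hk
  rw [backMap, if_pos hk]
  exact hs.2.1 _ (hypAt_mem hk)

theorem realMap_backMap (h : Admissible ε ε₀ x) (J : Stratum I) :
    Set.RightInvOn (backMap ε ε₀ J) (realMap ε ε₀ J) (region ε ε₀ J) := by
  intro s hs
  have hD := one_le_realDil h J (slot_le_of_mem_region hs)
  have hcong : realDil ε ε₀ J (fun k => hypVal I s (hypAt J k)) =
      realDil ε ε₀ J (backMap ε ε₀ J s) :=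
    realDil_congr fun k hk => by rw [backMap, if_pos hk]
  have hne : ∀ k, (¬∃ h : hSum ∈ J.1, k = pivot J h) →
      realMap ε ε₀ J (backMap ε ε₀ J s) k = s k := by
    intro k hp
    unfold realMap
    split_ifs with h1 h2 h3
    · rw [backMap, if_pos (mem_angSlots.2 (Or.inl h1)), hypAt_of_zero h1]
      rfl
    · rw [backMap, if_pos (mem_angSlots.2 (Or.inr (Or.inl h2))), hypAt_of_one h2]
      simp [hypVal]
    · have hk : k ∉ angSlots J := by
        rw [mem_angSlots]
        tauto
      rw [facePoint_of_notMem_angSlots hk, ← hcong]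
      rw [← hcong] at hD
      simp only [backMap, if_neg hk, if_pos h3]
      field_simp
      ring
    · have hk : k ∉ angSlots J := by
        rw [mem_angSlots]
        tauto
      rw [backMap, if_neg hk, if_neg h3]
  -- The pivot is not read off from its own slot: all other coordinates and the value of `1 - ∑ s_i`
  -- agree already, and these determine it.
  funext k
  by_cases hp : ∃ h : hSum ∈ J.1, k = pivot J h
  · obtain ⟨hJ, rfl⟩ := hp
    have hmem : pivot J hJ ∈ angSlots J := mem_angSlots.2 (Or.inr (Or.inr ⟨hJ, rfl⟩))
    have h1 := hypVal_realMap_hypAt h hmem (backMap ε ε₀ J s)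
    rw [backMap, if_pos hmem, hypAt_pivot hJ] at h1
    simp only [hypVal, sub_right_inj] at h1
    rw [← Finset.add_sum_erase I _ (pivot_mem hJ), ← Finset.add_sum_erase I s (pivot_mem hJ),
      Finset.sum_congr rfl fun i hi => hne i (by
        rintro ⟨h', rfl⟩
        exact (Finset.mem_erase.1 hi).1 rfl)] at h1
    exact add_right_cancel h1
  · exact hne k hp

theorem mapsTo_backMap (h : Admissible ε ε₀ x) (J : Stratum I) :
    Set.MapsTo (backMap ε ε₀ J) (region ε ε₀ J)
      (slotDom (slotRad ε ε₀ J) (angSlots J) ∅ (faceSet ε ε₀ J)) := by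
  intro s hs
  have hinv := realMap_backMap h J hs
  set y := backMap ε ε₀ J s with hy
  have hD := one_le_realDil h J (slot_le_of_mem_region hs)
  rw [← hy] at hD
  have hmem : ∀ L ∈ activeHyp I, L ∉ J.1 → hypRad ε ε₀ L ≤ hypVal I s L := fun L h1 h2 =>
    hs.2.2 L (Finset.mem_sdiff.2 ⟨h1, h2⟩)
  refine ⟨⟨fun i hi => ?_, ?_, fun j hj => ?_⟩, fun k hk => ?_⟩
  · by_cases hz : hZero i ∈ J.1
    · rw [facePoint_of_zero hz]
    · have h1 : ε i ≤ s i := hmem (hZero i) (mem_activeHyp.2 fun _ _ => by simp) hz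
      have h2 := congr_fun hinv i
      rw [realMap, if_neg hz, if_neg fun h' => (J.2.1 i h').1 hi, if_pos hi] at h2
      -- The dilation is positive, so a face coordinate below `ε i` would put `s i` below `ε i`.
      by_contra! hlt
      nlinarith
  · by_cases hS : hSum ∈ J.1
    · rw [sum_facePoint hS]
      linarith
    · have h1 : ε₀ ≤ 1 - ∑ i ∈ I, s i := hmem hSum (mem_activeHyp.2 fun _ _ => by simp) hS
      have h2 := sum_realMap h J y
      rw [hinv, dif_neg hS] at h2
      by_contra! hlt
      nlinarith
  · rw [facePoint_of_notMem hj, faceCoord]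
    have h1 := h.eps_lt j
    split_ifs with h2 h3
    · exact ⟨le_rfl, by linarith⟩
    · exact ⟨by linarith, by linarith⟩
    · have hk : j ∉ angSlots J := by
        rw [mem_angSlots]
        rintro (h' | h' | ⟨h', rfl⟩)
        · exact h2 h'
        · exact h3 h'
        · exact hj (pivot_mem h')
      rw [hy, backMap, if_neg hk, if_neg hj]
      refine ⟨hmem (hZero j) (mem_activeHyp.2 fun _ _ => by simp) h2,
        hmem (hOne j) (mem_activeHyp.2 fun k hk' h' => ?_) h3⟩
      cases h'
      exact hj hk'
  · rw [hy, backMap, if_pos hk, if_neg (Finset.notMem_empty _)]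
    have := hypAt_mem hk
    exact ⟨hs.1 _ (stratum_subset J this), hs.2.1 _ this⟩

theorem image_realMap (h : Admissible ε ε₀ x) (J : Stratum I) :
    realMap ε ε₀ J '' slotDom (slotRad ε ε₀ J) (angSlots J) ∅ (faceSet ε ε₀ J) =
      region ε ε₀ J :=
  (mapsTo_realMap h J).image_subset.antisymm fun _ hs =>
    ⟨_, mapsTo_backMap h J hs, realMap_backMap h J hs⟩

theorem differentiable_realMap (J : Stratum I) (k : Fin m) :
    Differentiable ℝ fun y => realMap ε ε₀ J y k := by
  have h1 : Differentiable ℝ (realDil ε ε₀ J) := by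
    unfold realDil
    split_ifs <;> fun_prop
  have h2 : Differentiable ℝ fun y => facePoint ε ε₀ J y k :=
    (contDiff_facePoint J k).differentiable (by simp)
  unfold realMap
  split_ifs
  · fun_prop
  · fun_prop
  · exact (h1.mul (h2.sub_const _)).const_add _
  · fun_prop

/-- `det_slotMap` for the identity curves; the orientation signs disappear in the absolute value.
The Jacobian is exactly the power of the dilation that occurs in `slotWeight`. -/
theorem abs_det_realMap (h : Admissible ε ε₀ x) (J : Stratum I) {y : Fin m → ℝ}
    (hy : ∀ k ∈ angSlots J, y k ≤ slotRad ε ε₀ J k) :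
    |(fderiv ℝ (realMap ε ε₀ J) y).det| = realDil ε ε₀ J y ^ (I \ angSlots J).card := by
  have hdiff : DifferentiableAt ℝ (realMap ε ε₀ J) y :=
    differentiableAt_pi.2 fun k => differentiable_realMap J k y
  have h1 := det_slotMap h J (zeta := fun _ t => (t : ℂ)) (zeta' := fun _ _ => 1)
    (fun k t => Complex.ofRealCLM.hasDerivAt) y
  simp only [slotMap_ofReal, slotDil_ofReal, Finset.prod_const_one, one_mul] at h1
  have h2 : HasFDerivAt (fun y k => (realMap ε ε₀ J y k : ℂ))
      (ContinuousLinearMap.pi fun k => Complex.ofRealCLM.comp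
        ((ContinuousLinearMap.proj k).comp (fderiv ℝ (realMap ε ε₀ J) y))) y := by
    refine hasFDerivAt_pi.2 fun k => ?_
    exact Complex.ofRealCLM.hasFDerivAt.comp y (hasFDerivAt_pi'.1 hdiff.hasFDerivAt k)
  rw [h2.fderiv] at h1
  have h3 : (Matrix.of fun i k : Fin m => (ContinuousLinearMap.pi fun k =>
      Complex.ofRealCLM.comp ((ContinuousLinearMap.proj k).comp
        (fderiv ℝ (realMap ε ε₀ J) y))) (Pi.single k 1) i).det =
      (((fderiv ℝ (realMap ε ε₀ J) y).det : ℝ) : ℂ) := by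
    rw [ContinuousLinearMap.det, ← LinearMap.det_toMatrix', ← Complex.ofRealHom_eq_coe,
      RingHom.map_det]
    congr 1
  have h4 : ‖∏ L ∈ J.1, orient L‖ = 1 := by
    rw [norm_prod]
    refine Finset.prod_eq_one fun L _ => ?_
    rcases L with k | k <;> simp [orient]
  have h5 := congr_arg norm h1
  rw [h3, norm_mul, h4, one_mul, Complex.norm_real, norm_pow, Complex.norm_real,
    Real.norm_eq_abs, Real.norm_of_nonneg (zero_le_one.trans (one_le_realDil h J hy))] at h5
  exact h5

/-- The contraction of the circles transforms the integral over a cell into an integral over a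
piece of the big polytope. -/
theorem orient_mul_monInt_eq (h : Admissible ε ε₀ x) (J : Stratum I) {lam : Hyp m → ℂ}
    (hlam : ∀ L, 1 < (lam L).re) :
    (∏ L ∈ J.1, orient L) * monInt h J lam = (∏ L ∈ J.1, monod (lam L)) *
      ∫ s in region ε ε₀ J, ∏ L ∈ activeHyp I, ((hypVal I s L : ℝ) : ℂ) ^ (lam L - 1) := by
  have hmeas := (isCompact_slotDom h J ∅).measurableSet
  rw [orient_mul_monInt h J hlam, ← image_realMap h J,
    integral_image_eq_integral_abs_det_fderiv_smul volume hmeas (f := realMap ε ε₀ J)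
      (f' := fderiv ℝ (realMap ε ε₀ J)) (fun y _ => (differentiableAt_pi.2 fun k =>
        differentiable_realMap J k y).hasFDerivAt.hasFDerivWithinAt)
      (backMap_realMap h J).injOn]
  congr 1
  refine setIntegral_congr_fun hmeas fun y hy => ?_
  have hy1 : ∀ k ∈ angSlots J, y k ≤ slotRad ε ε₀ J k := fun k hk => by
    simpa using (hy.2 k hk).2
  rw [abs_det_realMap h J hy1, slotWeight, prod_activeHyp_stratum J, slotDil_ofReal,
    slotMap_ofReal, Complex.real_smul, Complex.ofReal_pow, mul_left_comm]
  congr 2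
  · exact Finset.prod_congr rfl fun k hk => by rw [hypVal_realMap_hypAt h hk]
  · refine Finset.prod_congr rfl fun L hL => ?_
    have hpos := (hypRad_pos h L).trans_le (hypRad_le_hypVal_realMap h hy1 hy.1 hL)
    rw [hypVal_ofReal, Complex.cpow_def_of_ne_zero (by exact_mod_cast hpos.ne'), mul_comm]

/-! ### The pieces cover the big polytope -/

/-- For `I = ∅` the form of `hSum` is the constant `1`; the bound `r < 1` excludes that its level
set is everything. -/
theorem volume_setOf_hypVal_eq {L : Hyp m} {r : ℝ} (hr : r < 1) :
    volume {s : Fin m → ℝ | hypVal I s L = r} = 0 := by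
  rcases L with k | k | u
  · exact Measure.pi_hyperplane (fun _ : Fin m => (volume : Measure ℝ)) k r
  · have : {s : Fin m → ℝ | hypVal I s (Sum.inr (Sum.inl k)) = r} = {s | s k = 1 - r} := by
      ext s
      simp only [hypVal, Set.mem_ofPred_eq]
      constructor <;> intro <;> linarith
    rw [this]
    exact Measure.pi_hyperplane (fun _ : Fin m => (volume : Measure ℝ)) k (1 - r)
  · rcases I.eq_empty_or_nonempty with rfl | ⟨i, hi⟩
    · have : {s : Fin m → ℝ | hypVal ∅ s (Sum.inr (Sum.inr u)) = r} = ∅ := by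
        ext s
        simp [hypVal, hr.ne']
      rw [this, measure_empty]
    · set φ : (Fin m → ℝ) →ₗ[ℝ] ℝ := ∑ i ∈ I, LinearMap.proj i with hφ
      have hφ' : ∀ s, φ s = ∑ i ∈ I, s i := fun s => by simp [hφ]
      have h1 : {s : Fin m → ℝ | hypVal I s (Sum.inr (Sum.inr u)) = r} =
          ((AffineSubspace.mk' (1 - r) (⊥ : Submodule ℝ ℝ)).comap φ.toAffineMap :
            Set (Fin m → ℝ)) := by
        ext s
        simp only [hypVal, AffineSubspace.coe_comap, Set.mem_preimage, SetLike.mem_coe,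
          AffineSubspace.mem_mk', Submodule.mem_bot, LinearMap.coe_toAffineMap, vsub_eq_sub, hφ',
          Set.mem_ofPred_eq]
        constructor <;> intro <;> linarith
      rw [h1]
      refine Measure.addHaar_affineSubspace _ _ fun htop => ?_
      have h2 : ∀ s : Fin m → ℝ, s ∈
          (AffineSubspace.mk' (1 - r) (⊥ : Submodule ℝ ℝ)).comap φ.toAffineMap := fun s => by
        rw [htop]
        exact AffineSubspace.mem_top _ _ _
      have h3 := h2 0
      simp [AffineSubspace.mem_mk'] at h3
      linarith

/-- The walls that are nearer to `s` than their radius form an admissible set: `s_k` and `1 - s_k`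
cannot both be below `1/4`, and not all barycentric coordinates can be below their radii, whose sum
is less than `1`. -/
theorem exists_stratum (h : Admissible ε ε₀ x) {s : Fin m → ℝ} :
    ∃ J : Stratum I, J.1 = (activeHyp I).filter fun L => hypVal I s L < hypRad ε ε₀ L := by
  refine ⟨⟨(activeHyp I).filter fun L => hypVal I s L < hypRad ε ε₀ L, fun k hk => ?_,
    fun hS => ?_⟩, rfl⟩
  · obtain ⟨h1, h2⟩ := Finset.mem_filter.1 hk
    refine ⟨fun hkI => mem_activeHyp.1 h1 k hkI rfl, fun hz => ?_⟩
    have h3 := (Finset.mem_filter.1 hz).2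
    simp only [hypVal, hypRad] at h2 h3
    have := h.eps_lt k
    linarith
  · by_contra! hcon
    have h1 := (Finset.mem_filter.1 hS).2
    simp only [hypVal, hypRad] at h1
    have h2 : ∑ i ∈ I, s i ≤ ∑ i ∈ I, ε i :=
      Finset.sum_le_sum fun i hi => (Finset.mem_filter.1 (hcon i hi)).2.le
    have := sum_eps_lt h I
    linarith

theorem unitPolytope_eq : unitPolytope (· ∈ I) =
    {s : Fin m → ℝ | ∀ L ∈ activeHyp I, 0 ≤ hypVal I s L} := by
  ext s
  simp only [unitPolytope, Set.mem_ofPred_eq, Finset.sum_ite_mem, Finset.univ_inter]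
  constructor
  · rintro ⟨h1, h2, h3⟩ L hL
    rcases L with k | k | u
    · exact h1 k
    · have := h2 k fun hk => mem_activeHyp.1 hL k hk rfl
      simp only [hypVal]
      linarith
    · simp only [hypVal]
      linarith
  · intro hs
    refine ⟨fun k => hs (hZero k) (mem_activeHyp.2 fun _ _ => by simp), fun k hk => ?_, ?_⟩
    · have := hs (hOne k) (mem_activeHyp.2 fun l hl h' => by cases h'; exact hk hl)
      simp only [hypVal] at this
      linarith
    · have := hs hSum (mem_activeHyp.2 fun _ _ => by simp)
      simp only [hypVal] at this
      linarith

theorem measurableSet_region (h : Admissible ε ε₀ x) (J : Stratum I) :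
    MeasurableSet (region ε ε₀ J) := by
  rw [← image_realMap h J]
  refine ((isCompact_slotDom h J ∅).image ?_).measurableSet
  exact continuous_pi fun k => (differentiable_realMap J k).continuous

/-- Almost no point has a form exactly equal to its radius. Any other point of the polytope lies in
one region only, the one indexed by its set of near walls. -/
theorem sum_setIntegral_region (h : Admissible ε ε₀ x) {f : (Fin m → ℝ) → ℂ}
    (hf : IntegrableOn f (unitPolytope (· ∈ I))) :
    ∑ J : Stratum I, ∫ s in region ε ε₀ J, f s = ∫ s in unitPolytope (· ∈ I), f s := by
  have hsub : ∀ J : Stratum I, region ε ε₀ J ⊆ unitPolytope (· ∈ I) := fun J s hs => by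
    rw [unitPolytope_eq]
    exact hs.1
  simp_rw [← integral_indicator (measurableSet_region h _)]
  rw [← integral_indicator (isCompact_unitPolytope _).measurableSet,
    ← integral_finsetSum _ fun J _ =>
      (integrable_indicator_iff (measurableSet_region h J)).2 (hf.mono_set (hsub J))]
  have hnull : ∀ᵐ s : Fin m → ℝ, ∀ L : Hyp m, hypRad ε ε₀ L < 1 → hypVal I s L ≠ hypRad ε ε₀ L := by
    refine ae_all_iff.2 fun L => ?_
    by_cases hL : hypRad ε ε₀ L < 1
    · have := volume_setOf_hypVal_eq (I := I) (L := L) hL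
      rw [ae_iff]
      simpa [hL] using this
    · exact Filter.Eventually.of_forall fun s h' => absurd h' hL
  have hlt : ∀ L, hypRad ε ε₀ L < 1 := by
    intro L
    rcases L with k | k | u
    · exact (h.eps_lt k).trans (by norm_num)
    · exact (h.eps_lt k).trans (by norm_num)
    · have := h.eps₀_lt
      have h1 : 0 ≤ ∑ k, ε k := Finset.sum_nonneg fun k _ => (h.eps_pos k).le
      simp only [hypRad]
      linarith
  refine integral_congr_ae ?_
  filter_upwards [hnull] with s hs
  obtain ⟨J, hJ⟩ := exists_stratum (I := I) h (s := s)
  have hne : ∀ J', J' ≠ J → s ∉ region ε ε₀ J' := by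
    rintro J' hJ' ⟨-, h2, h3⟩
    refine hJ' (Subtype.ext ?_)
    rw [hJ]
    ext L
    rw [Finset.mem_filter]
    constructor
    · intro hL
      exact ⟨stratum_subset J' hL, lt_of_le_of_ne (h2 L hL) (hs L (hlt L))⟩
    · rintro ⟨h4, h5⟩
      by_contra hL
      exact absurd (h3 L (Finset.mem_sdiff.2 ⟨h4, hL⟩)) (not_le.2 h5)
  rw [Finset.sum_eq_single J (fun J' _ hJ' => Set.indicator_of_notMem (hne J' hJ') _)
    (fun h' => absurd (Finset.mem_univ J) h')]
  by_cases hsP : s ∈ unitPolytope (· ∈ I)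
  · rw [Set.indicator_of_mem hsP, Set.indicator_of_mem]
    rw [unitPolytope_eq] at hsP
    refine ⟨hsP, fun L hL => ?_, fun L hL => ?_⟩
    · rw [hJ] at hL
      exact (Finset.mem_filter.1 hL).2.le
    · obtain ⟨h1, h2⟩ := Finset.mem_sdiff.1 hL
      rw [hJ, Finset.mem_filter, not_and, not_lt] at h2
      exact h2 h1
  · rw [Set.indicator_of_notMem hsP, Set.indicator_of_notMem fun h' => hsP (hsub J h')]

end subdivision

/-! ### The monomial integrals over the regularized cycle -/

section regularization

variable {m : ℕ} {I : Finset (Fin m)} {ε : Fin m → ℝ} {ε₀ : ℝ} {x : Fin m → ℝ}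

theorem continuousOn_hypLog (h : Admissible ε ε₀ x) (J : Stratum I) {L : Hyp m}
    (hL : L ∈ activeHyp I) : ContinuousOn (fun y => hypLog ε ε₀ J y L) (cellDom ε ε₀ J) := by
  by_cases hLJ : L ∈ J.1
  · obtain ⟨k, hk, rfl⟩ := exists_hypAt hLJ
    simp only [hypLog_hypAt hk]
    fun_prop
  · simp only [hypLog_of_notMem hLJ]
    refine continuousOn_clog (hypVal_continuous
      (fun k => (contDiff_cellMap_apply J k).continuous) L).continuousOn fun y hy => ?_
    rw [cellDom_eq_slotDom] at hy
    rw [← slotMap_circleSlots]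
    exact (hypRad_pos h L).trans_le (hypRad_le_hypVal_re h (fun k hk =>
      (Complex.re_le_norm _).trans (norm_circleSlots_le (fun k _ => hypRad_pos h _) hy hk)) hy.1
        (Finset.mem_sdiff.2 ⟨hL, hLJ⟩))

theorem continuous_jacobian (h : Admissible ε ε₀ x) (J : Stratum I) :
    Continuous (tubeCell h J).jacobian := by
  have hc : Continuous (fderiv ℝ (tubeCell h J).map) :=
    (tubeCell h J).contDiff_map.continuous_fderiv (by simp)
  unfold LoadedCell.jacobian
  refine Continuous.matrix_det (continuous_matrix fun i k => ?_)
  exact (continuous_apply i).comp (hc.clm_apply continuous_const)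

/-- A single complex parameter, the common shift of all exponents, suffices for the continuation: a
large shift moves all of them into the half plane `Re > 1`. -/
theorem differentiable_monInt (h : Admissible ε ε₀ x) (J : Stratum I) (lam : Hyp m → ℂ) :
    Differentiable ℂ fun t : ℂ => monInt h J fun L => lam L + t := by
  have h1 := differentiable_setIntegral_exp (μ := volume) (isCompact_cellDom h J)
    (g := fun y => ∑ L ∈ activeHyp I, hypLog ε ε₀ J y L)
    (w := fun y => Complex.exp (∑ L ∈ activeHyp I, (lam L - 1) * hypLog ε ε₀ J y L) *
      (tubeCell h J).jacobian y)
    (continuousOn_finsetSum _ fun L hL => continuousOn_hypLog h J hL)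
    (ContinuousOn.mul (continuousOn_finsetSum _ fun L hL =>
      continuousOn_const.mul (continuousOn_hypLog h J hL)).cexp
      (continuous_jacobian h J).continuousOn)
  convert! h1 using 2 with t
  unfold monInt
  congr 1
  funext y
  rw [← mul_assoc, ← Complex.exp_add, Finset.mul_sum, ← Finset.sum_add_distrib]
  congr 2
  refine Finset.sum_congr rfl fun L _ => ?_
  ring

/-- The entire function that equals `(e ^ {2 π i z} - 1) Γ(z)` off the poles of `Γ`. -/
noncomputable def hankel (z : ℂ) : ℂ :=
  2 * Real.pi * Complex.I * Complex.exp (Real.pi * Complex.I * z) * (Complex.Gamma (1 - z))⁻¹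

theorem differentiable_monod : Differentiable ℂ monod := by
  unfold monod
  fun_prop

theorem differentiable_hankel : Differentiable ℂ hankel := by
  unfold hankel
  have h1 : Differentiable ℂ fun z : ℂ => (Complex.Gamma (1 - z))⁻¹ :=
    Complex.differentiable_one_div_Gamma.comp (differentiable_id.const_sub 1)
  fun_prop

/-- The reflection formula, together with `e^{2πiz} - 1 = 2i e^{πiz} sin(πz)`. `Complex.Gamma` has
the value `0` at its poles, so the assumption says that `z` is not a pole. -/
theorem hankel_eq {z : ℂ} (hz : Complex.Gamma z ≠ 0) : hankel z = monod z * Complex.Gamma z := by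
  have h1 := Complex.Gamma_mul_Gamma_one_sub z
  have hpi : (Real.pi : ℂ) ≠ 0 := by exact_mod_cast Real.pi_ne_zero
  have h2 : (Complex.Gamma (1 - z))⁻¹ =
      Complex.sin (Real.pi * z) * Complex.Gamma z / Real.pi := by
    have h3 : Complex.Gamma (1 - z) =
        Real.pi / (Complex.sin (Real.pi * z) * Complex.Gamma z) := by
      rw [← div_div, ← h1, mul_div_cancel_left₀ _ hz]
    rw [h3, inv_div]
  have h4 : monod z = 2 * Complex.I * Complex.exp (Real.pi * Complex.I * z) *
      Complex.sin (Real.pi * z) := by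
    rw [monod, Complex.sin, show 2 * (Real.pi : ℂ) * Complex.I * z =
      Real.pi * Complex.I * z + Real.pi * Complex.I * z by ring, Complex.exp_add,
      show (Real.pi : ℂ) * z * Complex.I = Real.pi * Complex.I * z by ring,
      show -((Real.pi : ℂ) * z) * Complex.I = -(Real.pi * Complex.I * z) by ring, Complex.exp_neg]
    have := Complex.exp_ne_zero (Real.pi * Complex.I * z)
    field_simp
    linear_combination (Complex.exp (Real.pi * Complex.I * z) ^ 2 - 1) * Complex.I_sq
  rw [hankel, h2, h4]
  field_simp

/-- `Γ` has no zeros; the value `0` occurs only at the poles, which are integers. -/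
theorem Gamma_ne_zero_of_monod {z : ℂ} (hz : monod z ≠ 0) : Complex.Gamma z ≠ 0 := by
  intro h0
  obtain ⟨n, rfl⟩ := Complex.Gamma_eq_zero_iff _ |>.1 h0
  refine hz ?_
  rw [monod, sub_eq_zero, Complex.exp_eq_one_iff]
  exact ⟨-n, by push_cast; ring⟩

theorem monod_ne_zero {z : ℂ} (hz : ∀ n : ℤ, z ≠ n) : monod z ≠ 0 := by
  intro h0
  rw [monod, sub_eq_zero, Complex.exp_eq_one_iff] at h0
  obtain ⟨n, hn⟩ := h0
  refine hz n (mul_left_cancel₀ Complex.two_pi_I_ne_zero ?_)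
  rw [hn]
  ring

theorem monod_add_int (z : ℂ) (n : ℤ) : monod (z + n) = monod z := by
  rw [monod, monod, mul_add, Complex.exp_add, mul_comm _ (n : ℂ), Complex.exp_int_mul_two_pi_mul_I,
    mul_one]

theorem prod_ite_compl {R : Type*} [CommMonoid R] (I : Finset (Fin m)) (f g : Fin m → R) :
    ∏ k, (if k ∈ I then f k else g k) = (∏ i ∈ I, f i) * ∏ j ∈ Iᶜ, g j := by
  rw [← Finset.prod_mul_prod_compl I]
  congr 1
  · exact Finset.prod_congr rfl fun k hk => if_pos hk
  · exact Finset.prod_congr rfl fun k hk => if_neg (Finset.mem_compl.1 hk)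

/-- The sum of the contracted cells, multiplied by all the monodromy factors. -/
theorem sum_monInt_of_re (h : Admissible ε ε₀ x) {lam : Hyp m → ℂ} (hlam : ∀ L, 1 < (lam L).re) :
    ∑ J : Stratum I, (∏ L ∈ activeHyp I \ J.1, monod (lam L)) *
      ((∏ L ∈ J.1, orient L) * monInt h J lam) =
    (∏ L ∈ activeHyp I, hankel (lam L)) *
      (∏ j ∈ Iᶜ, (Complex.Gamma (lam (hZero j) + lam (hOne j)))⁻¹) *
      (Complex.Gamma (lam hSum + ∑ i ∈ I, lam (hZero i)))⁻¹ := by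
  have h1 : ∀ s : Fin m → ℝ, ∏ L ∈ activeHyp I, ((hypVal I s L : ℝ) : ℂ) ^ (lam L - 1) =
      dirichletTerm (· ∈ I) (fun k => lam (hZero k)) (fun k => lam (hOne k)) (lam hSum) s := by
    intro s
    rw [prod_activeHyp, dirichletTerm, Finset.prod_mul_distrib, Finset.sum_ite_mem,
      Finset.univ_inter, prod_ite_compl, Finset.prod_const_one, one_mul]
    rfl
  have h2 : ∀ J : Stratum I, (∏ L ∈ activeHyp I \ J.1, monod (lam L)) *
      ((∏ L ∈ J.1, orient L) * monInt h J lam) = (∏ L ∈ activeHyp I, monod (lam L)) *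
        ∫ s in region ε ε₀ J, dirichletTerm (· ∈ I) (fun k => lam (hZero k))
          (fun k => lam (hOne k)) (lam hSum) s := by
    intro J
    rw [orient_mul_monInt_eq h J hlam, ← mul_assoc, Finset.prod_sdiff (stratum_subset J)]
    simp_rw [h1]
  have hcont := continuous_dirichletTerm (p := (· ∈ I)) (lam := fun k => lam (hZero k))
    (mu := fun k => lam (hOne k)) (nu := lam hSum) (fun k => hlam _) (fun k => hlam _) (hlam _)
  rw [Finset.sum_congr rfl fun J _ => h2 J, ← Finset.mul_sum, sum_setIntegral_region h
    (hcont.continuousOn.integrableOn_compact (isCompact_unitPolytope _)),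
    setIntegral_dirichletTerm _ _ _ _ (fun k => hlam _) (fun k => hlam _) (hlam _)]
  have h3 : ∀ L, hankel (lam L) = monod (lam L) * Complex.Gamma (lam L) := fun L =>
    hankel_eq (Complex.Gamma_ne_zero_of_re_pos (zero_lt_one.trans (hlam L)))
  simp_rw [h3]
  rw [Finset.prod_mul_distrib, prod_activeHyp I fun L => Complex.Gamma (lam L),
    Finset.sum_ite_mem, Finset.univ_inter, prod_ite_compl, ← Finset.prod_mul_prod_compl I fun k =>
      Complex.Gamma (lam (hZero k)), Finset.prod_div_distrib, Finset.prod_mul_distrib,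
    Finset.prod_inv_distrib]
  ring

/-- The regularized integral of a monomial. -/
theorem sum_monInt (h : Admissible ε ε₀ x) {lam : Hyp m → ℂ}
    (hlam : ∀ L ∈ activeHyp I, monod (lam L) ≠ 0) :
    ∑ J : Stratum I, (∏ L ∈ J.1, orient L / monod (lam L)) * monInt h J lam =
      (∏ L ∈ activeHyp I, Complex.Gamma (lam L)) *
      (∏ j ∈ Iᶜ, (Complex.Gamma (lam (hZero j) + lam (hOne j)))⁻¹) *
      (Complex.Gamma (lam hSum + ∑ i ∈ I, lam (hZero i)))⁻¹ := by
  have key : ∑ J : Stratum I, (∏ L ∈ activeHyp I \ J.1, monod (lam L)) *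
      ((∏ L ∈ J.1, orient L) * monInt h J lam) =
    (∏ L ∈ activeHyp I, hankel (lam L)) *
      (∏ j ∈ Iᶜ, (Complex.Gamma (lam (hZero j) + lam (hOne j)))⁻¹) *
      (Complex.Gamma (lam hSum + ∑ i ∈ I, lam (hZero i)))⁻¹ := by
    set f : ℂ → ℂ := fun t => ∑ J : Stratum I, (∏ L ∈ activeHyp I \ J.1, monod (lam L + t)) *
      ((∏ L ∈ J.1, orient L) * monInt h J fun L => lam L + t) with hf
    set g : ℂ → ℂ := fun t => (∏ L ∈ activeHyp I, hankel (lam L + t)) *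
      (∏ j ∈ Iᶜ, (Complex.Gamma (lam (hZero j) + t + (lam (hOne j) + t)))⁻¹) *
      (Complex.Gamma (lam hSum + t + ∑ i ∈ I, (lam (hZero i) + t)))⁻¹ with hg
    have hfd : Differentiable ℂ f := by
      refine Differentiable.fun_sum fun J _ => Differentiable.mul
        (Differentiable.fun_finsetProd fun L _ => ?_) ((differentiable_monInt h J lam).const_mul _)
      exact differentiable_monod.comp (differentiable_id.const_add _)
    have hgd : Differentiable ℂ g := by
      refine ((Differentiable.fun_finsetProd fun L _ => ?_).mul
        (Differentiable.fun_finsetProd fun j _ => ?_)).mul ?_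
      · exact differentiable_hankel.comp (differentiable_id.const_add _)
      · exact Complex.differentiable_one_div_Gamma.comp
          ((differentiable_id.const_add _).add (differentiable_id.const_add _))
      · exact Complex.differentiable_one_div_Gamma.comp
          ((differentiable_id.const_add _).add
            (Differentiable.fun_sum fun i _ => differentiable_id.const_add _))
    -- The base point is real and so large that every shifted exponent has real part greater than
    -- `1`, also in a neighbourhood.
    have heq : f = g := by
      refine AnalyticOnNhd.eq_of_eventuallyEq (z₀ := ((2 + ∑ L, |(lam L).re| : ℝ) : ℂ))
        (fun t _ => hfd.analyticAt t) (fun t _ => hgd.analyticAt t) ?_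
      have hopen : IsOpen {t : ℂ | ∀ L, 1 < (lam L + t).re} := by
        simp only [Set.ofPred_forall]
        exact isOpen_iInter_of_finite fun L => isOpen_lt continuous_const
          (Complex.continuous_re.comp (continuous_const.add continuous_id))
      refine Filter.eventually_of_mem (hopen.mem_nhds fun L => ?_) fun t ht =>
        sum_monInt_of_re h ht
      have h1 := Finset.single_le_sum (f := fun L => |(lam L).re|) (fun L _ => abs_nonneg _)
        (Finset.mem_univ L)
      have h2 := neg_abs_le (lam L).re
      simp only [Complex.add_re, Complex.ofReal_re] at h1 ⊢
      linarith
    have := congr_fun heq 0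
    simpa only [hf, hg, add_zero] using this
  -- Division by all the monodromy factors: those outside `J` cancel against the left-hand weights,
  -- and those in `J` become the denominators of the cycle.
  have hne : ∏ L ∈ activeHyp I, monod (lam L) ≠ 0 := Finset.prod_ne_zero_iff.2 hlam
  refine mul_left_cancel₀ hne ?_
  rw [Finset.prod_congr rfl fun L hL => hankel_eq (Gamma_ne_zero_of_monod (hlam L hL)),
    Finset.prod_mul_distrib] at key
  rw [← mul_assoc, ← mul_assoc, ← key, Finset.mul_sum]
  refine Finset.sum_congr rfl fun J _ => ?_
  have hne' : ∏ L ∈ J.1, monod (lam L) ≠ 0 :=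
    Finset.prod_ne_zero_iff.2 fun L hL => hlam L (stratum_subset J hL)
  rw [Finset.prod_div_distrib, ← Finset.prod_sdiff (stratum_subset J)]
  field_simp

end regularization

/-! ### Quotients of values of the gamma function -/

theorem Gamma_add_nat {z : ℂ} (hz : ∀ n : ℤ, z ≠ n) (n : ℕ) :
    Complex.Gamma (z + n) = poch z n * Complex.Gamma z := by
  induction n with
  | zero => simp [poch]
  | succ n ih =>
    have h1 : z + n ≠ 0 := fun h0 => hz (-n) (by push_cast; linear_combination h0)
    rw [poch, ascPochhammer_succ_eval, ← poch, Nat.cast_succ, ← add_assoc,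
      Complex.Gamma_add_one _ h1, ih]
    ring

theorem Gamma_sub_nat {z : ℂ} (hz : ∀ n : ℤ, z ≠ n) (n : ℕ) :
    Complex.Gamma (z - n) * ((-1) ^ n * poch (1 - z) n) = Complex.Gamma z := by
  induction n with
  | zero => simp [poch]
  | succ n ih =>
    have h1 : z - (n + 1) ≠ 0 := fun h0 => hz (n + 1) (by push_cast; linear_combination h0)
    have h2 := Complex.Gamma_add_one _ h1
    rw [show z - (n + 1) + 1 = z - n by ring] at h2
    rw [← ih, h2, poch, ascPochhammer_succ_eval, ← poch]
    push_cast
    ring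

theorem poch_ne_zero {z : ℂ} (hz : ∀ n : ℤ, z ≠ n) (n : ℕ) : poch z n ≠ 0 := by
  induction n with
  | zero => simp [poch]
  | succ n ih =>
    rw [poch, ascPochhammer_succ_eval]
    exact mul_ne_zero ih fun h0 => hz (-n) (by push_cast; linear_combination h0)

theorem Gamma_ne_zero_of_ne_int {z : ℂ} (hz : ∀ n : ℤ, z ≠ n) : Complex.Gamma z ≠ 0 :=
  Gamma_ne_zero_of_monod (monod_ne_zero hz)

section final

variable {m : ℕ} {I : Finset (Fin m)} {ε : Fin m → ℝ} {ε₀ : ℝ} {x : Fin m → ℝ}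

/-- The exponents of the terms of the expansion of `u_I φ_I` into monomials. -/
noncomputable def expo (I : Finset (Fin m)) (a : ℂ) (b c : Fin m → ℂ) (n : Fin m → ℕ) : Hyp m → ℂ
  | Sum.inl k => if k ∈ I then c k - 1 - n k else b k + n k
  | Sum.inr (Sum.inl k) => c k - b k
  | Sum.inr (Sum.inr _) => 1 - a - ((∑ k, if k ∈ I then 0 else n k : ℕ) : ℂ)

theorem bShift_apply (b c : Fin m → ℂ) (k : Fin m) :
    bShift I b c k = if k ∈ I then b k - c k + 1 else b k := by
  have : (∑ i ∈ I, (1 - c i) • Pi.single i (1 : ℂ) : Fin m → ℂ) k =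
      if k ∈ I then 1 - c k else 0 := by
    simp [Finset.sum_apply, Pi.single_apply]
  rw [bShift, Pi.add_apply, this]
  split_ifs <;> ring

/-- The form `1 - (c k - 1)` is the one that the shift rule for `Γ(z - n)` produces at `z = c k -
1`. -/
theorem cShift_apply (c : Fin m → ℂ) (k : Fin m) :
    cShift I c k = if k ∈ I then 1 - (c k - 1) else c k := by
  have : (∑ i ∈ I, (1 - c i) • Pi.single i (1 : ℂ) : Fin m → ℂ) k =
      if k ∈ I then 1 - c k else 0 := by
    simp [Finset.sum_apply, Pi.single_apply]
  rw [cShift, Pi.add_apply, Pi.smul_apply, this, smul_eq_mul]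
  split_ifs <;> ring

/-- The values of the monomial integrals, in terms of the series. -/
theorem multTerm_mul_Gamma {a : ℂ} {b c : Fin m → ℂ} (hb : ∀ k, ∀ n : ℤ, b k ≠ n)
    (hac : ∀ S : Finset (Fin m), ∀ n : ℤ, a - ∑ i ∈ S, c i ≠ n) (hc : ∀ k, ∀ n : ℤ, c k ≠ n)
    (q : Fin m → ℂ) (n : Fin m → ℕ) :
    multTerm (· ∈ I) (fun k => b k - c k + 1) q a n *
      ((∏ L ∈ activeHyp I, Complex.Gamma (expo I a b c n L)) *
      (∏ j ∈ Iᶜ, (Complex.Gamma (expo I a b c n (hZero j) + expo I a b c n (hOne j)))⁻¹) *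
      (Complex.Gamma (expo I a b c n hSum + ∑ i ∈ I, expo I a b c n (hZero i)))⁻¹) =
    (∏ i ∈ I, Complex.Gamma (c i - 1)) *
      (∏ j ∈ Iᶜ, Complex.Gamma (b j) * Complex.Gamma (c j - b j) / Complex.Gamma (c j)) *
      (Complex.Gamma (1 - a) / Complex.Gamma (∑ i ∈ I, c i - a - I.card + 1)) *
      termFA (a + I.card - ∑ i ∈ I, c i) (bShift I b c) (cShift I c) q n := by
  set N := ∑ k, (if k ∈ I then 0 else n k) with hN
  set N' := ∑ k, (if k ∈ I then n k else 0) with hN'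
  set Y := ∑ i ∈ I, c i - a - I.card + 1 with hY
  have hM : ∑ k, n k = N' + N := by
    rw [hN, hN', ← Finset.sum_add_distrib]
    refine Finset.sum_congr rfl fun k _ => ?_
    split_ifs <;> simp
  have ha : ∀ n : ℤ, 1 - a ≠ n := fun l h0 => hac ∅ (1 - l) (by
    push_cast
    rw [Finset.sum_empty]
    linear_combination -h0)
  have ha' : ∀ n : ℤ, a ≠ n := fun l h0 => hac ∅ l (by simpa using h0)
  have hYZ : ∀ n : ℤ, Y ≠ n := fun l h0 => hac I (1 - I.card - l) (by
    push_cast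
    linear_combination hY - h0)
  have e1 : expo I a b c n hSum + ∑ i ∈ I, expo I a b c n (hZero i) =
      Y - ((∑ k, n k : ℕ) : ℂ) := by
    have h1 : ∑ i ∈ I, expo I a b c n (hZero i) = ∑ i ∈ I, c i - I.card - N' := by
      have : ∀ i ∈ I, expo I a b c n (hZero i) = c i - 1 - n i := fun i hi => if_pos hi
      rw [Finset.sum_congr rfl this, Finset.sum_sub_distrib, Finset.sum_sub_distrib, hN',
        Finset.sum_ite_mem, Finset.univ_inter]
      simp
    rw [h1, hM, hY]
    simp only [expo, ← hN]
    push_cast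
    ring
  have e2 : (Complex.Gamma (Y - ((∑ k, n k : ℕ) : ℂ)))⁻¹ =
      (-1) ^ N' * (-1) ^ N * poch (1 - Y) (∑ k, n k) / Complex.Gamma Y := by
    have h1 := Gamma_sub_nat hYZ (∑ k, n k)
    have h2 := Gamma_ne_zero_of_ne_int hYZ
    have h3 : Complex.Gamma (Y - ((∑ k, n k : ℕ) : ℂ)) ≠ 0 := fun h0 => h2 (by
      rw [← h1, h0, zero_mul])
    rw [← pow_add, ← hM, inv_eq_one_div, div_eq_div_iff h3 h2, ← h1]
    ring
  have e3 : Complex.Gamma (1 - a - N) = Complex.Gamma (1 - a) * (-1) ^ N / poch a N := by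
    have h1 := Gamma_sub_nat ha N
    rw [sub_sub_cancel] at h1
    have h2 := poch_ne_zero ha' N
    have h3 : ((-1 : ℂ) ^ N) * (-1) ^ N = 1 := by rw [← mul_pow]; simp
    rw [eq_div_iff h2, ← h1]
    linear_combination (-Complex.Gamma (1 - a - N) * poch a N) * h3
  -- Everything except the two gamma factors of the slanted wall splits over the coordinates. A
  -- coordinate in `I` has its exponent lowered by `n k` and leaves the sign `(-1) ^ n k`.
  have e4 : ∀ k, (if k ∈ I then (ascPochhammer ℂ (n k)).eval (b k - c k + 1) else 1) /
      ((n k).factorial : ℂ) * q k ^ n k * (Complex.Gamma (expo I a b c n (hZero k)) *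
        (if k ∈ I then 1 else Complex.Gamma (c k - b k)) *
        (if k ∈ I then 1 else (Complex.Gamma (c k + n k))⁻¹)) =
      (if k ∈ I then Complex.Gamma (c k - 1) else
        Complex.Gamma (b k) * Complex.Gamma (c k - b k) / Complex.Gamma (c k)) *
      (poch (bShift I b c k) (n k) / (poch (cShift I c k) (n k) * ((n k).factorial : ℂ)) *
        q k ^ n k) * (-1) ^ (if k ∈ I then n k else 0) := by
    intro k
    rw [bShift_apply, cShift_apply]
    simp only [expo]
    split_ifs with hk
    · have hck : ∀ l : ℤ, c k - 1 ≠ l := fun l h0 => hc k (l + 1) (by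
        push_cast
        linear_combination h0)
      have hck' : ∀ l : ℤ, 1 - (c k - 1) ≠ l := fun l h0 => hc k (2 - l) (by
        push_cast
        linear_combination -h0)
      have h2 := poch_ne_zero hck' (n k)
      have h3 : ((-1 : ℂ) ^ n k) * (-1) ^ n k = 1 := by rw [← mul_pow]; simp
      rw [← Gamma_sub_nat hck (n k), ← poch]
      have h5 := mul_inv_cancel₀ h2
      simp only [poch] at h5 ⊢
      generalize (ascPochhammer ℂ (n k)).eval (b k - c k + 1) = A
      generalize (ascPochhammer ℂ (n k)).eval (1 - (c k - 1)) = P at h5 ⊢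
      linear_combination (-(A / ((n k).factorial : ℂ) * q k ^ n k *
        Complex.Gamma (c k - 1 - n k))) * (P * P⁻¹ * h3 + h5)
    · have h2 := poch_ne_zero (hc k) (n k)
      have h3 := Gamma_ne_zero_of_ne_int (hc k)
      rw [Gamma_add_nat (hb k), Gamma_add_nat (hc k)]
      field_simp
  have e5 : ∀ j, expo I a b c n (hZero j) + expo I a b c n (hOne j) =
      if j ∈ I then c j - 1 - n j + (c j - b j) else c j + n j := by
    intro j
    simp only [expo]
    split_ifs <;> ring
  have e6 : ∏ j ∈ Iᶜ, (Complex.Gamma (expo I a b c n (hZero j) + expo I a b c n (hOne j)))⁻¹ =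
      ∏ k, (if k ∈ I then 1 else (Complex.Gamma (c k + n k))⁻¹) := by
    rw [prod_ite_compl, Finset.prod_const_one, one_mul]
    refine Finset.prod_congr rfl fun j hj => ?_
    rw [e5, if_neg (Finset.mem_compl.1 hj)]
  have e7 : ∏ j ∈ Iᶜ, Complex.Gamma (expo I a b c n (hOne j)) =
      ∏ k, (if k ∈ I then 1 else Complex.Gamma (c k - b k)) := by
    rw [prod_ite_compl, Finset.prod_const_one, one_mul]
    rfl
  have e8 : expo I a b c n hSum = 1 - a - N := rfl
  have e9 : a + I.card - ∑ i ∈ I, c i = 1 - Y := by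
    rw [hY]
    ring
  rw [e1, e2, prod_activeHyp, e6, e7, e8, e3, ← prod_ite_compl, e9, termFA, multTerm]
  have e10 := Finset.prod_congr (rfl : (Finset.univ : Finset (Fin m)) = Finset.univ)
    fun k _ => e4 k
  simp only [Finset.prod_mul_distrib, Finset.prod_div_distrib, Finset.prod_pow_eq_pow_sum]
    at e10 ⊢
  rw [← hN'] at e10
  rw [← poch]
  have h1 := poch_ne_zero ha' N
  have h3 : ((-1 : ℂ) ^ N) * (-1) ^ N = 1 := by rw [← mul_pow]; simp
  have h4 : ((-1 : ℂ) ^ N') * (-1) ^ N' = 1 := by rw [← mul_pow]; simp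
  rw [← hN]
  have h5 := mul_inv_cancel₀ h1
  -- The signs cancel: `(-1) ^ (N' + N)` from `e2` meets `(-1) ^ N` from `e3` and `(-1) ^ N'` from
  -- `e4`.
  linear_combination (Complex.Gamma (1 - a) * poch (1 - Y) (∑ k, n k) / Complex.Gamma Y) *
    (poch a N * (poch a N)⁻¹ * (-1) ^ N * (-1) ^ N * (-1) ^ N' * e10 +
      (∏ k, (if k ∈ I then Complex.Gamma (c k - 1) else
        Complex.Gamma (b k) * Complex.Gamma (c k - b k) / Complex.Gamma (c k))) *
      ((∏ k, poch (bShift I b c k) (n k)) /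
        ((∏ k, poch (cShift I c k) (n k)) * ∏ k, ((n k).factorial : ℂ)) * ∏ k, q k ^ n k) *
      (poch a N * (poch a N)⁻¹ * ((-1) ^ N * (-1) ^ N * h4 + h3) + h5))

end final

/-! ### Expansion of the integral over the regularized cycle -/

section expansion

variable {m : ℕ} {I : Finset (Fin m)} {ε : Fin m → ℝ} {ε₀ : ℝ} {x : Fin m → ℝ}

/-- The ratios `1 / s_i` for `i ∈ I` and `s_j / (1 - ∑_{i ∈ I} s_i)` for `j ∉ I` on a cell. -/
noncomputable def ratio (ε : Fin m → ℝ) (ε₀ : ℝ) (J : Stratum I) (y : Fin m → ℝ) (k : Fin m) : ℂ :=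
  if k ∈ I then (cellMap ε ε₀ J y k)⁻¹ else cellMap ε ε₀ J y k / simplexRest ε ε₀ J y

/-- Bounds for the products of the ratios with the variables. -/
noncomputable def ratioBound (I : Finset (Fin m)) (ε : Fin m → ℝ) (ε₀ : ℝ) (x : Fin m → ℝ)
    (k : Fin m) : ℝ :=
  if k ∈ I then x k / ε k else x k * (1 + ε k) / ε₀

theorem norm_mul_ratio_le (h : Admissible ε ε₀ x) {J : Stratum I} {y : Fin m → ℝ}
    (hy : y ∈ cellDom ε ε₀ J) (k : Fin m) :
    ‖(x k : ℂ) * ratio ε ε₀ J y k‖ ≤ ratioBound I ε ε₀ x k := by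
  have h1 := h.x_pos k
  have h2 := h.eps_pos k
  rw [norm_mul, Complex.norm_real, Real.norm_of_nonneg h1.le, ratio, ratioBound]
  split_ifs with hk
  · rw [norm_inv, div_eq_mul_inv]
    have := le_norm_cellMap h k hy
    gcongr
  · rw [norm_div, mul_div_assoc]
    have h3 := norm_cellMap_le h hk hy
    have h4 := le_norm_simplexRest h hy
    have h5 := h.eps₀_pos
    gcongr

theorem ratioBound_nonneg (h : Admissible ε ε₀ x) (k : Fin m) : 0 ≤ ratioBound I ε ε₀ x k := by
  have h1 := h.x_pos k
  have h2 := h.eps_pos k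
  have h3 := h.eps₀_pos
  unfold ratioBound
  split_ifs <;> positivity

theorem ratioBound_lt_one (h : Admissible ε ε₀ x) {k : Fin m} (hk : k ∈ I) :
    ratioBound I ε ε₀ x k < 1 := by
  rw [ratioBound, if_pos hk, div_lt_one (h.eps_pos k)]
  exact h.x_lt k

theorem sum_ratioBound_lt_one (h : Admissible ε ε₀ x) :
    ∑ k, (if k ∈ I then 0 else ratioBound I ε ε₀ x k) < 1 := by
  have h1 : ∑ k, (if k ∈ I then 0 else ratioBound I ε ε₀ x k) ≤
      ∑ k, x k * (1 + ε k) / ε₀ := by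
    refine Finset.sum_le_sum fun k _ => ?_
    have h1 := h.x_pos k
    have h2 := h.eps_pos k
    have h3 := h.eps₀_pos
    unfold ratioBound
    split_ifs
    · positivity
    · exact le_rfl
  refine h1.trans_lt ?_
  rw [← Finset.sum_div, div_lt_one h.eps₀_pos]
  exact h.sum_x_lt

theorem sum_expo_mul_hypLog (a : ℂ) (b c : Fin m → ℂ) (n : Fin m → ℕ) (J : Stratum I)
    (y : Fin m → ℝ) :
    ∑ L ∈ activeHyp I, (expo I a b c n L - 1) * hypLog ε ε₀ J y L =
      ∑ L ∈ activeHyp I, (expo I a b c 0 L - 1) * hypLog ε ε₀ J y L +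
        ∑ k, (n k : ℂ) * (if k ∈ I then -logCoord ε ε₀ J y k
          else logCoord ε ε₀ J y k - logRest ε ε₀ J y) := by
  have h1 : ∑ k, (expo I a b c n (hZero k) - 1) * hypLog ε ε₀ J y (hZero k) =
      ∑ k, (expo I a b c 0 (hZero k) - 1) * hypLog ε ε₀ J y (hZero k) +
      ∑ k, (n k : ℂ) * (if k ∈ I then -logCoord ε ε₀ J y k
          else logCoord ε ε₀ J y k - logRest ε ε₀ J y) +
      ∑ k, (if k ∈ I then 0 else (n k : ℂ)) * logRest ε ε₀ J y := by
    rw [← Finset.sum_add_distrib, ← Finset.sum_add_distrib]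
    refine Finset.sum_congr rfl fun k _ => ?_
    simp only [expo, hypLog, Pi.zero_apply]
    split_ifs <;> push_cast <;> ring
  rw [sum_activeHyp, sum_activeHyp, h1, ← Finset.sum_mul]
  simp only [expo, hypLog, Pi.zero_apply]
  push_cast
  simp only [ite_self, Finset.sum_const_zero]
  ring

/-- With the chosen branches, passing from exponents `0` to `n` multiplies the monomial by integer
powers of the ratios, so the monomials form a power series in them, with no ambiguity of branch. -/
theorem exp_sum_expo (h : Admissible ε ε₀ x) (a : ℂ) (b c : Fin m → ℂ) (n : Fin m → ℕ)
    {J : Stratum I} {y : Fin m → ℝ} (hy : y ∈ cellDom ε ε₀ J) :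
    Complex.exp (∑ L ∈ activeHyp I, (expo I a b c n L - 1) * hypLog ε ε₀ J y L) =
      Complex.exp (∑ L ∈ activeHyp I, (expo I a b c 0 L - 1) * hypLog ε ε₀ J y L) *
        ∏ k, ratio ε ε₀ J y k ^ n k := by
  rw [sum_expo_mul_hypLog, Complex.exp_add, Complex.exp_sum Finset.univ]
  congr 1
  refine Finset.prod_congr rfl fun k _ => ?_
  rw [Complex.exp_nat_mul, ratio]
  split_ifs
  · rw [Complex.exp_neg, exp_logCoord h hy]
  · rw [Complex.exp_sub, exp_logCoord h hy, exp_logRest h hy]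

theorem multTerm_mul_prod_pow (p : Fin m → Prop) [DecidablePred p] (al q w : Fin m → ℂ) (a : ℂ)
    (n : Fin m → ℕ) :
    multTerm p al q a n * ∏ k, w k ^ n k = multTerm p al (fun k => q k * w k) a n := by
  simp only [multTerm, mul_pow, Finset.prod_mul_distrib]
  ring

/-- `cellLog` already takes `s_i - x_i` and `v_I` apart as in the expansion, so this is additivity
of exponents. For `i ∈ I` they add up to `b_i + (c_i - b_i - 1) - 1 = (c_i - 1) - 1`, where the last
`-1` comes from `φ_I`. -/
theorem branch_mul_phiI (h : Admissible ε ε₀ x) (a : ℂ) (b c : Fin m → ℂ)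
    {J : Stratum I} {y : Fin m → ℝ} (hy : y ∈ cellDom ε ε₀ J) :
    (tubeCell h J).branch (expoI a b c) y * phiI ((tubeCell h J).map y) =
      ((∏ k, if k ∈ I then Complex.exp (-(b k - c k + 1) *
          Complex.log (1 - x k * ratio ε ε₀ J y k)) else 1) *
        Complex.exp (-a * Complex.log (1 - ∑ k, if k ∈ I then 0 else x k * ratio ε ε₀ J y k))) *
      Complex.exp (∑ L ∈ activeHyp I, (expo I a b c 0 L - 1) * hypLog ε ε₀ J y L) := by
  have h1 : phiI ((tubeCell h J).map y) = Complex.exp (-∑ k, logCoord ε ε₀ J y k) := by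
    rw [Complex.exp_neg, Complex.exp_sum, phiI]
    congr 1
    exact Finset.prod_congr rfl fun k _ => (exp_logCoord h hy k).symm
  have h2 : ∑ k, (if k ∈ I then 0 else (x k : ℂ) * ratio ε ε₀ J y k) =
      (∑ j ∈ Iᶜ, (x j : ℂ) * cellMap ε ε₀ J y j) / simplexRest ε ε₀ J y := by
    rw [Finset.sum_div, ← Finset.sum_subset (Finset.subset_univ Iᶜ)]
    · refine Finset.sum_congr rfl fun j hj => ?_
      rw [ratio, if_neg (Finset.mem_compl.1 hj), if_neg (Finset.mem_compl.1 hj), mul_div_assoc]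
    · intro k _ hk
      exact if_pos (by simpa using hk)
  have h3 : (∏ k, if k ∈ I then Complex.exp (-(b k - c k + 1) *
      Complex.log (1 - x k * ratio ε ε₀ J y k)) else 1) =
      Complex.exp (∑ i ∈ I, (c i - b i - 1) * Complex.log (1 - x i / cellMap ε ε₀ J y i)) := by
    rw [prod_ite_compl, Finset.prod_const_one, mul_one, Complex.exp_sum]
    refine Finset.prod_congr rfl fun i hi => ?_
    rw [ratio, if_pos hi, ← div_eq_mul_inv]
    congr 1
    ring
  have h4 : ∑ k, (c k - b k - 1) * cellLog ε ε₀ x J (Sum.inr (Sum.inl k)) y =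
      ∑ i ∈ I, (c i - b i - 1) * logCoord ε ε₀ J y i +
      ∑ i ∈ I, (c i - b i - 1) * Complex.log (1 - x i / cellMap ε ε₀ J y i) +
      ∑ j ∈ Iᶜ, (c j - b j - 1) * hypLog ε ε₀ J y (hOne j) := by
    rw [← Finset.sum_add_sum_compl I, ← Finset.sum_add_distrib]
    congr 1
    · refine Finset.sum_congr rfl fun i hi => ?_
      simp only [cellLog, if_pos hi]
      ring
    · refine Finset.sum_congr rfl fun j hj => ?_
      simp only [cellLog, hypLog, if_neg (Finset.mem_compl.1 hj)]
  have h5 : ∑ k, (expo I a b c 0 (hZero k) - 1) * hypLog ε ε₀ J y (hZero k) =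
      ∑ k, b k * logCoord ε ε₀ J y k - ∑ k, logCoord ε ε₀ J y k +
      ∑ i ∈ I, (c i - b i - 1) * logCoord ε ε₀ J y i := by
    have : ∑ i ∈ I, (c i - b i - 1) * logCoord ε ε₀ J y i =
        ∑ k, (if k ∈ I then (c k - b k - 1) * logCoord ε ε₀ J y k else 0) := by
      rw [Finset.sum_ite_mem, Finset.univ_inter]
    rw [this, ← Finset.sum_sub_distrib, ← Finset.sum_add_distrib]
    refine Finset.sum_congr rfl fun k _ => ?_
    simp only [expo, hypLog, Pi.zero_apply]
    split_ifs <;> push_cast <;> ring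
  rw [h1, h2, h3, LoadedCell.branch, ← Complex.exp_add, ← Complex.exp_add, ← Complex.exp_add,
    sum_activeHyp, h5, Fintype.sum_sum_type, Fintype.sum_sum_type]
  congr 1
  simp only [expoI]
  have h6 : ∑ k, (c k - b k - 1) * (tubeCell h J).logP (Sum.inr (Sum.inl k)) y = _ := h4
  rw [h6]
  simp only [tubeCell, cellLog, hypLog, expo, Finset.univ_unique, Finset.sum_singleton,
    Pi.zero_apply, ite_self, Finset.sum_const_zero, Nat.cast_zero]
  ring

/-- The integral over a cell, expanded into monomial integrals. -/
theorem hasSum_monInt (h : Admissible ε ε₀ x) (a : ℂ) (b c : Fin m → ℂ) (J : Stratum I) :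
    HasSum (fun n => multTerm (· ∈ I) (fun k => b k - c k + 1) (fun k => (x k : ℂ)) a n *
      monInt h J (expo I a b c n)) ((tubeCell h J).integral (expoI a b c) phiI) := by
  have hcont : ∀ n, ContinuousOn (fun y =>
      Complex.exp (∑ L ∈ activeHyp I, (expo I a b c n L - 1) * hypLog ε ε₀ J y L) *
        (tubeCell h J).jacobian y) (cellDom ε ε₀ J) := fun n =>
    ContinuousOn.mul (continuousOn_finsetSum _ fun L hL =>
      (continuousOn_hypLog h J hL).const_mul _).cexp (continuous_jacobian h J).continuousOn
  -- The term of index `n` is the one of index `0` times powers of the ratios; one bound for the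
  -- former and the summable majorant in `ratioBound` control all terms on the cell.
  obtain ⟨C, hC⟩ := (isCompact_cellDom h J).exists_bound_of_continuousOn (hcont 0)
  have hterm : ∀ n, ∀ y ∈ cellDom ε ε₀ J,
      multTerm (· ∈ I) (fun k => b k - c k + 1) (fun k => (x k : ℂ)) a n *
        (Complex.exp (∑ L ∈ activeHyp I, (expo I a b c n L - 1) * hypLog ε ε₀ J y L) *
          (tubeCell h J).jacobian y) =
      multTerm (· ∈ I) (fun k => b k - c k + 1) (fun k => (x k : ℂ) * ratio ε ε₀ J y k) a n *
        (Complex.exp (∑ L ∈ activeHyp I, (expo I a b c 0 L - 1) * hypLog ε ε₀ J y L) *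
          (tubeCell h J).jacobian y) := by
    intro n y hy
    rw [exp_sum_expo h a b c n hy, ← multTerm_mul_prod_pow]
    ring
  have key := hasSum_setIntegral_of_isCompact (μ := volume) (isCompact_cellDom h J)
    (F := fun n y => multTerm (· ∈ I) (fun k => b k - c k + 1) (fun k => (x k : ℂ)) a n *
        (Complex.exp (∑ L ∈ activeHyp I, (expo I a b c n L - 1) * hypLog ε ε₀ J y L) *
          (tubeCell h J).jacobian y))
    (f := fun y => (tubeCell h J).branch (expoI a b c) y * phiI ((tubeCell h J).map y) *
      (tubeCell h J).jacobian y)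
    (u := fun n => multTerm (· ∈ I) (fun k => ‖b k - c k + 1‖) (ratioBound I ε ε₀ x) ‖a‖ n * C)
    (fun n => (hcont n).const_mul _)
    ((hasSum_multTerm_real (· ∈ I) (fun k => norm_nonneg _) (ratioBound_nonneg h) (norm_nonneg a)
      (fun k hk => ratioBound_lt_one h hk) (sum_ratioBound_lt_one h)).summable.mul_right C)
    (fun n y hy => ?_) (fun y hy => ?_)
  · simp only [integral_const_mul] at key
    exact key
  · rw [hterm n y hy, norm_mul]
    have h1 := norm_multTerm_le (p := (· ∈ I)) (al := fun k => b k - c k + 1) (a := a)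
      (norm_mul_ratio_le h hy) n
    exact mul_le_mul h1 (hC y hy) (norm_nonneg _) ((norm_nonneg _).trans h1)
  · simp only [hterm _ y hy]
    rw [branch_mul_phiI h a b c hy, mul_assoc]
    refine (hasSum_multTerm (· ∈ I) (fun k hk => (norm_mul_ratio_le h hy k).trans_lt
      (ratioBound_lt_one h hk)) (lt_of_le_of_lt (Finset.sum_le_sum fun k _ => ?_)
        (sum_ratioBound_lt_one (I := I) h))).mul_right _
    split_ifs
    · exact le_rfl
    · exact norm_mul_ratio_le h hy k

/-- Along the expansion the exponents change by integers only, so the denominators of the one cycle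
regularize every monomial. -/
theorem monod_expo (a : ℂ) (b c : Fin m → ℂ) (n : Fin m → ℕ) (L : Hyp m) :
    monod (expo I a b c n L) = dCoef I a b c L := by
  have h1 : ∀ z, monod z = Complex.exp (2 * Real.pi * Complex.I * z) - 1 := fun _ => rfl
  rcases L with k | k | u
  · rw [expo, dCoef, ← h1]
    split_ifs
    · rw [← monod_add_int (c k) (-1 - n k)]
      congr 1
      push_cast
      ring
    · exact_mod_cast monod_add_int (b k) (n k)
  · rfl
  · rw [expo, dCoef, ← h1,
      ← monod_add_int (-a) (1 - ((∑ k, if k ∈ I then 0 else n k : ℕ) : ℤ))]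
    congr 1
    push_cast
    ring

theorem dCoef_ne_zero {a : ℂ} {b c : Fin m → ℂ} (hb : ∀ k, ∀ n : ℤ, b k ≠ n)
    (hcb : ∀ k, ∀ n : ℤ, c k - b k ≠ n) (hc : ∀ k, ∀ n : ℤ, c k ≠ n) (ha : ∀ n : ℤ, a ≠ n)
    (L : Hyp m) : dCoef I a b c L ≠ 0 := by
  rcases L with k | k | u
  · rw [dCoef]
    split_ifs
    · exact monod_ne_zero (hc k)
    · exact monod_ne_zero (hb k)
  · exact monod_ne_zero (hcb k)
  · exact monod_ne_zero fun n h0 => ha (-n) (by push_cast; linear_combination -h0)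

/-- Linearity of the integral in the coefficients; it does not matter whether different strata yield
different loaded cells. -/
theorem cycleIntegral_eq_sum (h : Admissible ε ε₀ x) (a : ℂ) (b c : Fin m → ℂ) :
    cycleIntegral I a b c h = ∑ J : Stratum I, (∏ L ∈ J.1, orient L / dCoef I a b c L) *
      (tubeCell h J).integral (expoI a b c) phiI := by
  unfold cycleIntegral chainIntegral regCycle
  rw [← Finsupp.sum_finsetSum_index (fun _ => zero_mul _) fun _ _ _ => add_mul _ _ _]
  exact Finset.sum_congr rfl fun J _ => Finsupp.sum_single_index (zero_mul _)

/-- The finite sum over the strata is interchanged with the expansion. For fixed `n` the sum over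
the strata is a regularized monomial integral, whose gamma values combine into the term of `F_A`. -/
theorem hasSum_termFA (h : Admissible ε ε₀ x) {a : ℂ} {b c : Fin m → ℂ}
    (hb : ∀ k, ∀ n : ℤ, b k ≠ n) (hcb : ∀ k, ∀ n : ℤ, c k - b k ≠ n)
    (hac : ∀ S : Finset (Fin m), ∀ n : ℤ, a - ∑ i ∈ S, c i ≠ n) (hc : ∀ k, ∀ n : ℤ, c k ≠ n) :
    HasSum (fun n => (∏ i ∈ I, Complex.Gamma (c i - 1)) *
      (∏ j ∈ Iᶜ, Complex.Gamma (b j) * Complex.Gamma (c j - b j) / Complex.Gamma (c j)) *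
      (Complex.Gamma (1 - a) / Complex.Gamma (∑ i ∈ I, c i - a - I.card + 1)) *
      termFA (a + I.card - ∑ i ∈ I, c i) (bShift I b c) (cShift I c) (fun k => (x k : ℂ)) n)
      (cycleIntegral I a b c h) := by
  have ha : ∀ n : ℤ, a ≠ n := fun n h0 => hac ∅ n (by simpa using h0)
  rw [cycleIntegral_eq_sum]
  refine (hasSum_sum fun J (_ : J ∈ Finset.univ) =>
    (hasSum_monInt h a b c J).mul_left (∏ L ∈ J.1, orient L / dCoef I a b c L)).congr_fun ?_
  intro n
  rw [← multTerm_mul_Gamma hb hac hc, ← sum_monInt h fun L _ => by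
    rw [monod_expo]
    exact dCoef_ne_zero hb hcb hc ha L, Finset.mul_sum]
  refine Finset.sum_congr rfl fun J _ => ?_
  simp only [monod_expo]
  ring

end expansion

end LauricellaFA

/-! ### The integral over the regularized cycle as a series of Lauricella -/

theorem mainTheorem2 (m : ℕ) (I : Finset (Fin m)) (a : ℂ) (b c : Fin m → ℂ)
    (hb : ∀ k, ∀ n : ℤ, b k ≠ n)
    (hcb : ∀ k, ∀ n : ℤ, c k - b k ≠ n)
    (hac : ∀ S : Finset (Fin m), ∀ n : ℤ, a - ∑ i ∈ S, c i ≠ n)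
    (hc : ∀ k, ∀ n : ℤ, c k ≠ n)
    (ε : Fin m → ℝ) (ε₀ : ℝ) (x : Fin m → ℝ) (h : LauricellaFA.Admissible ε ε₀ x) :
    Summable (LauricellaFA.termFA (a + I.card - ∑ i ∈ I, c i)
        (LauricellaFA.bShift I b c) (LauricellaFA.cShift I c) (fun k => (x k : ℂ))) ∧
    LauricellaFA.cycleIntegral I a b c h =
      (∏ i ∈ I, Complex.Gamma (c i - 1)) *
      (∏ j ∈ Iᶜ, Complex.Gamma (b j) * Complex.Gamma (c j - b j) / Complex.Gamma (c j)) *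
      (Complex.Gamma (1 - a) / Complex.Gamma (∑ i ∈ I, c i - a - I.card + 1)) *
      LauricellaFA.seriesFA (a + I.card - ∑ i ∈ I, c i)
        (LauricellaFA.bShift I b c) (LauricellaFA.cShift I c) (fun k => (x k : ℂ)) := by
  have key := LauricellaFA.hasSum_termFA (I := I) h hb hcb hac hc
  -- All arguments of `Γ` here are non-integral, so the constant can be cancelled from the
  -- convergent series. Summability over a countable set in `ℂ` is absolute convergence.
  have hK : (∏ i ∈ I, Complex.Gamma (c i - 1)) *
      (∏ j ∈ Iᶜ, Complex.Gamma (b j) * Complex.Gamma (c j - b j) / Complex.Gamma (c j)) *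
      (Complex.Gamma (1 - a) / Complex.Gamma (∑ i ∈ I, c i - a - I.card + 1)) ≠ 0 := by
    refine mul_ne_zero (mul_ne_zero (Finset.prod_ne_zero_iff.2 fun i _ => ?_)
      (Finset.prod_ne_zero_iff.2 fun j _ => div_ne_zero (mul_ne_zero ?_ ?_) ?_))
      (div_ne_zero ?_ ?_)
    · exact LauricellaFA.Gamma_ne_zero_of_ne_int fun n h0 => hc i (n + 1) (by
        push_cast
        linear_combination h0)
    · exact LauricellaFA.Gamma_ne_zero_of_ne_int (hb j)
    · exact LauricellaFA.Gamma_ne_zero_of_ne_int (hcb j)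
    · exact LauricellaFA.Gamma_ne_zero_of_ne_int (hc j)
    · exact LauricellaFA.Gamma_ne_zero_of_ne_int fun n h0 => hac ∅ (1 - n) (by
        push_cast
        rw [Finset.sum_empty]
        linear_combination -h0)
    · exact LauricellaFA.Gamma_ne_zero_of_ne_int fun n h0 => hac I (1 - I.card - n) (by
        push_cast
        linear_combination -h0)
  have hs := (summable_mul_left_iff hK).1 key.summable
  exact ⟨hs, by rw [LauricellaFA.seriesFA, ← tsum_mul_left]; exact key.tsum_eq.symm⟩
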